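/- **Setting.** Let $\Omega\subset\mathbb R^2$ be a bounded polygonal domain and $a(v,w)=\int_\Omega D^2v:D^2w\,dx$. *Discretization.* Let $\Omega_1,\dots,\Omega_n$ be open rectangles (with sides parallel to the axes) that cover $\bar\Omega$, and let $\phi_1,\dots,\phi_n\in W^2_\infty(\mathbb R^2)$ be such that $\phi_i$ is the tensor product of two one-dimensional flat-top functions (functions with values in $[0,1]$ that vanish outside the corresponding side of $\Omega_i$ and equal $1$ on a nondegenerate closed subinterval of it), $\sum_i\phi_i=1$ on $\Omega$ and $|\phi_i|_{W^m_\infty(\mathbb R^2)}\le C_\phi(\operatorname{diam}\Omega_i)^{-m}$ for $0\le m\le 2$. Let $V_i$ be a space of biquadratic polynomials that vanish together with their gradients on $\partial\Omega\cap\Omega_i$, where $V_i$ is the space of all biquadratic polynomials if $\partial\Omega\cap\Omega_i=\emptyset$. Let $\mathcal N_i\subset\Omega$ be a finite set of nodes in the flat-top region $\{\phi_i=1\}$ such that every function on $\mathcal N_i$ is interpolated by exactly one member of $V_i$. Assume, with a mesh size $h>0$ and constants $\rho,\sigma,M$, that $\operatorname{diam}\Omega_i\le\rho h$, that the sides of the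 rectangle where both one-dimensional factors of $\phi_i$ equal $1$ are at least $h/\rho$, that a point of the plane belongs to at most $M$ patches, and that the nodal basis functions of $V_i$ are bounded by $\sigma$ on $\Omega_i$. Put $V_h=\sum_i\phi_iV_i\subset H^2_0(\Omega)$ and $\mathcal N_h=\bigcup_i\mathcal N_i$. For $\widetilde{\mathcal N}_h\subset\mathcal N_h$ let $\widetilde V_h$ be the space of all $v\in V_h$ that vanish at the nodes in $\mathcal N_h\setminus\widetilde{\mathcal N}_h$, and define $\tilde A_h:\widetilde V_h\to\widetilde V_h'$ by $\langle\tilde A_hv,w\rangle=a(v,w)$. *Domain decomposition.* Let $D_1,\dots,D_J$ be open sets with $\bigcup_jD_j=\Omega$ and without slits ($\Omega\cap\operatorname{int}\overline{D_j}=D_j$) whose boundaries are contained in the union of $\partial\Omega$ and the boundaries of the patches, with $H/C_H\le\operatorname{diam}D_j\le C_HH$ for an $H>0$, such that any point of $\Omega$ belongs to at most $N_c$ of them. Let $\psi_1,\dots,\psi_J\in W^2_\infty(\mathbb R^2)$ be nonnegative with $\sum_j\psi_j=1$ on $\bar\Omega$, $\psi_j=0$ on $\Omega\setminus\bar D_j$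 and $|\psi_j|_{W^k_\infty(\Omega)}\le C_\dagger\delta^{-k}$ for $k=0,1,2$, where $h\le\delta\le\operatorname{diam}\Omega$. Let $\widetilde V_j$ be the subspace of $\widetilde V_h$ of the functions that vanish at all the nodes outside $D_j$, let $I_j:\widetilde V_j\to\widetilde V_h$ be the natural injection, define $A_j:\widetilde V_j\to\widetilde V_j'$ by $\langle A_jv,w\rangle=a(v,w)$, and let $B_{OL}=\sum_{j=1}^JI_jA_j^{-1}I_j^t:\widetilde V_h'\to\widetilde V_h$. **Theorem.** The operators $A_j$ are invertible, $B_{OL}\tilde A_h$ is diagonalizable with positive eigenvalues, and $$\kappa(B_{OL}\tilde A_h)=\frac{\lambda_{\max}(B_{OL}\tilde A_h)}{\lambda_{\min}(B_{OL}\tilde A_h)}\le C\delta^{-4}$$ (for $\widetilde V_h\ne\{0\}$), where the positive constant $C$ depends only on $\Omega$, $\rho$, $C_\phi$, $\sigma$, $M$, $C_H$, $C_\dagger$ and $N_c$; in particular it is independent of $h$, $H$, $J$, $\delta$ and $\widetilde{\mathcal N}_h$. -/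

import Mathlib

open MeasureTheory Set

noncomputable section

namespace PlateSchwarz

/-- The Euclidean plane `ℝ²`. -/
abbrev Plane : Type := EuclideanSpace ℝ (Fin 2)

/-- A bounded polygonal domain: a bounded, connected, nonempty open set whose boundary is a finite
union of nondegenerate line segments. -/
structure IsPolygonalDomain (Ω : Set Plane) : Prop where
  isOpen : IsOpen Ω
  isConnected : IsConnected Ω
  isBounded : Bornology.IsBounded Ω
  frontier_eq : ∃ S : Finset (Plane × Plane), (∀ s ∈ S, s.1 ≠ s.2) ∧
    frontier Ω = ⋃ s ∈ S, segment ℝ s.1 s.2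

/-! ### The space `W²_∞(ℝ²)` -/

/-- Membership in `W²_∞(ℝ²)`, for the continuous representative: `f` is bounded, Lipschitz, of class
`C¹`, and its gradient is Lipschitz. By Rademacher's theorem the gradient of such a function is
differentiable almost everywhere, and its classical second derivatives, defined almost everywhere,
are its weak second derivatives. -/
structure IsW2Inf (f : Plane → ℝ) : Prop where
  contDiff : ContDiff ℝ 1 f
  bounded : ∃ K : ℝ, ∀ x, |f x| ≤ K
  lipschitz : ∃ K, LipschitzWith K f
  lipschitz_fderiv : ∃ K, LipschitzWith K (fderiv ℝ f)

/-- The bounds `|f|_{W^k_∞(U)} ≤ c k` for `k = 0, 1, 2`. -/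
def W2InfBound (f : Plane → ℝ) (U : Set Plane) (c : ℕ → ℝ) : Prop :=
  ∀ k ≤ 2, ∀ᵐ x ∂(volume.restrict U), ‖iteratedFDeriv ℝ k f x‖ ≤ c k

/-- The second partial derivative `∂²f/∂x_i∂x_j` at `x`. -/
def hess (f : Plane → ℝ) (x : Plane) (i j : Fin 2) : ℝ :=
  fderiv ℝ (fderiv ℝ f) x (EuclideanSpace.single i 1) (EuclideanSpace.single j 1)

theorem IsW2Inf.differentiable {f : Plane → ℝ} (hf : IsW2Inf f) : Differentiable ℝ f :=
  hf.contDiff.differentiable one_ne_zero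

theorem IsW2Inf.zero : IsW2Inf (0 : Plane → ℝ) := by
  refine ⟨contDiff_const, ⟨0, by simp⟩, ⟨0, LipschitzWith.const 0⟩, ⟨0, ?_⟩⟩
  have : fderiv ℝ (0 : Plane → ℝ) = fun _ => 0 := by ext1 x; simp
  rw [this]
  exact LipschitzWith.const 0

theorem IsW2Inf.add {f g : Plane → ℝ} (hf : IsW2Inf f) (hg : IsW2Inf g) : IsW2Inf (f + g) := by
  obtain ⟨b₁, h₁⟩ := hf.bounded
  obtain ⟨b₂, h₂⟩ := hg.bounded
  obtain ⟨K₁, k₁⟩ := hf.lipschitz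
  obtain ⟨K₂, k₂⟩ := hg.lipschitz
  obtain ⟨L₁, l₁⟩ := hf.lipschitz_fderiv
  obtain ⟨L₂, l₂⟩ := hg.lipschitz_fderiv
  refine ⟨hf.contDiff.add hg.contDiff,
    ⟨b₁ + b₂, fun x => (abs_add_le _ _).trans (add_le_add (h₁ x) (h₂ x))⟩,
    ⟨_, k₁.add k₂⟩, ⟨L₁ + L₂, ?_⟩⟩
  have : fderiv ℝ (f + g) = fun x => fderiv ℝ f x + fderiv ℝ g x := by
    ext1 x
    exact fderiv_add (hf.differentiable x) (hg.differentiable x)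
  rw [this]
  exact l₁.add l₂

theorem IsW2Inf.smul {f : Plane → ℝ} (c : ℝ) (hf : IsW2Inf f) : IsW2Inf (c • f) := by
  obtain ⟨b, hb⟩ := hf.bounded
  obtain ⟨K, hK⟩ := hf.lipschitz
  obtain ⟨L, hL⟩ := hf.lipschitz_fderiv
  refine ⟨hf.contDiff.const_smul c, ⟨|c| * b, fun x => ?_⟩, ⟨_, (lipschitzWith_smul c).comp hK⟩,
    ⟨‖c‖₊ * L, ?_⟩⟩
  · simpa [abs_mul] using mul_le_mul_of_nonneg_left (hb x) (abs_nonneg c)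
  · have : fderiv ℝ (c • f) = fun x => c • fderiv ℝ f x := by
      ext1 x
      exact fderiv_const_smul (hf.differentiable x) c
    rw [this]
    exact (lipschitzWith_smul c).comp hL

/-- The space of compactly supported functions in `W²_∞(ℝ²)`. -/
def W2c : Submodule ℝ (Plane → ℝ) where
  carrier := {f | IsW2Inf f ∧ HasCompactSupport f}
  zero_mem' := ⟨IsW2Inf.zero, HasCompactSupport.zero⟩
  add_mem' hf hg := ⟨hf.1.add hg.1, hf.2.add hg.2⟩
  smul_mem' c _ hf := ⟨hf.1.smul c, hf.2.smul_left (f := fun _ => c)⟩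

theorem hess_ae_add {f g : Plane → ℝ} (hf : IsW2Inf f) (hg : IsW2Inf g) :
    ∀ᵐ x, ∀ i j, hess (f + g) x i j = hess f x i j + hess g x i j := by
  obtain ⟨L₁, l₁⟩ := hf.lipschitz_fderiv
  obtain ⟨L₂, l₂⟩ := hg.lipschitz_fderiv
  have h : fderiv ℝ (f + g) = fderiv ℝ f + fderiv ℝ g := by
    ext1 x
    exact fderiv_add (hf.differentiable x) (hg.differentiable x)
  filter_upwards [l₁.ae_differentiableAt (μ := volume), l₂.ae_differentiableAt (μ := volume)]
    with x h₁ h₂ i j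
  simp only [hess, h]
  rw [fderiv_add h₁ h₂]
  rfl

theorem hess_ae_smul {f : Plane → ℝ} (c : ℝ) (hf : IsW2Inf f) :
    ∀ᵐ x, ∀ i j, hess (c • f) x i j = c * hess f x i j := by
  obtain ⟨L, l⟩ := hf.lipschitz_fderiv
  have h : fderiv ℝ (c • f) = c • fderiv ℝ f := by
    ext1 x
    exact fderiv_const_smul (hf.differentiable x) c
  filter_upwards [l.ae_differentiableAt (μ := volume)] with x h₁ i j
  simp only [hess, h]
  rw [fderiv_const_smul h₁ c]
  rfl

theorem hess_measurable (f : Plane → ℝ) (i j : Fin 2) : Measurable fun x => hess f x i j := by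
  have h := measurable_fderiv_apply_const ℝ (fderiv ℝ f) (EuclideanSpace.single i (1 : ℝ))
  exact (ContinuousLinearMap.apply ℝ ℝ (EuclideanSpace.single j (1 : ℝ) : Plane)).measurable.comp h

theorem hess_bounded {f : Plane → ℝ} (hf : IsW2Inf f) :
    ∃ K : ℝ, ∀ x i j, |hess f x i j| ≤ K := by
  obtain ⟨L, l⟩ := hf.lipschitz_fderiv
  refine ⟨L, fun x i j => ?_⟩
  have h := norm_fderiv_le_of_lipschitz ℝ l (x₀ := x)
  have h1 := (fderiv ℝ (fderiv ℝ f) x).le_opNorm (EuclideanSpace.single i 1)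
  have h2 := (fderiv ℝ (fderiv ℝ f) x (EuclideanSpace.single i 1)).le_opNorm
    (EuclideanSpace.single j 1)
  simp only [PiLp.norm_single, norm_one, mul_one] at h1 h2
  exact (h2.trans h1).trans h

theorem hess_eq_zero {f : Plane → ℝ} {x : Plane} (hx : x ∉ tsupport f) (i j : Fin 2) :
    hess f x i j = 0 := by
  have h : x ∉ tsupport (fderiv ℝ (fderiv ℝ f)) := fun hx' =>
    hx (tsupport_fderiv_subset ℝ (tsupport_fderiv_subset ℝ hx'))
  simp [hess, image_eq_zero_of_notMem_tsupport h]

theorem hess_mul_integrable {f g : Plane → ℝ} (hf : f ∈ W2c) (hg : g ∈ W2c) (i j : Fin 2) :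
    Integrable fun x => hess f x i j * hess g x i j := by
  obtain ⟨K₁, k₁⟩ := hess_bounded hf.1
  obtain ⟨K₂, k₂⟩ := hess_bounded hg.1
  have hs : Function.support (fun x => hess f x i j * hess g x i j) ⊆ tsupport f := by
    intro x hx
    by_contra h
    exact hx (by simp [hess_eq_zero h])
  rw [← integrableOn_iff_integrable_of_support_subset hs]
  have : IsFiniteMeasure (volume.restrict (tsupport f)) :=
    ⟨by simpa using (IsCompact.measure_lt_top hf.2)⟩
  refine Integrable.of_bound
    ((hess_measurable f i j).mul (hess_measurable g i j)).aestronglyMeasurable (K₁ * K₂)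
    (Filter.Eventually.of_forall fun x => ?_)
  rw [norm_mul]
  exact mul_le_mul (k₁ x i j) (k₂ x i j) (norm_nonneg _) ((abs_nonneg _).trans (k₁ x i j))

/-- The integral `∫_Ω D²v : D²w dx`. -/
def plateEnergy (Ω : Set Plane) (v w : Plane → ℝ) : ℝ :=
  ∫ x in Ω, ∑ i, ∑ j, hess v x i j * hess w x i j

theorem plateEnergy_integrable (Ω : Set Plane) {v w : Plane → ℝ} (hv : v ∈ W2c) (hw : w ∈ W2c) :
    Integrable (fun x => ∑ i, ∑ j, hess v x i j * hess w x i j) (volume.restrict Ω) :=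
  (integrable_finsetSum _ fun i _ => integrable_finsetSum _ fun j _ =>
    hess_mul_integrable hv hw i j).restrict

theorem plateEnergy_comm (Ω : Set Plane) (v w : Plane → ℝ) :
    plateEnergy Ω v w = plateEnergy Ω w v := by
  simp only [plateEnergy, mul_comm]

theorem plateEnergy_add_left (Ω : Set Plane) {u v w : Plane → ℝ}
    (hu : u ∈ W2c) (hv : v ∈ W2c) (hw : w ∈ W2c) :
    plateEnergy Ω (u + v) w = plateEnergy Ω u w + plateEnergy Ω v w := by
  simp only [plateEnergy]
  rw [← integral_add (plateEnergy_integrable Ω hu hw) (plateEnergy_integrable Ω hv hw)]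
  refine integral_congr_ae (ae_restrict_of_ae ?_)
  filter_upwards [hess_ae_add hu.1 hv.1] with x hx
  simp only [hx, add_mul, Finset.sum_add_distrib]

theorem plateEnergy_smul_left (Ω : Set Plane) (c : ℝ) {v : Plane → ℝ} (hv : v ∈ W2c)
    (w : Plane → ℝ) : plateEnergy Ω (c • v) w = c * plateEnergy Ω v w := by
  simp only [plateEnergy]
  rw [← integral_const_mul]
  refine integral_congr_ae (ae_restrict_of_ae ?_)
  filter_upwards [hess_ae_smul c hv.1] with x hx
  simp only [hx, mul_assoc, Finset.mul_sum]

/-- The bilinear form `a(v, w) = ∫_Ω D²v : D²w dx` of the plate. -/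
def plateForm (Ω : Set Plane) : W2c →ₗ[ℝ] W2c →ₗ[ℝ] ℝ :=
  LinearMap.mk₂ ℝ (fun v w => plateEnergy Ω v w)
    (fun u v w => plateEnergy_add_left Ω u.2 v.2 w.2)
    (fun c v w => plateEnergy_smul_left Ω c v.2 w)
    (fun u v w => by
      rw [plateEnergy_comm Ω u, plateEnergy_comm Ω u, plateEnergy_comm Ω u]
      exact plateEnergy_add_left Ω v.2 w.2 u.2)
    (fun c v w => by
      rw [plateEnergy_comm Ω v, plateEnergy_comm Ω v]
      exact plateEnergy_smul_left Ω c w.2 v)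

/-! ### The flat-top partition of unity method -/

/-- A one-dimensional flat-top function: it takes values in `[0, 1]`, vanishes outside `(a, b)`
and equals `1` on the nondegenerate interval `[α, β] ⊆ (a, b)`. -/
structure IsFlatTop (a α β b : ℝ) (f : ℝ → ℝ) : Prop where
  lt_left : a < α
  lt_mid : α < β
  lt_right : β < b
  nonneg : ∀ t, 0 ≤ f t
  le_one : ∀ t, f t ≤ 1
  eq_zero : ∀ t, t ∉ Ioo a b → f t = 0
  eq_one : ∀ t ∈ Icc α β, f t = 1

/-- The space of biquadratic polynomials, spanned by `x₁ ^ k * x₂ ^ l` with `k, l ≤ 2`. -/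
def biquadratics : Submodule ℝ (Plane → ℝ) :=
  Submodule.span ℝ (range fun e : Fin 3 × Fin 3 =>
    fun x : Plane => x 0 ^ (e.1 : ℕ) * x 1 ^ (e.2 : ℕ))

/-- A flat-top partition of unity discretization of the clamped plate on `Ω`, with rectangular
patches and nodal biquadratic local spaces. -/
structure PUM (Ω : Set Plane) where
  /-- the number of patches -/
  n : ℕ
  /-- the patch `i` is the open rectangle with sides `(lo i k, hi i k)`, `k = 0, 1` -/
  lo : Fin n → Fin 2 → ℝ
  hi : Fin n → Fin 2 → ℝ
  /-- the intervals `[flo i k, fhi i k]`, `k = 0, 1`, on which the one-dimensional functions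
  are `1` -/
  flo : Fin n → Fin 2 → ℝ
  fhi : Fin n → Fin 2 → ℝ
  /-- the one-dimensional flat-top functions -/
  bump : Fin n → Fin 2 → ℝ → ℝ
  /-- the local spaces -/
  V : Fin n → Submodule ℝ (Plane → ℝ)
  /-- the local nodes -/
  nodes : Fin n → Finset Plane
  flatTop : ∀ i k, IsFlatTop (lo i k) (flo i k) (fhi i k) (hi i k) (bump i k)
  /-- the patches cover the closure of `Ω` -/
  cover : closure Ω ⊆ ⋃ i, {x | ∀ k, x k ∈ Ioo (lo i k) (hi i k)}
  /-- the partition functions are tensor products in `W²_∞(ℝ²)` that add up to `1` on `Ω` -/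
  regular : ∀ i, IsW2Inf fun x => bump i 0 (x 0) * bump i 1 (x 1)
  sum_eq_one : ∀ x ∈ Ω, ∑ i, bump i 0 (x 0) * bump i 1 (x 1) = 1
  /-- the members of `V i` are biquadratic polynomials ... -/
  V_le : ∀ i, V i ≤ biquadratics
  /-- ... that satisfy the homogeneous Dirichlet boundary conditions of the clamped plate
  (vanishing value and gradient) on the part of `∂Ω` inside the patch ... -/
  V_clamped : ∀ i, ∀ q ∈ V i, ∀ z ∈ frontier Ω, (∀ k, z k ∈ Ioo (lo i k) (hi i k)) →
    q z = 0 ∧ fderiv ℝ q z = 0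
  /-- ... and all biquadratic polynomials are used on a patch that contains no point of `∂Ω` -/
  V_interior : ∀ i, (∀ z ∈ frontier Ω, ¬ ∀ k, z k ∈ Ioo (lo i k) (hi i k)) → V i = biquadratics
  /-- the nodes of the patch `i` lie in `Ω`, in the flat-top region of the patch -/
  nodes_subset : ∀ i, ∀ p ∈ nodes i, p ∈ Ω ∧ bump i 0 (p 0) * bump i 1 (p 1) = 1
  /-- the values at the nodes of the patch are the degrees of freedom of the local space: local
  nodal interpolation is uniquely defined -/
  unisolvent : ∀ i, ∀ g : Plane → ℝ, ∃! q : Plane → ℝ, q ∈ V i ∧ ∀ p ∈ nodes i, q p = g p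

namespace PUM

variable {Ω : Set Plane} (P : PUM Ω)

/-- The patch `Ω_i`, an open rectangle. -/
def patch (i : Fin P.n) : Set Plane := {x | ∀ k, x k ∈ Ioo (P.lo i k) (P.hi i k)}

/-- The partition of unity function `φ_i`. -/
def phi (i : Fin P.n) (x : Plane) : ℝ := P.bump i 0 (x 0) * P.bump i 1 (x 1)

/-- Regularity of the discretization with mesh size `h`: the patches and their flat-top regions are
of size comparable to `h` (constant `ρ`), a point lies in at most `M` patches, the partition
functions satisfy `|φ_i|_{W^m_∞(ℝ²)} ≤ Cφ (diam Ω_i)^{-m}`, and the local nodal basis functions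
are bounded by `σ` on the patches (that is, the nodes of a patch are placed uniformly well, as for
a tensor product grid whose spacing is comparable to `h`). -/
structure IsRegular (h ρ Cφ σ : ℝ) (M : ℕ) : Prop where
  diam_le : ∀ i, Metric.diam (P.patch i) ≤ ρ * h
  le_flat : ∀ i k, h ≤ ρ * (P.fhi i k - P.flo i k)
  overlap : ∀ x : Plane, {i | x ∈ P.patch i}.ncard ≤ M
  phi_bound : ∀ i, W2InfBound (P.phi i) univ fun m => Cφ / Metric.diam (P.patch i) ^ m
  nodal_basis_bound : ∀ i, ∀ p ∈ P.nodes i, ∀ q ∈ P.V i, q p = 1 →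
    (∀ p' ∈ P.nodes i, p' ≠ p → q p' = 0) → ∀ x ∈ P.patch i, |q x| ≤ σ

/-- The set `𝒩_h` of all nodes. -/
def nodeSet : Set Plane := ⋃ i, (P.nodes i : Set Plane)

/-- The generalized finite element space `V_h = ∑ φ_i V_i`. Its members are written as functions on
the plane; only their restrictions to `Ω`, which lie in `H²₀(Ω)`, enter the form `plateForm Ω`.
The products `φ_i q` are compactly supported `W²_∞(ℝ²)` functions, so that passing to `W2c`
removes nothing. -/
def Vh : Submodule ℝ W2c :=
  (⨆ i, (P.V i).map (LinearMap.mulLeft ℝ (P.phi i))).comap W2c.subtype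

/-- The subspace of the functions in `V_h` that vanish at all the nodes outside `S`. -/
def VhOn (S : Set Plane) : Submodule ℝ W2c where
  carrier := {v | v ∈ P.Vh ∧ ∀ p ∈ P.nodeSet, p ∉ S → (v : Plane → ℝ) p = 0}
  zero_mem' := ⟨zero_mem _, fun _ _ _ => rfl⟩
  add_mem' {v w} hv hw := ⟨add_mem hv.1 hw.1, fun p hp hS => by
    have h1 := hv.2 p hp hS
    have h2 := hw.2 p hp hS
    simp [h1, h2]⟩
  smul_mem' c v hv := ⟨Submodule.smul_mem _ c hv.1, fun p hp hS => by
    have h1 := hv.2 p hp hS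
    simp [h1]⟩

/-- The space `Ṽ_h`, the range of the truncation operator `T̃_h` that keeps the nodal values at the
nodes in `Ñ_h` and sets the other ones to zero: it consists of the functions in `V_h` that vanish
at the nodes outside `Ñ_h`. -/
def Vt (Nt : Set Plane) : Submodule ℝ W2c := P.VhOn Nt

/-- The space `Ṽ_j` of the functions in `Ṽ_h` that vanish at all the nodes outside `D_j`. -/
def Vloc (Nt D : Set Plane) : Submodule ℝ W2c := P.Vt Nt ⊓ P.VhOn D

end PUM

/-! ### Overlapping domain decomposition -/

/-- An overlapping domain decomposition of `Ω` into `J` subdomains whose boundaries are aligned with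
the boundaries of the patches, together with a partition of unity subordinate to it.
The parameters: `H` is comparable to the diameters of the subdomains (constant `CH`), `δ` is the
overlap, `Cd` is the constant in the bounds for the partition of unity, and a point belongs to at
most `Nc` subdomains. -/
structure Decomposition {Ω : Set Plane} (P : PUM Ω) (J : ℕ) (H δ CH Cd : ℝ) (Nc : ℕ) where
  D : Fin J → Set Plane
  ψ : Fin J → Plane → ℝ
  isOpen : ∀ j, IsOpen (D j)
  iUnion_eq : ⋃ j, D j = Ω
  /-- a subdomain lies on one side of its boundary inside `Ω` (it has no slits) -/
  no_slit : ∀ j, Ω ∩ interior (closure (D j)) ⊆ D j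
  aligned : ∀ j, frontier (D j) ⊆ frontier Ω ∪ ⋃ i, frontier (P.patch i)
  diam_le : ∀ j, Metric.diam (D j) ≤ CH * H
  le_diam : ∀ j, H ≤ CH * Metric.diam (D j)
  overlap : ∀ x ∈ Ω, {j | x ∈ D j}.ncard ≤ Nc
  ψ_regular : ∀ j, IsW2Inf (ψ j)
  ψ_sum : ∀ x ∈ closure Ω, ∑ j, ψ j x = 1
  ψ_nonneg : ∀ j x, 0 ≤ ψ j x
  ψ_eq_zero : ∀ j, ∀ x ∈ Ω \ closure (D j), ψ j x = 0
  ψ_bound : ∀ j, W2InfBound (ψ j) Ω fun k => Cd * (δ ^ k)⁻¹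

/-! ### The preconditioner -/

/-- The operator `A : U → U'` defined by `⟨A v, w⟩ = a(v, w)` for `v, w ∈ U`. -/
def stiffness (Ω : Set Plane) (U : Submodule ℝ W2c) : U →ₗ[ℝ] Module.Dual ℝ U :=
  U.subtype.dualMap ∘ₗ plateForm Ω ∘ₗ U.subtype

/-- The inverse of a bijective linear map (and `0` if the map is not bijective). -/
def linInv {E F : Type*} [AddCommMonoid E] [Module ℝ E] [AddCommMonoid F] [Module ℝ F]
    (A : E →ₗ[ℝ] F) : F →ₗ[ℝ] E :=
  open Classical in
  if h : Function.Bijective A then ((LinearEquiv.ofBijective A h).symm : F →ₗ[ℝ] E) else 0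

section

variable {Ω : Set Plane} {P : PUM Ω} {J : ℕ} {H δ CH Cd : ℝ} {Nc : ℕ}

/-- The operator `A_j : Ṽ_j → Ṽ_j'`. -/
def Aj (DD : Decomposition P J H δ CH Cd Nc) (Nt : Set Plane) (j : Fin J) :
    P.Vloc Nt (DD.D j) →ₗ[ℝ] Module.Dual ℝ (P.Vloc Nt (DD.D j)) :=
  stiffness Ω (P.Vloc Nt (DD.D j))

/-- The natural injection `I_j : Ṽ_j → Ṽ_h`. -/
def Ij (DD : Decomposition P J H δ CH Cd Nc) (Nt : Set Plane) (j : Fin J) :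
    P.Vloc Nt (DD.D j) →ₗ[ℝ] P.Vt Nt :=
  Submodule.inclusion inf_le_left

/-- The one-level additive Schwarz preconditioner `B_OL = ∑ I_j A_j⁻¹ I_jᵗ`. -/
def BOL (DD : Decomposition P J H δ CH Cd Nc) (Nt : Set Plane) :
    Module.Dual ℝ (P.Vt Nt) →ₗ[ℝ] P.Vt Nt :=
  ∑ j, Ij DD Nt j ∘ₗ linInv (Aj DD Nt j) ∘ₗ (Ij DD Nt j).dualMap

/-- The truncated stiffness operator `Ã_h : Ṽ_h → Ṽ_h'`. -/
def Ah (P : PUM Ω) (Nt : Set Plane) : P.Vt Nt →ₗ[ℝ] Module.Dual ℝ (P.Vt Nt) :=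
  stiffness Ω (P.Vt Nt)

/-- The preconditioned operator `B_OL Ã_h : Ṽ_h → Ṽ_h`. -/
def BOLAh (DD : Decomposition P J H δ CH Cd Nc) (Nt : Set Plane) : Module.End ℝ (P.Vt Nt) :=
  BOL DD Nt ∘ₗ Ah P Nt

end

/-- The condition number `κ(T) = λ_max(T) / λ_min(T)`, the quotient of the largest and the smallest
eigenvalue of `T` (on a finite-dimensional space there are finitely many). -/
def condNumber {E : Type*} [AddCommGroup E] [Module ℝ E] (T : Module.End ℝ E) : ℝ :=
  sSup {μ : ℝ | T.HasEigenvalue μ} / sInf {μ : ℝ | T.HasEigenvalue μ}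

end PlateSchwarz

end

namespace PlateSchwarz

/-! ### Second derivatives -/

/-! By the abstract theory of additive Schwarz methods, `BOLAh` is the sum of the `a`-orthogonal
projections onto the local spaces. It is symmetric for `a`, and its eigenvalues lie in
$[\Lambda^{-1},K]$ as soon as $a(\sum w_j,\sum w_j)\le K\sum a(w_j,w_j)$ for all local $w_j$ and
every $v$ splits as $v=\sum w_j$ with $\sum a(w_j,w_j)\le\Lambda a(v,v)$ (`schwarz_bound`). Hence
$\kappa\le K\Lambda$.

The bound with $K=9MN_c$ is pointwise: near almost every point only boundedly many of the $w_j$ are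
nonzero (`card_active_le`, `plateForm_sum_le`).

The splitting is $w_j=\Pi_h(\psi_jv)$ with the nodal interpolant $\Pi_h$
(`exists_stable_decomposition`). Because of the flat tops the nodal values are degrees of freedom of
$V_h$, so $w_j$ has the nodal values $\psi_jv$. These vanish outside $D_j$ and wherever $v$
vanishes, and they add up to $v$. Its stability has two ingredients. The product rule and the
Poincaré inequality for the extension of $v$ by zero give $\sum_j|\psi_jv|_{H^2}^2\le
C\delta^{-4}|v|_{H^2}^2$ (`Decomposition.sum_integral_hessNorm_le`). The interpolation is stable in
the $H^2$ seminorm (`PUM.IsRegular.integral_hessNorm_interp_le`).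

For the second ingredient, interpolation uses point values only, so it suffices to bound $w$ up to
an affine function by $Ch|w|_{H^2}$ on a disc of radius comparable to $h$. Away from the boundary
the local spaces reproduce affine functions (`exists_affine_approx`). Near the boundary they need
not, but $w$ and its gradient vanish on a nearby boundary segment, which bounds $w$ itself
(`abs_le_of_zero_on_segment`). Both estimates come from Taylor expansion at a point on well-chosen
lines (`exists_taylor_point`). Inverse estimates turn the values into second derivatives at the cost
of $h^{-2}$, and integrating over discs of area $\sim h^2$ balances the powers of $h$. -/

/-- The operator norm of the second derivative. -/
noncomputable def hessNorm (f : Plane → ℝ) (x : Plane) : ℝ := ‖fderiv ℝ (fderiv ℝ f) x‖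

theorem hessNorm_nonneg (f : Plane → ℝ) (x : Plane) : 0 ≤ hessNorm f x :=
  norm_nonneg (fderiv ℝ (fderiv ℝ f) x)

theorem hessNorm_measurable (f : Plane → ℝ) : Measurable (hessNorm f) :=
  (measurable_fderiv ℝ (fderiv ℝ f)).norm

theorem hessNorm_congr {f g : Plane → ℝ} {x : Plane} (h : f =ᶠ[nhds x] g) :
    hessNorm f x = hessNorm g x := by
  unfold hessNorm
  rw [h.fderiv.fderiv_eq]

theorem hessNorm_eq_zero {f : Plane → ℝ} {x : Plane} (h : f =ᶠ[nhds x] 0) :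
    hessNorm f x = 0 := by
  rw [hessNorm_congr h]
  have : fderiv ℝ (0 : Plane → ℝ) = fun _ => 0 := by ext1 x; simp
  simp only [hessNorm, this, fderiv_fun_const]
  exact norm_zero (E := Plane →L[ℝ] Plane →L[ℝ] ℝ)

theorem hess_congr {f g : Plane → ℝ} {x : Plane} (h : f =ᶠ[nhds x] g) (i j : Fin 2) :
    hess f x i j = hess g x i j := by
  unfold hess
  rw [h.fderiv.fderiv_eq]

theorem hess_eq_zero_of_eventuallyEq {f : Plane → ℝ} {x : Plane} (h : f =ᶠ[nhds x] 0)
    (i j : Fin 2) : hess f x i j = 0 := by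
  rw [hess_congr h]
  have : fderiv ℝ (0 : Plane → ℝ) = fun _ => 0 := by ext1 x; simp
  simp [hess, this]

theorem abs_hess_le (f : Plane → ℝ) (x : Plane) (i j : Fin 2) : |hess f x i j| ≤ hessNorm f x := by
  have h1 := (fderiv ℝ (fderiv ℝ f) x).le_opNorm (EuclideanSpace.single i 1)
  have h2 := (fderiv ℝ (fderiv ℝ f) x (EuclideanSpace.single i 1)).le_opNorm
    (EuclideanSpace.single j 1)
  simp only [PiLp.norm_single, norm_one, mul_one] at h1 h2
  exact h2.trans h1

theorem sum_hess_sq_le (f : Plane → ℝ) (x : Plane) :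
    ∑ i, ∑ j, hess f x i j * hess f x i j ≤ 4 * hessNorm f x ^ 2 := by
  have h : ∀ i j, hess f x i j * hess f x i j ≤ hessNorm f x ^ 2 := fun i j => by
    rw [← sq, ← sq_abs]
    exact pow_le_pow_left₀ (abs_nonneg _) (abs_hess_le f x i j) 2
  simp only [Fin.sum_univ_two]
  linarith [h 0 0, h 0 1, h 1 0, h 1 1]

theorem plane_eq_add (x : Plane) : x = x 0 • EuclideanSpace.single (0 : Fin 2) (1 : ℝ) +
    x 1 • EuclideanSpace.single (1 : Fin 2) (1 : ℝ) := by
  ext i; fin_cases i <;> simp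

theorem plane_norm_sq (x : Plane) : ‖x‖ ^ 2 = x 0 ^ 2 + x 1 ^ 2 := by
  simp [EuclideanSpace.norm_sq_eq, Fin.sum_univ_two]

/-- A linear map on the plane is bounded by the Euclidean norm of its two columns. -/
theorem sq_norm_apply_le {E : Type*} [NormedAddCommGroup E] [NormedSpace ℝ E]
    (A : Plane →L[ℝ] E) :
    ‖A‖ ^ 2 ≤ ‖A (EuclideanSpace.single 0 1)‖ ^ 2 + ‖A (EuclideanSpace.single 1 1)‖ ^ 2 := by
  have key : ‖A‖ ≤ √(‖A (EuclideanSpace.single 0 1)‖ ^ 2 + ‖A (EuclideanSpace.single 1 1)‖ ^ 2) := by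
    refine A.opNorm_le_bound (Real.sqrt_nonneg _) fun x => ?_
    rw [← Real.sqrt_sq (norm_nonneg x), ← Real.sqrt_mul (by positivity)]
    refine Real.le_sqrt_of_sq_le ?_
    rw [plane_norm_sq]
    set a := ‖A (EuclideanSpace.single 0 1)‖
    set b := ‖A (EuclideanSpace.single 1 1)‖
    have h : ‖A x‖ ≤ |x 0| * a + |x 1| * b := by
      conv_lhs => rw [plane_eq_add x]
      rw [map_add, map_smul, map_smul]
      refine (norm_add_le _ _).trans ?_
      rw [norm_smul, norm_smul, Real.norm_eq_abs, Real.norm_eq_abs]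
    have h2 := pow_le_pow_left₀ (norm_nonneg _) h 2
    refine h2.trans ?_
    rw [← sq_abs (x 0), ← sq_abs (x 1)]
    nlinarith [sq_nonneg (|x 0| * b - |x 1| * a)]
  calc ‖A‖ ^ 2 ≤ _ := pow_le_pow_left₀ (norm_nonneg _) key 2
    _ = _ := Real.sq_sqrt (by positivity)

/-- The column estimate is used twice: for $D^2f$ and then for each of its two columns. The operator
norm is thereby at most the Frobenius norm. -/
theorem hessNorm_sq_le (f : Plane → ℝ) (x : Plane) :
    hessNorm f x ^ 2 ≤ ∑ i, ∑ j, hess f x i j * hess f x i j := by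
  refine (sq_norm_apply_le _).trans ?_
  refine (add_le_add (sq_norm_apply_le _) (sq_norm_apply_le _)).trans (le_of_eq ?_)
  simp only [Fin.sum_univ_two, hess, Real.norm_eq_abs, sq_abs]
  ring

/-! ### Calculus in $W^2_\infty$: products, sums and cutoffs. -/

theorem IsW2Inf.continuous {f : Plane → ℝ} (hf : IsW2Inf f) : Continuous f :=
  hf.contDiff.continuous

theorem IsW2Inf.ae_differentiableAt_fderiv {f : Plane → ℝ} (hf : IsW2Inf f) :
    ∀ᵐ x, DifferentiableAt ℝ (fderiv ℝ f) x := by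
  obtain ⟨L, l⟩ := hf.lipschitz_fderiv
  exact l.ae_differentiableAt

theorem IsW2Inf.exists_hessNorm_le {f : Plane → ℝ} (hf : IsW2Inf f) :
    ∃ K : ℝ, 0 ≤ K ∧ ∀ x, hessNorm f x ≤ K := by
  obtain ⟨L, l⟩ := hf.lipschitz_fderiv
  exact ⟨L, L.2, fun x => norm_fderiv_le_of_lipschitz ℝ l⟩

theorem fderiv_mul_eq {f g : Plane → ℝ} (hf : Differentiable ℝ f) (hg : Differentiable ℝ g) :
    fderiv ℝ (f * g) = fun x => f x • fderiv ℝ g x + g x • fderiv ℝ f x := by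
  ext1 x
  exact fderiv_mul (hf x) (hg x)

/-- Leibniz rule $D^2(fg)=f\,D^2g+\nabla f\otimes\nabla g+\nabla g\otimes\nabla f+g\,D^2f$. For
$W^2_\infty$ factors Rademacher's theorem makes it available almost everywhere. -/
theorem hessNorm_mul_le {f g : Plane → ℝ} (hf : Differentiable ℝ f) (hg : Differentiable ℝ g)
    {x : Plane} (hf' : DifferentiableAt ℝ (fderiv ℝ f) x)
    (hg' : DifferentiableAt ℝ (fderiv ℝ g) x) :
    hessNorm (f * g) x ≤ |f x| * hessNorm g x + 2 * ‖fderiv ℝ f x‖ * ‖fderiv ℝ g x‖ +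
      |g x| * hessNorm f x := by
  unfold hessNorm
  rw [fderiv_mul_eq hf hg]
  have h1 := (hf x).hasFDerivAt.smul hg'.hasFDerivAt
  have h2 := (hg x).hasFDerivAt.smul hf'.hasFDerivAt
  have h3 : fderiv ℝ (fun x => f x • fderiv ℝ g x + g x • fderiv ℝ f x) x = _ :=
    (h1.add h2).fderiv
  rw [h3]
  have hadd : ∀ A B : Plane →L[ℝ] Plane →L[ℝ] ℝ, ‖A + B‖ ≤ ‖A‖ + ‖B‖ := fun A B =>
    A.opNorm_add_le B
  refine (hadd _ _).trans ((add_le_add (hadd _ _) (hadd _ _)).trans ?_)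
  have e1 : ‖(fderiv ℝ f x).smulRight (fderiv ℝ g x)‖ = ‖fderiv ℝ f x‖ * ‖fderiv ℝ g x‖ :=
    ContinuousLinearMap.norm_smulRight_apply _ _
  have e2 : ‖(fderiv ℝ g x).smulRight (fderiv ℝ f x)‖ = ‖fderiv ℝ g x‖ * ‖fderiv ℝ f x‖ :=
    ContinuousLinearMap.norm_smulRight_apply _ _
  rw [e1, e2]
  have h4 := ContinuousLinearMap.opNorm_smul_le (f x) (fderiv ℝ (fderiv ℝ g) x)
  have h5 := ContinuousLinearMap.opNorm_smul_le (g x) (fderiv ℝ (fderiv ℝ f) x)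
  rw [Real.norm_eq_abs] at h4 h5
  linarith

theorem hessNorm_sum_le {ι : Type*} (s : Finset ι) {f : ι → Plane → ℝ}
    (hf : ∀ i ∈ s, Differentiable ℝ (f i)) {x : Plane}
    (hf' : ∀ i ∈ s, DifferentiableAt ℝ (fderiv ℝ (f i)) x) :
    hessNorm (∑ i ∈ s, f i) x ≤ ∑ i ∈ s, hessNorm (f i) x := by
  have : fderiv ℝ (∑ i ∈ s, f i) = ∑ i ∈ s, fderiv ℝ (f i) := by
    ext1 y
    rw [fderiv_sum fun i hi => hf i hi y, Finset.sum_apply]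
  unfold hessNorm
  rw [this, fderiv_sum hf']
  exact norm_sum_le s fun i => fderiv ℝ (fderiv ℝ (f i)) x

theorem hess_ae_sum {ι : Type*} (s : Finset ι) {f : ι → Plane → ℝ}
    (hf : ∀ i ∈ s, IsW2Inf (f i)) :
    ∀ᵐ x, ∀ a b, hess (∑ i ∈ s, f i) x a b = ∑ i ∈ s, hess (f i) x a b := by
  have h0 : fderiv ℝ (∑ i ∈ s, f i) = ∑ i ∈ s, fderiv ℝ (f i) := by
    ext1 y
    rw [fderiv_sum fun i hi => (hf i hi).differentiable y, Finset.sum_apply]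
  have h1 : ∀ᵐ x, ∀ i ∈ s, DifferentiableAt ℝ (fderiv ℝ (f i)) x :=
    (ae_ball_iff s.countable_toSet).2 fun i hi => (hf i hi).ae_differentiableAt_fderiv
  filter_upwards [h1] with x hx a b
  simp only [hess, h0]
  rw [fderiv_sum hx]
  simp

theorem IsW2Inf.mul {f g : Plane → ℝ} (hf : IsW2Inf f) (hg : IsW2Inf g) : IsW2Inf (f * g) := by
  -- A product of bounded Lipschitz maps is Lipschitz. This serves for $fg$ and for the two terms of
  -- its gradient.
  have key : ∀ {E : Type} [NormedAddCommGroup E] [NormedSpace ℝ E] {u : Plane → ℝ} {v : Plane → E},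
      (∃ K : ℝ, ∀ x, |u x| ≤ K) → (∃ K, LipschitzWith K u) → (∃ K : ℝ, ∀ x, ‖v x‖ ≤ K) →
      (∃ K, LipschitzWith K v) → ∃ K, LipschitzWith K fun x => u x • v x := by
    intro E _ _ u v ⟨A, hA⟩ ⟨K, hK⟩ ⟨B, hB⟩ ⟨L, hL⟩
    have hA0 : 0 ≤ A := (abs_nonneg _).trans (hA 0)
    have hB0 : 0 ≤ B := (norm_nonneg _).trans (hB 0)
    refine ⟨⟨A * L + B * K, by positivity⟩, LipschitzWith.of_dist_le_mul fun x y => ?_⟩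
    have h1 := hK.dist_le_mul x y
    have h2 := hL.dist_le_mul x y
    rw [dist_eq_norm] at h1 h2 ⊢
    have : u x • v x - u y • v y = u x • (v x - v y) + (u x - u y) • v y := by
      rw [smul_sub, sub_smul]; abel
    rw [this]
    refine (norm_add_le _ _).trans ?_
    rw [norm_smul, norm_smul]
    have h3 : ‖u x‖ * ‖v x - v y‖ ≤ A * (L * dist x y) :=
      mul_le_mul (hA x) h2 (norm_nonneg _) hA0
    have h4 : ‖u x - u y‖ * ‖v y‖ ≤ (K * dist x y) * B :=
      mul_le_mul h1 (hB y) (norm_nonneg _) (by positivity)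
    calc _ ≤ A * (L * dist x y) + (K * dist x y) * B := add_le_add h3 h4
      _ = (A * L + B * K) * dist x y := by ring
  have hbd : ∀ {u : Plane → ℝ}, IsW2Inf u → ∃ K : ℝ, ∀ x, ‖fderiv ℝ u x‖ ≤ K := fun hu => by
    obtain ⟨K, hK⟩ := hu.lipschitz
    exact ⟨K, fun x => norm_fderiv_le_of_lipschitz ℝ hK⟩
  obtain ⟨b₁, h₁⟩ := hf.bounded
  obtain ⟨b₂, h₂⟩ := hg.bounded
  refine ⟨hf.contDiff.mul hg.contDiff, ⟨b₁ * b₂, fun x => ?_⟩,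
    key hf.bounded hf.lipschitz hg.bounded hg.lipschitz, ?_⟩
  · rw [Pi.mul_apply, abs_mul]
    exact mul_le_mul (h₁ x) (h₂ x) (abs_nonneg _) ((abs_nonneg _).trans (h₁ x))
  · rw [fderiv_mul_eq hf.differentiable hg.differentiable]
    obtain ⟨K₁, k₁⟩ := key hf.bounded hf.lipschitz (hbd hg) hg.lipschitz_fderiv
    obtain ⟨K₂, k₂⟩ := key hg.bounded hg.lipschitz (hbd hf) hf.lipschitz_fderiv
    exact ⟨_, k₁.add k₂⟩

theorem IsW2Inf.of_contDiff {f : Plane → ℝ} (hf : ContDiff ℝ 2 f) (hs : HasCompactSupport f) :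
    IsW2Inf f := by
  refine ⟨hf.of_le (by norm_num), ?_, hf.lipschitzWith_of_hasCompactSupport hs (by norm_num), ?_⟩
  · obtain ⟨K, hK⟩ := hs.exists_bound_of_continuous hf.continuous
    exact ⟨K, hK⟩
  · exact (hf.fderiv_right (m := 1) (by norm_num)).lipschitzWith_of_hasCompactSupport
      (hs.fderiv ℝ) (by norm_num)

theorem W2InfBound.ae {f : Plane → ℝ} {U : Set Plane} {c : ℕ → ℝ} (h : W2InfBound f U c) :
    ∀ᵐ x ∂(volume.restrict U), |f x| ≤ c 0 ∧ ‖fderiv ℝ f x‖ ≤ c 1 ∧ hessNorm f x ≤ c 2 := by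
  filter_upwards [h 0 (by norm_num), h 1 (by norm_num), h 2 le_rfl] with x h0 h1 h2
  refine ⟨by simpa using h0, by simpa [norm_iteratedFDeriv_one] using h1, ?_⟩
  rwa [← norm_iteratedFDeriv_fderiv, norm_iteratedFDeriv_one] at h2

/-! ### Extension by zero -/

theorem exists_frontier_dist_le {U : Set Plane} {x y : Plane} (hx : x ∈ U) (hy : y ∉ U) :
    ∃ z ∈ frontier U, dist x z ≤ dist x y := by
  have hne : U ≠ univ := fun h => hy (h ▸ mem_univ y)
  obtain ⟨z, hz, hd⟩ := exists_mem_frontier_infDist_compl_eq_dist hx hne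
  exact ⟨z, hz, hd ▸ Metric.infDist_le_dist_of_mem hy⟩

/-- Between a point of `U` and a point `y` outside there is a frontier point, a zero of `g`, no
farther away than `y`. The Lipschitz constant is therefore kept. -/
theorem LipschitzWith.indicator_of_frontier {E : Type*} [NormedAddCommGroup E]
    {U : Set Plane} {K : NNReal} {g : Plane → E} (hg : LipschitzWith K g)
    (h0 : ∀ z ∈ frontier U, g z = 0) : LipschitzWith K (U.indicator g) := by
  have key : ∀ x ∈ U, ∀ y ∉ U, dist (g x) 0 ≤ K * dist x y := fun x hx y hy => by
    obtain ⟨z, hz, hd⟩ := exists_frontier_dist_le hx hy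
    rw [← h0 z hz]
    exact (hg.dist_le_mul x z).trans (mul_le_mul_of_nonneg_left hd K.2)
  refine LipschitzWith.of_dist_le_mul fun x y => ?_
  by_cases hx : x ∈ U <;> by_cases hy : y ∈ U
  · simpa [hx, hy] using hg.dist_le_mul x y
  · simpa [hx, hy] using key x hx y hy
  · simpa [hx, hy, dist_comm] using key y hy x hx
  · simp [hx, hy]; positivity

theorem hasFDerivAt_of_sq_bound {f : Plane → ℝ} {z : Plane} {K : ℝ} (hz : f z = 0)
    (h : ∀ x, |f x| ≤ K * ‖x - z‖ ^ 2) : HasFDerivAt f (0 : Plane →L[ℝ] ℝ) z := by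
  rw [hasFDerivAt_iff_isLittleO]
  simp only [hz, sub_zero, zero_apply]
  have h1 : f =O[nhds z] fun x => ‖x - z‖ ^ 2 :=
    Asymptotics.IsBigO.of_bound K (Filter.Eventually.of_forall fun x => by simpa using h x)
  refine h1.trans_isLittleO ?_
  have h2 : (fun x : Plane => ‖x - z‖) =o[nhds z] fun _ => (1 : ℝ) := by
    rw [Asymptotics.isLittleO_one_iff]
    have : Continuous fun x : Plane => ‖x - z‖ := by fun_prop
    simpa using this.tendsto z
  have h3 := h2.mul_isBigO (Asymptotics.isBigO_refl (fun x : Plane => ‖x - z‖) (nhds z))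
  simp only [one_mul, ← sq] at h3
  exact h3.trans_isBigO (Asymptotics.isBigO_refl _ _).norm_left

/-- Only frontier points need an argument: value and gradient vanish there and the gradient is
Lipschitz, so the mean value inequality on a segment gives $|f(y)|\le L|y-x|^2$. -/
theorem fderiv_indicator_of_frontier {U : Set Plane} (hU : IsOpen U) {f : Plane → ℝ}
    (hf : IsW2Inf f) (h0 : ∀ z ∈ frontier U, f z = 0 ∧ fderiv ℝ f z = 0) (x : Plane) :
    HasFDerivAt (U.indicator f) (U.indicator (fderiv ℝ f) x) x := by
  by_cases hx : x ∈ U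
  · rw [indicator_of_mem hx]
    refine (hf.differentiable x).hasFDerivAt.congr_of_eventuallyEq ?_
    filter_upwards [hU.mem_nhds hx] with y hy using indicator_of_mem hy f
  rw [indicator_of_notMem hx]
  by_cases hx' : x ∈ closure U
  · have hz : x ∈ frontier U := by rw [hU.frontier_eq]; exact ⟨hx', hx⟩
    obtain ⟨L, hL⟩ := hf.lipschitz_fderiv
    refine hasFDerivAt_of_sq_bound (K := L) (by simp [hx]) fun y => ?_
    have hb : |f y| ≤ L * ‖y - x‖ ^ 2 := by
      have h := (convex_segment x y).norm_image_sub_le_of_norm_fderiv_le (𝕜 := ℝ) (f := f)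
        (C := L * ‖y - x‖) (fun w _ => hf.differentiable w) (fun w hw => ?_)
        (left_mem_segment ℝ x y) (right_mem_segment ℝ x y)
      · rw [(h0 x hz).1, sub_zero] at h
        calc |f y| ≤ _ := h
          _ = _ := by ring
      · have h1 := hL.dist_le_mul w x
        rw [(h0 x hz).2, dist_zero_right, dist_eq_norm] at h1
        refine h1.trans (mul_le_mul_of_nonneg_left ?_ L.2)
        obtain ⟨a, b, ha, hb, hab, rfl⟩ := hw
        have : a • x + b • y - x = b • (y - x) := by
          rw [show a = 1 - b by linarith]; module
        rw [this, norm_smul, Real.norm_of_nonneg hb]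
        exact mul_le_of_le_one_left (norm_nonneg _) (by linarith)
    by_cases hy : y ∈ U
    · simpa [hy] using hb
    · simp only [hy, not_false_eq_true, indicator_of_notMem, abs_zero]; positivity
  · refine (hasFDerivAt_const (0 : ℝ) x).congr_of_eventuallyEq ?_
    filter_upwards [isClosed_closure.isOpen_compl.mem_nhds hx'] with y hy
    exact indicator_of_notMem (fun h => hy (subset_closure h)) f

/-- A `W²_∞` function that vanishes together with its gradient on the boundary of an open set may be
replaced by zero outside this set. -/
theorem IsW2Inf.indicator {U : Set Plane} (hU : IsOpen U) {f : Plane → ℝ}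
    (hf : IsW2Inf f) (h0 : ∀ z ∈ frontier U, f z = 0 ∧ fderiv ℝ f z = 0) :
    IsW2Inf (U.indicator f) := by
  obtain ⟨b, hb⟩ := hf.bounded
  obtain ⟨K, hK⟩ := hf.lipschitz
  obtain ⟨L, hL⟩ := hf.lipschitz_fderiv
  have hd : fderiv ℝ (U.indicator f) = U.indicator (fderiv ℝ f) :=
    funext fun x => (fderiv_indicator_of_frontier hU hf h0 x).fderiv
  have hL' := LipschitzWith.indicator_of_frontier hL fun z hz => (h0 z hz).2
  refine ⟨?_, ⟨b, fun x => ?_⟩, ⟨K, LipschitzWith.indicator_of_frontier hK fun z hz => (h0 z hz).1⟩,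
    ⟨L, hd ▸ hL'⟩⟩
  · rw [contDiff_one_iff_fderiv]
    exact ⟨fun x => (fderiv_indicator_of_frontier hU hf h0 x).differentiableAt,
      hd ▸ hL'.continuous⟩
  · by_cases hx : x ∈ U
    · simpa [hx] using hb x
    · simpa [hx] using (abs_nonneg _).trans (hb x)

/-! ### The fundamental theorem of calculus on lines -/

/-- The restriction to the line is absolutely continuous. Differentiability in the plane at almost
every point of the line is needed for the chain rule; Rademacher and Fubini supply it on almost
every line. -/
theorem LipschitzWith.integral_fderiv_line {F : Plane → ℝ} {K : NNReal} (hF : LipschitzWith K F)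
    (x e : Plane) (h : ∀ᵐ t : ℝ, DifferentiableAt ℝ F (x + t • e)) (a b : ℝ) :
    ∫ t in a..b, fderiv ℝ F (x + t • e) e = F (x + b • e) - F (x + a • e) := by
  have hl : LipschitzWith ‖e‖₊ fun t : ℝ => x + t • e := by
    refine LipschitzWith.of_dist_le_mul fun s t => ?_
    rw [dist_eq_norm, dist_eq_norm, add_sub_add_left_eq_sub, ← sub_smul, norm_smul, mul_comm]
    rfl
  have h1 := ((hF.comp hl).lipschitzOnWith
    (s := uIcc a b)).absolutelyContinuousOnInterval.integral_deriv_eq_sub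
  simp only [Function.comp_apply] at h1
  rw [← h1]
  refine intervalIntegral.integral_congr_ae ?_
  filter_upwards [h] with t ht _
  have h2 : HasDerivAt (fun t : ℝ => x + t • e) e t := by
    simpa using ((hasDerivAt_id t).smul_const e).const_add x
  exact (ht.hasFDerivAt.comp_hasDerivAt t h2).deriv.symm

/-- The integral runs over the fixed interval `Icc c d`, which makes the bound uniform in both end
points, in either order. -/
theorem LipschitzWith.abs_sub_le_integral_line {F : Plane → ℝ} {K : NNReal}
    (hF : LipschitzWith K F) (x e : Plane) (h : ∀ᵐ t : ℝ, DifferentiableAt ℝ F (x + t • e))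
    {a b c d : ℝ} (ha : a ∈ Icc c d) (hb : b ∈ Icc c d) {g : ℝ → ℝ}
    (hg0 : ∀ t, 0 ≤ g t) (hgi : IntegrableOn g (Icc c d))
    (hg : ∀ᵐ t, |fderiv ℝ F (x + t • e) e| ≤ g t) :
    |F (x + b • e) - F (x + a • e)| ≤ ∫ t in Icc c d, g t := by
  rw [← LipschitzWith.integral_fderiv_line hF x e h a b]
  have hsub : uIoc a b ⊆ Icc c d := fun t ht => by
    have h1 := uIoc_subset_uIcc ht
    exact ⟨(le_inf ha.1 hb.1).trans h1.1, h1.2.trans (sup_le ha.2 hb.2)⟩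
  calc |∫ t in a..b, fderiv ℝ F (x + t • e) e|
      ≤ ∫ t in uIoc a b, ‖fderiv ℝ F (x + t • e) e‖ := by
        exact intervalIntegral.norm_integral_le_integral_norm_uIoc (f := fun t => fderiv ℝ F (x + t • e) e)
    _ ≤ ∫ t in uIoc a b, g t := by
        refine integral_mono_of_nonneg (Filter.Eventually.of_forall fun t => norm_nonneg _)
          (hgi.mono_set hsub) (ae_restrict_of_ae hg)
    _ ≤ ∫ t in Icc c d, g t :=
        setIntegral_mono_set hgi (Filter.Eventually.of_forall hg0)
          (Filter.Eventually.of_forall hsub)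

/-! ### The Poincaré inequality -/

/-- Cauchy–Schwarz against the constant 1, from $\int(g-m)^2\ge0$ with $m$ the mean value of $g$. -/
theorem sq_integral_le {α : Type*} [MeasurableSpace α] {μ : Measure α} [IsFiniteMeasure μ]
    {g : α → ℝ} (h1 : Integrable g μ) (h2 : Integrable (fun x => g x ^ 2) μ) :
    (∫ x, g x ∂μ) ^ 2 ≤ μ.real univ * ∫ x, g x ^ 2 ∂μ := by
  have key : ∀ m : ℝ, 0 ≤ (∫ x, g x ^ 2 ∂μ) - 2 * m * (∫ x, g x ∂μ) + m ^ 2 * μ.real univ := by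
    intro m
    have h3 : ∫ x, (g x - m) ^ 2 ∂μ =
        (∫ x, g x ^ 2 ∂μ) - 2 * m * (∫ x, g x ∂μ) + m ^ 2 * μ.real univ := by
      have : (fun x => (g x - m) ^ 2) = fun x => (g x ^ 2 - 2 * m * g x) + m ^ 2 := by
        ext x; ring
      have h4 : Integrable (fun x => g x ^ 2 - 2 * m * g x) μ := h2.sub (h1.const_mul _)
      rw [this, integral_add h4 (integrable_const _), integral_sub h2 (h1.const_mul _), integral_const_mul, integral_const]
      simp [mul_comm]
    rw [← h3]
    exact integral_nonneg fun x => sq_nonneg _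
  rcases eq_or_ne (μ.real univ) 0 with h0 | h0
  · have : μ = 0 := by
      rw [← Measure.measure_univ_eq_zero]
      exact (measureReal_eq_zero_iff).1 h0
    simp [this]
  · have hp : 0 < μ.real univ := lt_of_le_of_ne measureReal_nonneg (Ne.symm h0)
    have := key ((∫ x, g x ∂μ) / μ.real univ)
    have h4 := mul_nonneg hp.le this
    have h5 : μ.real univ * ((∫ x, g x ^ 2 ∂μ) - 2 * ((∫ x, g x ∂μ) / μ.real univ) * (∫ x, g x ∂μ) +
      ((∫ x, g x ∂μ) / μ.real univ) ^ 2 * μ.real univ) =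
      μ.real univ * (∫ x, g x ^ 2 ∂μ) - (∫ x, g x ∂μ) ^ 2 := by
      field_simp
      ring
    linarith

theorem integrable_of_bounded_of_support {g : Plane → ℝ} (hg : Measurable g) {K : ℝ}
    (hK : ∀ x, |g x| ≤ K) {z : Plane} {R : ℝ} (h0 : ∀ x, x ∉ Metric.closedBall z R → g x = 0) :
    Integrable g := by
  have hs : Function.support g ⊆ Metric.closedBall z R := fun x hx => by
    by_contra h
    exact hx (h0 x h)
  rw [← integrableOn_iff_integrable_of_support_subset hs]
  have : IsFiniteMeasure (volume.restrict (Metric.closedBall z R)) :=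
    ⟨by simpa using measure_closedBall_lt_top (μ := volume) (x := z) (r := R)⟩
  exact Integrable.of_bound hg.aestronglyMeasurable K (Filter.Eventually.of_forall hK)

/-- Fubini: for each fixed `t`, translation invariance gives the property for almost every `x`. -/
theorem ae_ae_line {s : Set Plane} (hs : MeasurableSet s) (h : ∀ᵐ x, x ∈ s) (e : Plane) :
    ∀ᵐ x : Plane, ∀ᵐ t : ℝ, x + t • e ∈ s := by
  have hm : MeasurableSet {p : Plane × ℝ | p.1 + p.2 • e ∈ s} :=
    (show Measurable fun p : Plane × ℝ => p.1 + p.2 • e by fun_prop) hs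
  refine (Measure.ae_ae_comm (p := fun (x : Plane) (t : ℝ) => x + t • e ∈ s) hm).2 ?_
  exact Filter.Eventually.of_forall fun t =>
    (measurePreserving_add_right volume (t • e)).quasiMeasurePreserving.ae h

theorem fderiv_eq_zero_of_support {F : Plane → ℝ} {z : Plane} {R : ℝ}
    (h0 : ∀ x, x ∉ Metric.closedBall z R → F x = 0) (x : Plane)
    (hx : x ∉ Metric.closedBall z R) : fderiv ℝ F x = 0 := by
  have : F =ᶠ[nhds x] fun _ => 0 := by
    filter_upwards [Metric.isClosed_closedBall.isOpen_compl.mem_nhds hx] with y hy using h0 y hy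
  rw [this.fderiv_eq]
  simp

/-- The Poincaré inequality for Lipschitz functions with bounded support. -/
theorem poincare {F : Plane → ℝ} {K : NNReal} (hF : LipschitzWith K F) {z : Plane} {R : ℝ}
    (hR : 0 < R) (h0 : ∀ x, x ∉ Metric.closedBall z R → F x = 0) :
    ∫ x, F x ^ 2 ≤ 9 * R ^ 2 * ∫ x, ‖fderiv ℝ F x‖ ^ 2 := by
  set e : Plane := EuclideanSpace.single 0 1 with he
  have hnorm : ‖e‖ = 1 := by simp [he]
  set N : Plane → ℝ := fun x => ‖fderiv ℝ F x‖ with hN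
  have hNm : Measurable N := (measurable_fderiv ℝ F).norm
  have hNK : ∀ x, N x ≤ K := fun x => norm_fderiv_le_of_lipschitz ℝ hF
  have hN0 : ∀ x, 0 ≤ N x := fun x => norm_nonneg _
  have hN2K : ∀ x, N x ^ 2 ≤ K ^ 2 := fun x => pow_le_pow_left₀ (hN0 x) (hNK x) 2
  -- A walk of length $3R$ starting in a ball of diameter $2R$ ends outside it, where `F` vanishes.
  -- Cauchy–Schwarz on this path yields one factor $3R$.
  have hpt : ∀ᵐ x : Plane, ENNReal.ofReal (F x ^ 2) ≤
      ENNReal.ofReal (3 * R) * ∫⁻ t in Icc 0 (3 * R), ENNReal.ofReal (N (x + t • e) ^ 2) := by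
    filter_upwards [ae_ae_line (measurableSet_of_differentiableAt ℝ F)
      hF.ae_differentiableAt e] with x hx
    by_cases hxb : x ∈ Metric.closedBall z R
    swap
    · simp [h0 x hxb]
    have hline : Measurable fun t : ℝ => N (x + t • e) := hNm.comp (by fun_prop)
    have hi1 : IntegrableOn (fun t : ℝ => N (x + t • e)) (Icc 0 (3 * R)) :=
      Integrable.of_bound hline.aestronglyMeasurable K
        (Filter.Eventually.of_forall fun t => by simpa [hN] using hNK (x + t • e))
    have hi2 : IntegrableOn (fun t : ℝ => N (x + t • e) ^ 2) (Icc 0 (3 * R)) :=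
      Integrable.of_bound (hline.pow_const 2).aestronglyMeasurable (K ^ 2)
        (Filter.Eventually.of_forall fun t => by simpa [hN] using hN2K (x + t • e))
    have h1 := LipschitzWith.abs_sub_le_integral_line hF x e hx (a := 3 * R) (b := 0)
      (c := 0) (d := 3 * R) ⟨by positivity, le_rfl⟩ ⟨le_rfl, by positivity⟩
      (g := fun t => N (x + t • e)) (fun t => hN0 _) hi1 (Filter.Eventually.of_forall fun t => by
        simpa [hnorm] using (fderiv ℝ F (x + t • e)).le_opNorm e)
    have h2 : F (x + (3 * R) • e) = 0 := by
      refine h0 _ fun hmem => ?_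
      rw [mem_closedBall_iff_norm] at hmem hxb
      have h3 : ‖(3 * R) • e‖ ≤ ‖x + (3 * R) • e - z‖ + ‖x - z‖ := by
        have : (3 * R) • e = (x + (3 * R) • e - z) - (x - z) := by abel
        conv_lhs => rw [this]
        exact norm_sub_le _ _
      rw [norm_smul, hnorm, Real.norm_of_nonneg (by positivity)] at h3
      linarith
    rw [h2, zero_smul, add_zero, sub_zero] at h1
    have h4 := sq_integral_le hi1 hi2
    simp only [measureReal_restrict_apply_univ, Real.volume_real_Icc, sub_zero] at h4
    rw [max_eq_left (by positivity)] at h4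
    have h5 : F x ^ 2 ≤ 3 * R * ∫ t in Icc 0 (3 * R), N (x + t • e) ^ 2 := by
      rw [← sq_abs]
      exact (pow_le_pow_left₀ (abs_nonneg _) h1 2).trans h4
    refine (ENNReal.ofReal_le_ofReal h5).trans ?_
    rw [ENNReal.ofReal_mul (by positivity),
      ofReal_integral_eq_lintegral_ofReal hi2 (Filter.Eventually.of_forall fun t => sq_nonneg _)]
  have hFi : Integrable fun x => F x ^ 2 := by
    obtain ⟨B, hB⟩ := (isCompact_closedBall z R).exists_bound_of_continuousOn
      hF.continuous.continuousOn
    refine integrable_of_bounded_of_support (K := B ^ 2) (z := z) (R := R)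
      (hF.continuous.measurable.pow_const 2) (fun x => ?_) fun x hx => by simp [h0 x hx]
    by_cases hx : x ∈ Metric.closedBall z R
    · rw [abs_pow]; exact pow_le_pow_left₀ (abs_nonneg _) (hB x hx) 2
    · simp only [h0 x hx]; simpa using sq_nonneg B
  have hNi : Integrable fun x => N x ^ 2 :=
    integrable_of_bounded_of_support (K := K ^ 2) (z := z) (R := R) (hNm.pow_const 2)
      (fun x => by rw [abs_of_nonneg (sq_nonneg _)]; exact hN2K x)
      (fun x hx => by simp [hN, fderiv_eq_zero_of_support h0 x hx])
  have hmain : ∫⁻ x, ENNReal.ofReal (F x ^ 2) ≤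
      ENNReal.ofReal (9 * R ^ 2 * ∫ x, N x ^ 2) := by
    calc ∫⁻ x, ENNReal.ofReal (F x ^ 2)
        ≤ ∫⁻ x, ENNReal.ofReal (3 * R) *
            ∫⁻ t in Icc 0 (3 * R), ENNReal.ofReal (N (x + t • e) ^ 2) := lintegral_mono_ae hpt
      _ = ENNReal.ofReal (3 * R) *
            ∫⁻ x, ∫⁻ t in Icc 0 (3 * R), ENNReal.ofReal (N (x + t • e) ^ 2) :=
          lintegral_const_mul' _ _ ENNReal.ofReal_ne_top
      _ = ENNReal.ofReal (3 * R) *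
            ∫⁻ t in Icc 0 (3 * R), ∫⁻ x, ENNReal.ofReal (N (x + t • e) ^ 2) := by
          rw [lintegral_lintegral_swap]
          refine Measurable.aemeasurable ?_
          exact ((hNm.comp (show Measurable fun p : Plane × ℝ => p.1 + p.2 • e by
            fun_prop)).pow_const 2).ennreal_ofReal
      -- By translation invariance the inner integral does not depend on `t`; the integration in `t`
      -- yields the second factor $3R$.
      _ = ENNReal.ofReal (3 * R) *
            ∫⁻ t in Icc 0 (3 * R), ∫⁻ x, ENNReal.ofReal (N x ^ 2) := by
          congr 1
          refine lintegral_congr fun t => ?_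
          exact lintegral_add_right_eq_self (fun x => ENNReal.ofReal (N x ^ 2)) (t • e)
      _ = ENNReal.ofReal (9 * R ^ 2 * ∫ x, N x ^ 2) := by
          rw [lintegral_const, Measure.restrict_apply_univ, Real.volume_Icc, sub_zero,
            ← ofReal_integral_eq_lintegral_ofReal hNi
              (Filter.Eventually.of_forall fun t => sq_nonneg _),
            mul_comm (ENNReal.ofReal (∫ x, N x ^ 2)), ← ENNReal.ofReal_mul (by positivity),
            ← ENNReal.ofReal_mul (by positivity)]
          congr 1; ring
  rw [← ofReal_integral_eq_lintegral_ofReal hFi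
    (Filter.Eventually.of_forall fun t => sq_nonneg _)] at hmain
  exact (ENNReal.ofReal_le_ofReal_iff (mul_nonneg (by positivity)
    (integral_nonneg fun x => sq_nonneg _))).1 hmain

theorem IsW2Inf.integrable_sq {u : Plane → ℝ} (hu : IsW2Inf u) {z : Plane} {R : ℝ}
    (h0 : ∀ x, x ∉ Metric.closedBall z R → u x = 0) :
    Integrable (fun x => u x ^ 2) ∧ Integrable (fun x => ‖fderiv ℝ u x‖ ^ 2) ∧
      Integrable (fun x => hessNorm u x ^ 2) := by
  obtain ⟨B, hB⟩ := hu.bounded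
  obtain ⟨K, hK⟩ := hu.lipschitz
  obtain ⟨L, -, hL⟩ := hu.exists_hessNorm_le
  refine ⟨integrable_of_bounded_of_support (K := B ^ 2) (z := z) (R := R)
      (hu.continuous.measurable.pow_const 2) (fun x => ?_) fun x hx => by simp [h0 x hx],
    integrable_of_bounded_of_support (K := K ^ 2) (z := z) (R := R)
      ((measurable_fderiv ℝ u).norm.pow_const 2) (fun x => ?_)
      (fun x hx => by simp [fderiv_eq_zero_of_support h0 x hx]),
    integrable_of_bounded_of_support (K := L ^ 2) (z := z) (R := R)
      ((hessNorm_measurable u).pow_const 2) (fun x => ?_) (fun x hx => ?_)⟩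
  · rw [abs_pow]; exact pow_le_pow_left₀ (abs_nonneg _) (hB x) 2
  · rw [abs_of_nonneg (sq_nonneg _)]
    exact pow_le_pow_left₀ (norm_nonneg _) (norm_fderiv_le_of_lipschitz ℝ hK) 2
  · rw [abs_of_nonneg (sq_nonneg _)]
    exact pow_le_pow_left₀ (hessNorm_nonneg _ _) (hL x) 2
  · have : u =ᶠ[nhds x] 0 := by
      filter_upwards [Metric.isClosed_closedBall.isOpen_compl.mem_nhds hx] with y hy using h0 y hy
    rw [hessNorm_eq_zero this]; norm_num

/-- The Poincaré inequality is applied to each of the two partial derivatives, whence $18=2\cdot9$.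
-/
theorem poincare_fderiv {u : Plane → ℝ} (hu : IsW2Inf u) {z : Plane} {R : ℝ}
    (hR : 0 < R) (h0 : ∀ x, x ∉ Metric.closedBall z R → u x = 0) :
    ∫ x, ‖fderiv ℝ u x‖ ^ 2 ≤ 18 * R ^ 2 * ∫ x, hessNorm u x ^ 2 := by
  obtain ⟨L, hL⟩ := hu.lipschitz_fderiv
  obtain ⟨-, -, hint⟩ := hu.integrable_sq h0
  have hc : ∀ i : Fin 2, ∫ x, (fderiv ℝ u x (EuclideanSpace.single i 1)) ^ 2 ≤
      9 * R ^ 2 * ∫ x, hessNorm u x ^ 2 := by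
    intro i
    set e : Plane := EuclideanSpace.single i 1 with he
    have hnorm : ‖e‖ = 1 := by simp [he]
    have hLip : LipschitzWith L fun x => fderiv ℝ u x e := by
      refine LipschitzWith.of_dist_le_mul fun x y => ?_
      refine le_trans ?_ (hL.dist_le_mul x y)
      rw [dist_eq_norm, dist_eq_norm, ← sub_apply]
      simpa [hnorm] using (fderiv ℝ u x - fderiv ℝ u y).le_opNorm e
    refine (poincare (z := z) hLip hR fun x hx => by simp [fderiv_eq_zero_of_support h0 x hx]).trans ?_
    refine mul_le_mul_of_nonneg_left ?_ (by positivity)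
    refine integral_mono_of_nonneg (Filter.Eventually.of_forall fun x => sq_nonneg _) hint ?_
    filter_upwards [hu.ae_differentiableAt_fderiv] with x hx
    refine pow_le_pow_left₀ (norm_nonneg _) ?_ 2
    have h1 : HasFDerivAt (fun x => fderiv ℝ u x e)
        ((ContinuousLinearMap.apply ℝ ℝ e).comp (fderiv ℝ (fderiv ℝ u) x)) x :=
      (ContinuousLinearMap.apply ℝ ℝ e).hasFDerivAt.comp x hx.hasFDerivAt
    rw [h1.fderiv]
    refine ContinuousLinearMap.opNorm_le_bound _ (hessNorm_nonneg _ _) fun y => ?_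
    have h2 := ((fderiv ℝ (fderiv ℝ u) x) y).le_opNorm e
    rw [hnorm, mul_one] at h2
    exact h2.trans ((fderiv ℝ (fderiv ℝ u) x).le_opNorm y)
  have hi : ∀ i : Fin 2, Integrable fun x => (fderiv ℝ u x (EuclideanSpace.single i 1)) ^ 2 := by
    intro i
    refine (hu.integrable_sq h0).2.1.mono'
      ((measurable_fderiv_apply_const ℝ u _).pow_const 2).aestronglyMeasurable
      (Filter.Eventually.of_forall fun x => ?_)
    rw [norm_pow]
    refine pow_le_pow_left₀ (norm_nonneg _) ?_ 2
    simpa using (fderiv ℝ u x).le_opNorm (EuclideanSpace.single i 1)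
  calc ∫ x, ‖fderiv ℝ u x‖ ^ 2
      ≤ ∫ x, ((fderiv ℝ u x (EuclideanSpace.single 0 1)) ^ 2 +
          (fderiv ℝ u x (EuclideanSpace.single 1 1)) ^ 2) := by
        refine integral_mono (hu.integrable_sq h0).2.1 ((hi 0).add (hi 1)) fun x => ?_
        simpa using sq_norm_apply_le (fderiv ℝ u x)
    _ = _ := integral_add (hi 0) (hi 1)
    _ ≤ _ := by linarith [hc 0, hc 1]

theorem poincare_two {u : Plane → ℝ} (hu : IsW2Inf u) {z : Plane} {R : ℝ}
    (hR : 0 < R) (h0 : ∀ x, x ∉ Metric.closedBall z R → u x = 0) :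
    ∫ x, u x ^ 2 ≤ 162 * R ^ 4 * ∫ x, hessNorm u x ^ 2 := by
  obtain ⟨K, hK⟩ := hu.lipschitz
  refine (poincare hK hR h0).trans ?_
  refine (mul_le_mul_of_nonneg_left (poincare_fderiv hu hR h0) (by positivity)).trans (le_of_eq ?_)
  ring

/-! ### Local approximation by affine functions -/

/-- The orthonormal basis of the plane formed by two orthogonal unit vectors. -/
noncomputable def planeBasis {e e' : Plane} (he : ‖e‖ = 1) (he' : ‖e'‖ = 1)
    (h : inner ℝ e e' = 0) : OrthonormalBasis (Fin 2) ℝ Plane :=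
  have ho : Orthonormal ℝ ![e, e'] := by
    rw [orthonormal_vecCons_iff]
    refine ⟨he, fun i => by fin_cases i; simpa using h, ?_⟩
    rw [orthonormal_vecCons_iff]
    exact ⟨he', fun i => i.elim0, ⟨fun i => i.elim0, fun i => i.elim0⟩⟩
  OrthonormalBasis.mk ho (by
    rw [ho.linearIndependent.span_eq_top_of_card_eq_finrank' (by simp)])

theorem planeBasis_repr_symm {e e' : Plane} (he : ‖e‖ = 1) (he' : ‖e'‖ = 1) (h : inner ℝ e e' = 0)
    (a b : ℝ) :
    (planeBasis he he' h).repr.symm (WithLp.toLp 2 ![a, b]) = a • e + b • e' := by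
  rw [← OrthonormalBasis.sum_repr_symm]
  simp [planeBasis, Fin.sum_univ_two]

theorem exists_frame_coord {e e' : Plane} (he : ‖e‖ = 1) (he' : ‖e'‖ = 1) (h : inner ℝ e e' = 0)
    (z p : Plane) :
    ∃ a b : ℝ, p = z + a • e + b • e' ∧ |a| ≤ ‖p - z‖ ∧ |b| ≤ ‖p - z‖ := by
  have h1 := (planeBasis he he' h).sum_repr' (p - z)
  simp only [Fin.sum_univ_two, planeBasis, OrthonormalBasis.coe_mk, Matrix.cons_val_zero,
    Matrix.cons_val_one] at h1
  refine ⟨inner ℝ e (p - z), inner ℝ e' (p - z), ?_, ?_, ?_⟩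
  · rw [add_assoc, h1]; abel
  · simpa [he] using abs_real_inner_le_norm e (p - z)
  · simpa [he'] using abs_real_inner_le_norm e' (p - z)

/-- Allows Fubini in coordinates aligned with a boundary segment of arbitrary direction. -/
theorem measurePreserving_frame {e e' : Plane} (he : ‖e‖ = 1) (he' : ‖e'‖ = 1) (h : inner ℝ e e' = 0)
    (z : Plane) :
    MeasurePreserving fun p : ℝ × ℝ => z + p.1 • e + p.2 • e' := by
  have h1 := (volume_preserving_finTwoArrow ℝ).symm
  have h2 := PiLp.volume_preserving_toLp (Fin 2)
  have h3 := (planeBasis he he' h).measurePreserving_repr_symm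
  have h4 := (measurePreserving_add_left (volume : Measure Plane) z).comp (h3.comp (h2.comp h1))
  have h5 : (fun p : ℝ × ℝ => z + p.1 • e + p.2 • e') = (fun x => z + x) ∘
      (planeBasis he he' h).repr.symm ∘ WithLp.toLp 2 ∘ MeasurableEquiv.finTwoArrow.symm := by
    ext1 p
    rw [add_assoc, ← planeBasis_repr_symm he he' h]
    rfl
  rw [h5]
  exact h4

/-- Some line carries at most the average over the strip, and the lines on which membership in `S`
fails on a set of positive length form a null family that can be avoided. -/
theorem exists_good_line {g : ℝ × ℝ → ℝ} (hg : Measurable g) {K : ℝ} (hK : ∀ p, |g p| ≤ K)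
    (hg0 : ∀ p, 0 ≤ g p) {S : Set (ℝ × ℝ)} (hS : ∀ᵐ p, p ∈ S) {r t₀ t₁ : ℝ} (h0 : -r ≤ t₀)
    (h01 : t₀ < t₁) (h1 : t₁ ≤ r) :
    ∃ t ∈ Icc t₀ t₁, (∀ᵐ b : ℝ, (t, b) ∈ S) ∧
      ∫ b in Icc (-r) r, g (t, b) ≤ (∫ p in Icc (-r) r ×ˢ Icc (-r) r, g p) / (t₁ - t₀) := by
  have hS' : ∀ᵐ t : ℝ, ∀ᵐ b : ℝ, (t, b) ∈ S := Measure.ae_ae_of_ae_prod hS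
  have hint : IntegrableOn g (Icc (-r) r ×ˢ Icc (-r) r) (volume.prod volume) := by
    have : IsFiniteMeasure ((volume.prod volume : Measure (ℝ × ℝ)).restrict
        (Icc (-r) r ×ˢ Icc (-r) r)) :=
      ⟨by simpa using (isCompact_Icc.prod isCompact_Icc).measure_lt_top⟩
    exact Integrable.of_bound hg.aestronglyMeasurable K (Filter.Eventually.of_forall hK)
  have hF : ∫ p in Icc (-r) r ×ˢ Icc (-r) r, g p =
      ∫ t in Icc (-r) r, ∫ b in Icc (-r) r, g (t, b) := setIntegral_prod _ hint
  have hint' : IntegrableOn (fun t => ∫ b in Icc (-r) r, g (t, b)) (Icc (-r) r) := by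
    rw [IntegrableOn, ← Measure.prod_restrict] at hint
    exact hint.integral_prod_left
  have hsub : Icc t₀ t₁ ⊆ Icc (-r) r := Icc_subset_Icc h0 h1
  have hμ : (volume.restrict (Icc t₀ t₁)) ≠ 0 := by
    rw [Ne, Measure.restrict_eq_zero]
    simp [h01]
  -- The complement of the interval is added to the null set so that the parameter chosen lies in
  -- the interval.
  have hN : (volume.restrict (Icc t₀ t₁))
      ({t : ℝ | ¬ ∀ᵐ b : ℝ, (t, b) ∈ S} ∪ (Icc t₀ t₁)ᶜ) = 0 := by
    refine measure_union_null ?_ ?_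
    · exact ae_iff.1 (ae_restrict_of_ae hS')
    · simp [Measure.restrict_apply measurableSet_Icc.compl]
  obtain ⟨t, ht, hle⟩ := exists_notMem_null_le_average hμ (hint'.mono_set hsub) hN
  simp only [mem_union, mem_ofPred_eq, mem_compl_iff, not_or, not_not] at ht
  refine ⟨t, ht.2, ht.1, hle.trans ?_⟩
  rw [setAverage_eq, Real.volume_real_Icc_of_le h01.le, smul_eq_mul, hF, inv_mul_eq_div]
  refine div_le_div_of_nonneg_right ?_ (sub_pos.2 h01).le
  refine setIntegral_mono_set hint' (Filter.Eventually.of_forall fun t => ?_)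
    (Filter.Eventually.of_forall hsub)
  exact integral_nonneg fun b => hg0 _

/-- If the derivative along a line varies by at most `A`, then the remainder of the linear Taylor
polynomial on this line is bounded by `A` times the distance. -/
theorem abs_taylor_line_le {w : Plane → ℝ} (hw : Differentiable ℝ w) (x e : Plane) {c d A : ℝ}
    {a b : ℝ} (ha : a ∈ Icc c d) (hb : b ∈ Icc c d)
    (hA : ∀ t ∈ Icc c d, |fderiv ℝ w (x + t • e) e - fderiv ℝ w (x + a • e) e| ≤ A) :
    |w (x + b • e) - w (x + a • e) - (b - a) * fderiv ℝ w (x + a • e) e| ≤ A * |b - a| := by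
  have hd : ∀ t ∈ Icc c d, HasDerivWithinAt
      (fun t : ℝ => w (x + t • e) - t * fderiv ℝ w (x + a • e) e)
      (fderiv ℝ w (x + t • e) e - fderiv ℝ w (x + a • e) e) (Icc c d) t := by
    intro t _
    have h2 : HasDerivAt (fun t : ℝ => x + t • e) e t := by
      simpa using ((hasDerivAt_id t).smul_const e).const_add x
    have h3 := (hw (x + t • e)).hasFDerivAt.comp_hasDerivAt t h2
    have h4 := (hasDerivAt_id t).mul_const (fderiv ℝ w (x + a • e) e)
    rw [one_mul] at h4
    exact (h3.sub h4).hasDerivWithinAt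
  have := (convex_Icc c d).norm_image_sub_le_of_norm_hasDerivWithin_le hd hA ha hb
  rw [Real.norm_eq_abs, Real.norm_eq_abs] at this
  convert this using 2
  ring

theorem abs_fderiv_fderiv_apply_le (w : Plane → ℝ) (x : Plane) {e e' : Plane} (he : ‖e‖ = 1)
    (he' : ‖e'‖ = 1) : |fderiv ℝ (fderiv ℝ w) x e e'| ≤ hessNorm w x := by
  have h1 := (fderiv ℝ (fderiv ℝ w) x).le_opNorm e
  have h2 := (fderiv ℝ (fderiv ℝ w) x e).le_opNorm e'
  rw [he, mul_one] at h1
  rw [he', mul_one] at h2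
  exact h2.trans h1

theorem abs_fderiv_sub_le_integral_line {w : Plane → ℝ} (hw : IsW2Inf w) (x : Plane) {e e' : Plane}
    (he : ‖e‖ = 1) (he' : ‖e'‖ = 1)
    (h : ∀ᵐ t : ℝ, DifferentiableAt ℝ (fderiv ℝ w) (x + t • e)) {a b c d : ℝ}
    (ha : a ∈ Icc c d) (hb : b ∈ Icc c d) :
    |fderiv ℝ w (x + b • e) e' - fderiv ℝ w (x + a • e) e'| ≤
      ∫ t in Icc c d, hessNorm w (x + t • e) := by
  obtain ⟨L, hL⟩ := hw.lipschitz_fderiv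
  obtain ⟨K, -, hK⟩ := hw.exists_hessNorm_le
  have hLip : LipschitzWith L fun x => fderiv ℝ w x e' := by
    refine LipschitzWith.of_dist_le_mul fun x y => ?_
    refine le_trans ?_ (hL.dist_le_mul x y)
    rw [dist_eq_norm, dist_eq_norm, ← sub_apply]
    simpa [he'] using (fderiv ℝ w x - fderiv ℝ w y).le_opNorm e'
  have hd : ∀ y, DifferentiableAt ℝ (fderiv ℝ w) y → HasFDerivAt (fun x => fderiv ℝ w x e')
      ((ContinuousLinearMap.apply ℝ ℝ e').comp (fderiv ℝ (fderiv ℝ w) y)) y := fun y hy =>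
    (ContinuousLinearMap.apply ℝ ℝ e').hasFDerivAt.comp y hy.hasFDerivAt
  refine LipschitzWith.abs_sub_le_integral_line hLip x e ?_ ha hb
    (fun t => hessNorm_nonneg _ _) ?_ ?_
  · filter_upwards [h] with t ht using (hd _ ht).differentiableAt
  · refine Integrable.of_bound ((hessNorm_measurable w).comp
      (by fun_prop : Measurable fun t : ℝ => x + t • e)).aestronglyMeasurable K
      (Filter.Eventually.of_forall fun t => ?_)
    rw [Real.norm_of_nonneg (hessNorm_nonneg _ _)]
    exact hK _
  · filter_upwards [h] with t ht
    rw [(hd _ ht).fderiv]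
    exact abs_fderiv_fderiv_apply_le w _ he he'

theorem integral_line_le_sqrt {w : Plane → ℝ} (hw : IsW2Inf w) (x e : Plane) {r A : ℝ}
    (hr : 0 < r) (hA : ∫ t in Icc (-r) r, hessNorm w (x + t • e) ^ 2 ≤ A) :
    ∫ t in Icc (-r) r, hessNorm w (x + t • e) ≤ √(2 * r * A) := by
  obtain ⟨K, -, hK⟩ := hw.exists_hessNorm_le
  have hm : Measurable fun t : ℝ => hessNorm w (x + t • e) :=
    (hessNorm_measurable w).comp (by fun_prop : Measurable fun t : ℝ => x + t • e)
  have h1 : IntegrableOn (fun t : ℝ => hessNorm w (x + t • e)) (Icc (-r) r) :=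
    Integrable.of_bound hm.aestronglyMeasurable K (Filter.Eventually.of_forall fun t => by
      rw [Real.norm_of_nonneg (hessNorm_nonneg _ _)]; exact hK _)
  have h2 : IntegrableOn (fun t : ℝ => hessNorm w (x + t • e) ^ 2) (Icc (-r) r) :=
    Integrable.of_bound (hm.pow_const 2).aestronglyMeasurable (K ^ 2)
      (Filter.Eventually.of_forall fun t => by
        rw [Real.norm_of_nonneg (sq_nonneg _)]
        exact pow_le_pow_left₀ (hessNorm_nonneg _ _) (hK _) 2)
  refine Real.le_sqrt_of_sq_le ((sq_integral_le h1 h2).trans ?_)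
  rw [measureReal_restrict_apply_univ, Real.volume_real_Icc_of_le (by linarith)]
  have : r - -r = 2 * r := by ring
  rw [this]
  exact mul_le_mul_of_nonneg_left hA (by positivity)

/-- A function in `W²_∞` is approximated on a square of size `r` by its linear Taylor polynomial at a
suitable point, with an error of order `r` times the `H²` seminorm on a ball of the same size. -/
theorem exists_taylor_point {w : Plane → ℝ} (hw : IsW2Inf w) {e e' : Plane} (he : ‖e‖ = 1)
    (he' : ‖e'‖ = 1) (h : inner ℝ e e' = 0) (z : Plane) {r t₀ t₁ : ℝ} (h0 : -r ≤ t₀)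
    (h01 : t₀ < t₁) (h1 : t₁ ≤ r) :
    ∃ t ∈ Icc t₀ t₁, ∃ s ∈ Icc (-r) r,
      (∀ y ∈ Icc (-r) r, ∀ y' ∈ Icc (-r) r,
        |fderiv ℝ w (z + t • e + y • e') e' - fderiv ℝ w (z + t • e + y' • e') e'| ≤
          √(2 * r / (t₁ - t₀)) * √(∫ x in Metric.closedBall z (2 * r), hessNorm w x ^ 2)) ∧
      (∀ x ∈ Icc (-r) r, ∀ y ∈ Icc (-r) r,
        |w (z + x • e + y • e') - w (z + t • e + s • e')
          - (x - t) * fderiv ℝ w (z + t • e + s • e') e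
          - (y - s) * fderiv ℝ w (z + t • e + s • e') e'| ≤
          (4 + 2 * √(2 * r / (t₁ - t₀))) * r *
            √(∫ x in Metric.closedBall z (2 * r), hessNorm w x ^ 2)) := by
  have hr : 0 < r := by linarith
  obtain ⟨K, hK0, hK⟩ := hw.exists_hessNorm_le
  set E := ∫ x in Metric.closedBall z (2 * r), hessNorm w x ^ 2 with hE
  set Q : Set ℝ := Icc (-r) r with hQ
  set Φ : ℝ × ℝ → Plane := fun p => z + p.1 • e + p.2 • e' with hΦ
  have hΦm : MeasurePreserving Φ := measurePreserving_frame he he' h z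
  set g : ℝ × ℝ → ℝ := fun p => hessNorm w (Φ p) ^ 2 with hg
  have hGm : Measurable fun p => hessNorm w (Φ p) := (hessNorm_measurable w).comp hΦm.measurable
  have hgm : Measurable g := hGm.pow_const 2
  have hg0 : ∀ p, 0 ≤ g p := fun p => sq_nonneg _
  have hgK : ∀ p, |g p| ≤ K ^ 2 := fun p => by
    rw [abs_of_nonneg (hg0 p)]
    exact pow_le_pow_left₀ (hessNorm_nonneg _ _) (hK _) 2
  have hfin : IsFiniteMeasure ((volume : Measure (ℝ × ℝ)).restrict (Q ×ˢ Q)) :=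
    ⟨by rw [Measure.restrict_apply_univ]
        exact ((isCompact_Icc (α := ℝ)).prod isCompact_Icc).measure_lt_top⟩
  have hGi : IntegrableOn (fun p => hessNorm w (Φ p)) (Q ×ˢ Q) :=
    Integrable.of_bound hGm.aestronglyMeasurable K (Filter.Eventually.of_forall fun p => by
      rw [Real.norm_of_nonneg (hessNorm_nonneg _ _)]; exact hK _)
  have hgi : IntegrableOn g (Q ×ˢ Q) :=
    Integrable.of_bound hgm.aestronglyMeasurable (K ^ 2) (Filter.Eventually.of_forall hgK)
  -- The frame preserves area and maps the square $[-r,r]^2$ into the ball of radius $2r$.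
  have hEQ : ∫ p in Q ×ˢ Q, g p ≤ E := by
    have hB : MeasurableSet (Metric.closedBall z (2 * r)) := Metric.isClosed_closedBall.measurableSet
    have hmp := hΦm.restrict_preimage hB
    have hsub : Q ×ˢ Q ⊆ Φ ⁻¹' Metric.closedBall z (2 * r) := by
      rintro ⟨a, b⟩ ⟨ha, hb⟩
      rw [mem_preimage, mem_closedBall_iff_norm]
      have : Φ (a, b) - z = a • e + b • e' := by simp only [hΦ]; abel
      rw [this]
      refine (norm_add_le _ _).trans ?_
      rw [norm_smul, norm_smul, he, he', Real.norm_eq_abs, Real.norm_eq_abs]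
      have h2 := abs_le.2 ha
      have h3 := abs_le.2 hb
      simp only at h2 h3
      linarith
    have hBfin : IsFiniteMeasure (volume.restrict (Metric.closedBall z (2 * r))) :=
      ⟨by simpa using measure_closedBall_lt_top (μ := volume) (x := z) (r := 2 * r)⟩
    have hE' : E = ∫ p in Φ ⁻¹' Metric.closedBall z (2 * r), g p := by
      rw [hE, ← hmp.map_eq, integral_map hmp.measurable.aemeasurable]
      exact ((hessNorm_measurable w).pow_const 2).aestronglyMeasurable
    have hfin' : IsFiniteMeasure (volume.restrict (Φ ⁻¹' Metric.closedBall z (2 * r))) :=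
      ⟨by rw [Measure.restrict_apply_univ, hΦm.measure_preimage hB.nullMeasurableSet]
          exact measure_closedBall_lt_top⟩
    rw [hE']
    exact setIntegral_mono_set
      (Integrable.of_bound hgm.aestronglyMeasurable (K ^ 2) (Filter.Eventually.of_forall hgK))
      (Filter.Eventually.of_forall hg0) (Filter.Eventually.of_forall hsub)
  have hE0 : 0 ≤ E := integral_nonneg fun x => sq_nonneg _
  have hS : ∀ᵐ p : ℝ × ℝ, p ∈ {p | DifferentiableAt ℝ (fderiv ℝ w) (Φ p)} :=
    hΦm.quasiMeasurePreserving.ae hw.ae_differentiableAt_fderiv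
  have hS' : ∀ᵐ p : ℝ × ℝ, p ∈ {p : ℝ × ℝ | DifferentiableAt ℝ (fderiv ℝ w) (Φ p.swap)} :=
    (Measure.measurePreserving_swap (μ := (volume : Measure ℝ))
      (ν := (volume : Measure ℝ))).quasiMeasurePreserving.ae hS
  -- Two good lines are chosen: one parallel to `e'` with abscissa in `Icc t₀ t₁`, and one parallel
  -- to `e` with ordinate anywhere in $[-r,r]$. The Taylor point is their intersection.
  obtain ⟨t, ht, htd, hti⟩ := exists_good_line hgm hgK hg0 hS h0 h01 h1
  obtain ⟨s, hs, hsd, hsi⟩ := exists_good_line (g := fun p => g p.swap) (hgm.comp measurable_swap)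
    (fun p => hgK _) (fun p => hg0 _) hS' le_rfl (by linarith : -r < r) le_rfl
  have hswap : ∫ p in Q ×ˢ Q, g p.swap = ∫ p in Q ×ˢ Q, g p :=
    setIntegral_prod_swap (μ := volume) (ν := volume) Q Q g
  rw [hswap] at hsi
  have htQ : t ∈ Q := ⟨h0.trans ht.1, ht.2.trans h1⟩
  simp only [mem_ofPred_eq, hΦ, Prod.swap, hg] at htd hti hsd hsi
  have hcomm : ∀ a b : ℝ, z + a • e + b • e' = z + b • e' + a • e := fun a b => by abel
  -- the oscillation of the normal derivatives on the two lines through the point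
  have hB : ∀ e₂ : Plane, ‖e₂‖ = 1 → ∀ y ∈ Q, ∀ y' ∈ Q,
      |fderiv ℝ w (z + t • e + y • e') e₂ - fderiv ℝ w (z + t • e + y' • e') e₂| ≤
        √(2 * r / (t₁ - t₀)) * √E := by
    intro e₂ he₂ y hy y' hy'
    refine (abs_fderiv_sub_le_integral_line hw (z + t • e) he' he₂ htd hy' hy).trans ?_
    refine (integral_line_le_sqrt hw _ _ hr hti).trans ?_
    rw [← Real.sqrt_mul (div_nonneg (by positivity) (by linarith))]
    refine Real.sqrt_le_sqrt ?_
    have : 2 * r * ((∫ p in Q ×ˢ Q, g p) / (t₁ - t₀)) = 2 * r / (t₁ - t₀) * ∫ p in Q ×ˢ Q, g p := by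
      ring
    exact this.trans_le (mul_le_mul_of_nonneg_left hEQ (div_nonneg (by positivity) (by linarith)))
  have hA : ∀ x ∈ Q, ∀ x' ∈ Q,
      |fderiv ℝ w (z + s • e' + x • e) e - fderiv ℝ w (z + s • e' + x' • e) e| ≤ √E := by
    intro x hx x' hx'
    simp only [hcomm] at hsd hsi
    refine (abs_fderiv_sub_le_integral_line hw (z + s • e') he he hsd hx' hx).trans ?_
    refine (integral_line_le_sqrt hw _ _ hr hsi).trans (Real.sqrt_le_sqrt ?_)
    refine le_trans (le_of_eq ?_) hEQ
    rw [show r - -r = 2 * r by ring]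
    simp only [hg, hΦ, hcomm]
    field_simp
  refine ⟨t, ht, s, hs, hB e' he', fun x hx y hy => ?_⟩
  have hlen : ∀ a ∈ Q, ∀ b ∈ Q, |a - b| ≤ 2 * r := fun a ha b hb => by
    rw [abs_le]; constructor <;> linarith [ha.1, ha.2, hb.1, hb.2]
  have hR1 : |w (z + x • e + s • e') - w (z + t • e + s • e')
      - (x - t) * fderiv ℝ w (z + t • e + s • e') e| ≤ 2 * r * √E := by
    have := abs_taylor_line_le hw.differentiable (z + s • e') e htQ hx fun a ha => hA a ha t htQ
    simp only [hcomm]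
    refine this.trans ?_
    rw [mul_comm]
    exact mul_le_mul_of_nonneg_right (hlen x hx t htQ) (Real.sqrt_nonneg _)
  have hR2 : |w (z + t • e + y • e') - w (z + t • e + s • e')
      - (y - s) * fderiv ℝ w (z + t • e + s • e') e'| ≤
        2 * r * (√(2 * r / (t₁ - t₀)) * √E) := by
    have := abs_taylor_line_le hw.differentiable (z + t • e) e' hs hy
      fun a ha => hB e' he' a ha s hs
    refine this.trans ?_
    rw [mul_comm]
    exact mul_le_mul_of_nonneg_right (hlen y hy s hs) (by positivity)
  -- This mixed difference over a rectangle is controlled by the integral of $|D^2w|$ over the whole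
  -- square, hence by Cauchy–Schwarz on an area $4r^2$.
  have hR3 : |(w (z + x • e + y • e') - w (z + t • e + y • e')) -
      (w (z + x • e + s • e') - w (z + t • e + s • e'))| ≤ 2 * r * √E := by
    obtain ⟨L, hL⟩ := hw.lipschitz
    set F : Plane → ℝ := fun p => w (p + x • e) - w (p + t • e) with hF
    have hFL : LipschitzWith (L * 1 + L * 1) F :=
      (hL.comp (isometry_add_right (x • e)).lipschitz).sub
        (hL.comp (isometry_add_right (t • e)).lipschitz)
    have hFd : ∀ p, HasFDerivAt F (fderiv ℝ w (p + x • e) - fderiv ℝ w (p + t • e)) p := by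
      intro p
      exact ((hasFDerivAt_comp_add_right (x • e)).2 (hw.differentiable _).hasFDerivAt).sub
        ((hasFDerivAt_comp_add_right (t • e)).2 (hw.differentiable _).hasFDerivAt)
    have hline := LipschitzWith.abs_sub_le_integral_line hFL z e'
      (Filter.Eventually.of_forall fun y => (hFd _).differentiableAt) hs hy
      (g := fun y => ∫ a in Q, hessNorm w (Φ (a, y)))
      (fun y => integral_nonneg fun a => hessNorm_nonneg _ _) ?_ ?_
    · have e1 : F (z + y • e') - F (z + s • e') =
          (w (z + x • e + y • e') - w (z + t • e + y • e')) -
          (w (z + x • e + s • e') - w (z + t • e + s • e')) := by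
        simp only [hF, hcomm]
      rw [e1] at hline
      refine hline.trans ?_
      have e2 : ∫ y in Q, ∫ a in Q, hessNorm w (Φ (a, y)) = ∫ p in Q ×ˢ Q, hessNorm w (Φ p) := by
        have h1 := hGi
        rw [IntegrableOn, Measure.volume_eq_prod, ← Measure.prod_restrict] at h1
        have h2 := integral_prod_symm _ h1
        rw [Measure.prod_restrict] at h2
        exact h2.symm
      rw [e2]
      have e3 := sq_integral_le hGi hgi
      have e4 : ((volume : Measure (ℝ × ℝ)).restrict (Q ×ˢ Q)).real univ = 4 * r ^ 2 := by
        rw [measureReal_restrict_apply_univ]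
        change (volume.prod volume : Measure (ℝ × ℝ)).real (Q ×ˢ Q) = _
        rw [measureReal_prod_prod, Real.volume_real_Icc_of_le (by linarith)]
        ring
      rw [e4] at e3
      have e5 : 2 * r * √E = √(4 * r ^ 2 * E) := by
        rw [Real.sqrt_mul (by positivity), show 4 * r ^ 2 = (2 * r) ^ 2 by ring,
          Real.sqrt_sq (by positivity)]
      rw [e5]
      exact Real.le_sqrt_of_sq_le (e3.trans (mul_le_mul_of_nonneg_left hEQ (by positivity)))
    · have := hGi
      rw [IntegrableOn, Measure.volume_eq_prod, ← Measure.prod_restrict] at this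
      exact this.integral_prod_right
    · have := Measure.ae_ae_of_ae_prod hS'
      filter_upwards [this] with y hy
      rw [(hFd _).fderiv, sub_apply]
      simp only [hΦ, Prod.swap, hcomm] at hy
      have := abs_fderiv_sub_le_integral_line hw (z + y • e') he he' hy htQ hx
      simpa only [hΦ, hcomm] using this
  -- The Taylor remainder splits into the two one-dimensional remainders on the good lines and the
  -- mixed difference.
  have hsum : w (z + x • e + y • e') - w (z + t • e + s • e')
          - (x - t) * fderiv ℝ w (z + t • e + s • e') e
          - (y - s) * fderiv ℝ w (z + t • e + s • e') e' =
      (w (z + x • e + s • e') - w (z + t • e + s • e')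
        - (x - t) * fderiv ℝ w (z + t • e + s • e') e) +
      (w (z + t • e + y • e') - w (z + t • e + s • e')
        - (y - s) * fderiv ℝ w (z + t • e + s • e') e') +
      ((w (z + x • e + y • e') - w (z + t • e + y • e')) -
        (w (z + x • e + s • e') - w (z + t • e + s • e'))) := by ring
  rw [hsum]
  refine (abs_add_three _ _ _).trans ((add_le_add_three hR1 hR2 hR3).trans (le_of_eq ?_))
  ring

theorem exists_orthogonal_unit {e : Plane} (he : ‖e‖ = 1) :
    ∃ e' : Plane, ‖e'‖ = 1 ∧ inner ℝ e e' = 0 := by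
  refine ⟨!₂[-e 1, e 0], ?_, ?_⟩
  · have h1 := plane_norm_sq e
    have h2 := plane_norm_sq !₂[-e 1, e 0]
    simp only [Matrix.cons_val_zero, Matrix.cons_val_one] at h2
    rw [he] at h1
    have h3 : ‖(!₂[-e 1, e 0] : Plane)‖ ^ 2 = 1 := by rw [h2]; linarith
    exact (pow_eq_one_iff_of_nonneg (norm_nonneg _) two_ne_zero).1 h3
  · simp [PiLp.inner_apply, Fin.sum_univ_two]
    ring

/-- Approximation of a `W²_∞` function by an affine function on a disc. -/
theorem exists_affine_approx {w : Plane → ℝ} (hw : IsW2Inf w) (z : Plane) {r : ℝ} (hr : 0 < r) :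
    ∃ (c : ℝ) (A : Plane →L[ℝ] ℝ), ∀ p, ‖p - z‖ ≤ r →
      |w p - (c + A p)| ≤ 6 * r * √(∫ x in Metric.closedBall z (2 * r), hessNorm w x ^ 2) := by
  set e : Plane := EuclideanSpace.single 0 1 with hed
  have he : ‖e‖ = 1 := by simp [hed]
  obtain ⟨e', he', h⟩ := exists_orthogonal_unit he
  -- With the full interval $[-r,r]$ the ratio $2r/(t_1-t_0)$ is 1, and the constant becomes
  -- $4+2=6$.
  obtain ⟨t, -, s, -, -, hT⟩ := exists_taylor_point hw he he' h z (r := r) le_rfl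
    (by linarith : -r < r) le_rfl
  have h1 : 2 * r / (r - -r) = 1 := by
    rw [show r - -r = 2 * r by ring]; exact div_self (by positivity)
  rw [h1, Real.sqrt_one] at hT
  set p₀ := z + t • e + s • e' with hp₀
  refine ⟨w p₀ - fderiv ℝ w p₀ p₀, fderiv ℝ w p₀, fun p hp => ?_⟩
  obtain ⟨a, b, hpab, ha, hb⟩ := exists_frame_coord he he' h z p
  have h2 := hT a (abs_le.1 (ha.trans hp)) b (abs_le.1 (hb.trans hp))
  rw [← hpab] at h2
  have h3 : fderiv ℝ w p₀ p - fderiv ℝ w p₀ p₀ =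
      (a - t) * fderiv ℝ w p₀ e + (b - s) * fderiv ℝ w p₀ e' := by
    rw [← map_sub]
    have : p - p₀ = (a - t) • e + (b - s) • e' := by rw [hpab, hp₀]; module
    rw [this, map_add, map_smul, map_smul, smul_eq_mul, smul_eq_mul]
  convert h2 using 2
  · linarith
  · norm_num

/-- A bound for a `W²_∞` function that vanishes together with its gradient on a line segment. -/
theorem abs_le_of_zero_on_segment {w : Plane → ℝ} (hw : IsW2Inf w) (z : Plane) {e : Plane}
    (he : ‖e‖ = 1) {r τ κ : ℝ} (hτ : 0 < τ) (hτr : τ ≤ r) (hκ : r ≤ κ * τ)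
    (h0 : ∀ t ∈ Icc 0 τ, w (z + t • e) = 0 ∧ fderiv ℝ w (z + t • e) = 0) {p : Plane}
    (hp : ‖p - z‖ ≤ r) :
    |w p| ≤ (4 + 2 * √(2 * κ)) * (5 + 2 * κ) * r *
      √(∫ x in Metric.closedBall z (2 * r), hessNorm w x ^ 2) := by
  have hr : 0 < r := hτ.trans_le hτr
  obtain ⟨e', he', h⟩ := exists_orthogonal_unit he
  -- The abscissa is restricted to $[0,\tau]$, so the line parallel to `e'` starts at a point of the
  -- segment where $w$ and its gradient vanish.
  obtain ⟨t, ht, s, hs, hN, hT⟩ := exists_taylor_point hw he he' h z (r := r) (t₀ := 0) (t₁ := τ)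
    (by linarith) hτ hτr
  set E := √(∫ x in Metric.closedBall z (2 * r), hessNorm w x ^ 2) with hE
  have hE0 : 0 ≤ E := Real.sqrt_nonneg _
  rw [sub_zero] at hN hT
  have hrτ : r / τ ≤ κ := (div_le_iff₀ hτ).2 hκ
  have hκ1 : 1 ≤ κ := le_trans ((one_le_div hτ).2 hτr) hrτ
  have hsq : √(2 * r / τ) ≤ √(2 * κ) := Real.sqrt_le_sqrt (by
    rw [mul_div_assoc]; linarith)
  set k := √(2 * κ) with hk
  have hk0 : 0 ≤ k := Real.sqrt_nonneg _
  set p₀ := z + t • e + s • e' with hp₀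
  set T : ℝ → ℝ → ℝ := fun x y => w p₀ + (x - t) * fderiv ℝ w p₀ e + (y - s) * fderiv ℝ w p₀ e'
    with hTd
  set ε := (4 + 2 * k) * r * E with hε
  have hε0 : 0 ≤ ε := by positivity
  have hT' : ∀ x ∈ Icc (-r) r, ∀ y ∈ Icc (-r) r, |w (z + x • e + y • e') - T x y| ≤ ε := by
    intro x hx y hy
    have h1 := hT x hx y hy
    have h2 : (4 + 2 * √(2 * r / τ)) * r * E ≤ ε := by
      have : 4 + 2 * √(2 * r / τ) ≤ 4 + 2 * k := by linarith
      exact mul_le_mul_of_nonneg_right (mul_le_mul_of_nonneg_right this hr.le) hE0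
    refine le_trans (le_of_eq ?_) (h1.trans h2)
    simp only [hTd]
    congr 1
    ring
  have htr : t ∈ Icc (-r) r := ⟨by linarith [ht.1], by linarith [ht.2]⟩
  have h0r : (0 : ℝ) ∈ Icc (-r) r := ⟨by linarith, by linarith⟩
  have hT0 : ∀ x ∈ Icc 0 τ, |T x 0| ≤ ε := by
    intro x hx
    have h1 := hT' x ⟨by linarith [hx.1], by linarith [hx.2]⟩ 0 h0r
    rw [zero_smul, add_zero, (h0 x hx).1, zero_sub, abs_neg] at h1
    exact h1
  -- On the good line $w$ has zero value and derivative at the segment, so $|w|\le\varepsilon$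
  -- there; the approximation error adds another $\varepsilon$.
  have hTt : ∀ y ∈ Icc (-r) r, |T t y| ≤ 2 * ε := by
    intro y hy
    have h1 := abs_taylor_line_le hw.differentiable (z + t • e) e' h0r hy
      fun y' hy' => hN y' hy' 0 h0r
    rw [zero_smul, add_zero, (h0 t ht).1, (h0 t ht).2] at h1
    simp only [zero_apply, mul_zero, sub_zero] at h1
    have h2 := hT' t htr y hy
    have h3 : √(2 * r / τ) * E * |y| ≤ ε := by
      have h4 : |y| ≤ r := abs_le.2 hy
      calc √(2 * r / τ) * E * |y| ≤ k * E * r := by gcongr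
        _ ≤ ε := by
          rw [hε]
          have : 0 ≤ r * E := by positivity
          nlinarith
    have h5 : T t y = w (z + t • e + y • e') - (w (z + t • e + y • e') - T t y) := by ring
    rw [h5]
    refine (abs_sub _ _).trans ?_
    linarith
  obtain ⟨a, b, hpab, ha, hb⟩ := exists_frame_coord he he' h z p
  have haQ : a ∈ Icc (-r) r := abs_le.1 (ha.trans hp)
  have hbQ : b ∈ Icc (-r) r := abs_le.1 (hb.trans hp)
  -- Linear extrapolation from $[0,\tau]$, where the affine function is at most $\varepsilon$, to
  -- $[-r,r]$.
  have hTa0 : |T a 0| ≤ (1 + 2 * κ) * ε := by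
    have h1 : T a 0 = T 0 0 + a / τ * (T τ 0 - T 0 0) := by
      simp only [hTd]
      field_simp
      ring
    have h2 := hT0 0 ⟨le_rfl, hτ.le⟩
    have h3 := hT0 τ ⟨hτ.le, le_rfl⟩
    rw [h1]
    have h4 : |a / τ| ≤ κ := by
      rw [abs_div, abs_of_pos hτ]
      exact (div_le_div_of_nonneg_right (ha.trans hp) hτ.le).trans hrτ
    have h5 : |T τ 0 - T 0 0| ≤ 2 * ε := (abs_sub _ _).trans (by linarith)
    calc |T 0 0 + a / τ * (T τ 0 - T 0 0)| ≤ |T 0 0| + |a / τ| * |T τ 0 - T 0 0| := by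
          rw [← abs_mul]; exact abs_add_le _ _
      _ ≤ ε + κ * (2 * ε) := by gcongr
      _ = _ := by ring
  -- An affine function is determined by its restrictions to the two coordinate lines:
  -- $T(a,b)=T(a,0)+T(t,b)-T(t,0)$. The four contributions add up to $5+2\kappa$ times
  -- $\varepsilon$.
  have hfin : w p = (w (z + a • e + b • e') - T a b) + (T a 0 + (T t b - T t 0)) := by
    rw [← hpab]
    simp only [hTd]
    ring
  rw [hfin]
  calc |(w (z + a • e + b • e') - T a b) + (T a 0 + (T t b - T t 0))|
      ≤ |w (z + a • e + b • e') - T a b| + (|T a 0| + (|T t b| + |T t 0|)) :=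
        (abs_add_le _ _).trans (add_le_add le_rfl ((abs_add_le _ _).trans
          (add_le_add le_rfl (abs_sub _ _))))
    _ ≤ ε + ((1 + 2 * κ) * ε + (2 * ε + ε)) := by
        gcongr
        · exact hT' a haQ b hbQ
        · exact hTt b hbQ
        · exact hT0 t ht
    _ = (4 + 2 * k) * (5 + 2 * κ) * r * E := by rw [hε]; ring

/-! ### The boundary of a polygonal domain -/

/-- Half the length of the shortest of the finitely many segments is admissible: from any point of a
segment one of its end points is at least half its length away. -/
theorem IsPolygonalDomain.exists_boundary_segment {Ω : Set Plane} (hΩ : IsPolygonalDomain Ω) :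
    ∃ ℓ : ℝ, 0 < ℓ ∧ ∀ z ∈ frontier Ω, ∃ e : Plane, ‖e‖ = 1 ∧
      ∀ t ∈ Icc 0 ℓ, z + t • e ∈ frontier Ω := by
  obtain ⟨S, hS, hfr⟩ := hΩ.frontier_eq
  have hmin : ∃ ℓ : ℝ, 0 < ℓ ∧ ∀ s ∈ S, ℓ ≤ ‖s.2 - s.1‖ / 2 := by
    classical
    clear hfr
    induction S using Finset.induction_on with
    | empty => exact ⟨1, one_pos, by simp⟩
    | insert s S _ ih =>
      obtain ⟨ℓ, hℓ, h⟩ := ih fun s' hs' => hS s' (Finset.mem_insert_of_mem hs')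
      have hs := hS s (Finset.mem_insert_self _ _)
      have hpos : 0 < ‖s.2 - s.1‖ / 2 := half_pos (norm_pos_iff.2 (sub_ne_zero.2 (Ne.symm hs)))
      refine ⟨min ℓ (‖s.2 - s.1‖ / 2), lt_min hℓ hpos, fun s' hs' => ?_⟩
      rcases Finset.mem_insert.1 hs' with rfl | hs'
      · exact min_le_right _ _
      · exact (min_le_left _ _).trans (h s' hs')
  obtain ⟨ℓ, hℓ, hle⟩ := hmin
  refine ⟨ℓ, hℓ, fun z hz => ?_⟩
  rw [hfr] at hz
  simp only [mem_iUnion, exists_prop] at hz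
  obtain ⟨s, hs, hz⟩ := hz
  -- the direction towards the end point that is farther away
  have key : ∀ A B : Plane, segment ℝ A B ⊆ frontier Ω → ℓ ≤ ‖B - A‖ / 2 →
      ∀ a b : ℝ, 1 / 2 ≤ a → 0 ≤ b → a + b = 1 → ∃ e : Plane, ‖e‖ = 1 ∧
      ∀ t ∈ Icc 0 ℓ, (a • A + b • B) + t • e ∈ frontier Ω := by
    intro A B hAB hL a b ha hb hab
    have hpos : 0 < ‖B - A‖ := by linarith
    refine ⟨‖B - A‖⁻¹ • (B - A), ?_, fun t ht => hAB ?_⟩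
    · rw [norm_smul, norm_inv, norm_norm, inv_mul_cancel₀ hpos.ne']
    · refine ⟨a - t * ‖B - A‖⁻¹, b + t * ‖B - A‖⁻¹, ?_, ?_, by linarith, by module⟩
      · have : t * ‖B - A‖⁻¹ ≤ 1 / 2 := by
          rw [← div_eq_mul_inv, div_le_iff₀ hpos]; linarith [ht.2]
        linarith
      · have := mul_nonneg ht.1 (inv_nonneg.2 hpos.le)
        linarith
  have hsub : segment ℝ s.1 s.2 ⊆ frontier Ω := by
    rw [hfr]
    exact fun y hy => mem_biUnion hs hy
  obtain ⟨a, b, ha, hb, hab, rfl⟩ := hz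
  rcases le_total (1 / 2) a with h | h
  · exact key _ _ hsub (hle s hs) a b h hb hab
  · rw [add_comm (a • s.1)]
    refine key _ _ (segment_symm ℝ s.1 s.2 ▸ hsub) ?_ b a (by linarith) ha (by linarith)
    rw [norm_sub_rev]
    exact hle s hs

theorem IsPolygonalDomain.volume_frontier {Ω : Set Plane} (hΩ : IsPolygonalDomain Ω) :
    volume (frontier Ω) = 0 := by
  obtain ⟨S, -, hfr⟩ := hΩ.frontier_eq
  rw [hfr]
  refine (measure_biUnion_null_iff S.countable_toSet).2 fun s _ => ?_
  have hsub : segment ℝ s.1 s.2 ⊆ (affineSpan ℝ {s.1, s.2} : Set Plane) := by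
    rw [← convexHull_pair]
    exact convexHull_subset_affineSpan _
  refine measure_mono_null hsub (Measure.addHaar_affineSubspace _ _ fun htop => ?_)
  have h1 : Module.finrank ℝ (vectorSpan ℝ {s.1, s.2}) ≤ 1 :=
    finrank_vectorSpan_insert_le_set ℝ {s.2} s.1 |>.trans (by simp)
  rw [← direction_affineSpan, htop, AffineSubspace.direction_top, finrank_top] at h1
  simp at h1

/-! ### Biquadratic polynomials -/

theorem biquadratics_monomial_mem (k l : Fin 3) :
    (fun x : Plane => x 0 ^ (k : ℕ) * x 1 ^ (l : ℕ)) ∈ biquadratics :=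
  Submodule.subset_span ⟨(k, l), rfl⟩

theorem const_mem_biquadratics (c : ℝ) : (fun _ : Plane => c) ∈ biquadratics := by
  have := Submodule.smul_mem _ c (biquadratics_monomial_mem 0 0)
  convert this using 1
  ext x
  simp

theorem affine_mem_biquadratics (c : ℝ) (A : Plane →L[ℝ] ℝ) :
    (fun x : Plane => c + A x) ∈ biquadratics := by
  have h0 := const_mem_biquadratics c
  have h1 := Submodule.smul_mem _ (A (EuclideanSpace.single 0 1)) (biquadratics_monomial_mem 1 0)
  have h2 := Submodule.smul_mem _ (A (EuclideanSpace.single 1 1)) (biquadratics_monomial_mem 0 1)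
  convert add_mem h0 (add_mem h1 h2) using 1
  ext x
  have : A x = x 0 * A (EuclideanSpace.single 0 1) + x 1 * A (EuclideanSpace.single 1 1) := by
    conv_lhs => rw [plane_eq_add x]
    rw [map_add, map_smul, map_smul, smul_eq_mul, smul_eq_mul]
  simp [this, mul_comm]

theorem contDiff_of_mem_biquadratics {q : Plane → ℝ} (hq : q ∈ biquadratics) : ContDiff ℝ 2 q := by
  induction hq using Submodule.span_induction with
  | mem q hq =>
    obtain ⟨e, rfl⟩ := hq
    have h : ∀ i : Fin 2, ContDiff ℝ 2 fun x : Plane => x i := fun i =>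
      (EuclideanSpace.proj i : Plane →L[ℝ] ℝ).contDiff
    exact ((h 0).pow _).mul ((h 1).pow _)
  | zero => exact contDiff_const
  | add p q _ _ hp hq => exact hp.add hq
  | smul c q _ hq => exact hq.const_smul c

theorem differentiable_of_mem_biquadratics {q : Plane → ℝ} (hq : q ∈ biquadratics) :
    Differentiable ℝ q :=
  (contDiff_of_mem_biquadratics hq).differentiable two_ne_zero

theorem differentiable_fderiv_of_mem_biquadratics {q : Plane → ℝ} (hq : q ∈ biquadratics) :
    Differentiable ℝ (fderiv ℝ q) :=
  ((contDiff_of_mem_biquadratics hq).fderiv_right (m := 1) (by norm_num)).differentiable one_ne_zero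

theorem fderiv_mem_biquadratics {q : Plane → ℝ} (hq : q ∈ biquadratics) (j : Fin 2) :
    (fun x => fderiv ℝ q x (EuclideanSpace.single j 1)) ∈ biquadratics := by
  induction hq using Submodule.span_induction with
  | mem q hq =>
    obtain ⟨⟨k, l⟩, rfl⟩ := hq
    have h : ∀ (i : Fin 2) (x : Plane), HasFDerivAt (fun x : Plane => x i)
        (EuclideanSpace.proj i : Plane →L[ℝ] ℝ) x := fun i x =>
      (EuclideanSpace.proj i : Plane →L[ℝ] ℝ).hasFDerivAt
    have hd : ∀ x : Plane, fderiv ℝ (fun x : Plane => x 0 ^ (k : ℕ) * x 1 ^ (l : ℕ)) x = _ :=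
      fun x => (((h 0 x).pow (k : ℕ)).mul ((h 1 x).pow (l : ℕ))).fderiv
    simp only [hd]
    fin_cases j
    -- For $k=0$ the truncated exponent $k-1$ is harmless since the coefficient $k$ vanishes.
    · have h1 := Submodule.smul_mem _ ((k : ℕ) : ℝ)
        (biquadratics_monomial_mem ⟨(k : ℕ) - 1, by omega⟩ l)
      convert h1 using 1
      ext x
      simp
      ring
    · have h1 := Submodule.smul_mem _ ((l : ℕ) : ℝ)
        (biquadratics_monomial_mem k ⟨(l : ℕ) - 1, by omega⟩)
      convert h1 using 1
      ext x
      simp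
      ring
  | zero =>
    convert biquadratics.zero_mem using 1
    ext x
    have : fderiv ℝ (0 : Plane → ℝ) x = 0 := by simp
    simp [this]
  | add p q hp' hq' hp hq =>
    convert add_mem hp hq using 1
    ext x
    rw [fderiv_add (differentiable_of_mem_biquadratics hp' x)
      (differentiable_of_mem_biquadratics hq' x)]
    rfl
  | smul c q hq' hq =>
    convert Submodule.smul_mem _ c hq using 1
    ext x
    rw [fderiv_const_smul (differentiable_of_mem_biquadratics hq' x)]
    rfl

theorem quadratic_on_line_of_mem_biquadratics {q : Plane → ℝ} (hq : q ∈ biquadratics) (i : Fin 2)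
    (x : Plane) : ∃ a b c : ℝ, ∀ t : ℝ,
      q (x + t • EuclideanSpace.single i 1) = a + b * t + c * t ^ 2 := by
  induction hq using Submodule.span_induction with
  | mem q hq =>
    obtain ⟨⟨k, l⟩, rfl⟩ := hq
    have hpow : ∀ (m : Fin 3) (s : ℝ), ∃ a b c : ℝ, ∀ t : ℝ,
        (s + t) ^ (m : ℕ) = a + b * t + c * t ^ 2 := by
      intro m s
      fin_cases m
      · exact ⟨1, 0, 0, fun t => by simp⟩
      · exact ⟨s, 1, 0, fun t => by simp⟩
      · exact ⟨s ^ 2, 2 * s, 1, fun t => by simp; ring⟩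
    fin_cases i
    · obtain ⟨a, b, c, h⟩ := hpow k (x 0)
      refine ⟨a * x 1 ^ (l : ℕ), b * x 1 ^ (l : ℕ), c * x 1 ^ (l : ℕ), fun t => ?_⟩
      simp [h t]
      ring
    · obtain ⟨a, b, c, h⟩ := hpow l (x 1)
      refine ⟨x 0 ^ (k : ℕ) * a, x 0 ^ (k : ℕ) * b, x 0 ^ (k : ℕ) * c, fun t => ?_⟩
      simp [h t]
      ring
  | zero => exact ⟨0, 0, 0, fun t => by simp⟩
  | add p q _ _ hp hq =>
    obtain ⟨a, b, c, h⟩ := hp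
    obtain ⟨a', b', c', h'⟩ := hq
    exact ⟨a + a', b + b', c + c', fun t => by rw [Pi.add_apply, h, h']; ring⟩
  | smul s q _ hq =>
    obtain ⟨a, b, c, h⟩ := hq
    exact ⟨s * a, s * b, s * c, fun t => by rw [Pi.smul_apply, h, smul_eq_mul]; ring⟩

/-- Markov's inequality for the derivative at `0` of a quadratic polynomial. -/
theorem abs_linear_coeff_le {a b c t₀ t₁ ℓ S : ℝ} (h0 : t₀ < 0) (h1 : 0 < t₁) (hℓ : 0 < ℓ)
    (hℓ' : ℓ ≤ t₁ - t₀) (hS : ∀ t ∈ Ioo t₀ t₁, |a + b * t + c * t ^ 2| ≤ S) :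
    |b| ≤ 36 * S / ℓ := by
  -- Sampling at $m$ and $m\pm d$ gives $|2cd^2|\le4S$ and $|(b+2cm)d|\le S$. As 0 lies in the
  -- interval, $|m|\le2d$, so $|b|d\le9S$, and $d\ge\ell/4$ yields 36.
  set m := (t₀ + t₁) / 2 with hm
  set d := (t₁ - t₀) / 4 with hd
  have hd0 : 0 < d := by rw [hd]; linarith
  have hmem : ∀ s ∈ Icc (-1 : ℝ) 1, m + s * d ∈ Ioo t₀ t₁ := fun s hs => by
    constructor <;> nlinarith [hs.1, hs.2]
  have e0 := abs_le.1 (hS m (by simpa using hmem 0 ⟨by norm_num, by norm_num⟩))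
  have e1 := abs_le.1 (hS (m + d) (by simpa using hmem 1 ⟨by norm_num, by norm_num⟩))
  have e2 := abs_le.1 (hS (m - d)
    (by simpa [sub_eq_add_neg] using hmem (-1) ⟨by norm_num, by norm_num⟩))
  have hS0 : 0 ≤ S := by linarith [e0.1, e0.2]
  have hmd : |m| ≤ 2 * d := by rw [abs_le]; constructor <;> linarith
  have hc : |2 * c * d ^ 2| ≤ 4 * S := by
    rw [abs_le]
    constructor <;> nlinarith [e0.1, e0.2, e1.1, e1.2, e2.1, e2.2]
  have hb : |(b + 2 * c * m) * d| ≤ S := by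
    rw [abs_le]
    constructor <;> nlinarith [e1.1, e1.2, e2.1, e2.2]
  have hbd : |b| * d ≤ 9 * S := by
    have h2 : |2 * c * m * d| ≤ 8 * S := by
      rw [abs_mul, abs_of_pos hd0, abs_mul, abs_mul]
      rw [abs_mul, abs_mul, abs_of_pos (by positivity : 0 < d ^ 2)] at hc
      calc |2| * |c| * |m| * d ≤ |2| * |c| * (2 * d) * d := by gcongr
        _ = 2 * (|2| * |c| * d ^ 2) := by ring
        _ ≤ 8 * S := by linarith
    have h3 : b * d = (b + 2 * c * m) * d - 2 * c * m * d := by ring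
    have h4 : |b| * d = |b * d| := by rw [abs_mul, abs_of_pos hd0]
    rw [h4, h3]
    exact (abs_sub _ _).trans (by linarith)
  rw [le_div_iff₀ hℓ]
  have : |b| * ℓ ≤ |b| * (4 * d) := mul_le_mul_of_nonneg_left (by linarith) (abs_nonneg _)
  linarith

theorem abs_partial_le_of_mem_biquadratics {q : Plane → ℝ} (hq : q ∈ biquadratics)
    {lo hi : Fin 2 → ℝ} {ℓ S : ℝ} (hℓ : 0 < ℓ) (hlen : ∀ k, ℓ ≤ hi k - lo k)
    (hS : ∀ x : Plane, (∀ k, x k ∈ Ioo (lo k) (hi k)) → |q x| ≤ S) (i : Fin 2) {x : Plane}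
    (hx : ∀ k, x k ∈ Ioo (lo k) (hi k)) :
    |fderiv ℝ q x (EuclideanSpace.single i 1)| ≤ 36 * S / ℓ := by
  obtain ⟨a, b, c, h⟩ := quadratic_on_line_of_mem_biquadratics hq i x
  have hb : fderiv ℝ q x (EuclideanSpace.single i 1) = b := by
    have h2 : HasDerivAt (fun t : ℝ => x + t • (EuclideanSpace.single i 1 : Plane))
        (EuclideanSpace.single i 1) 0 := by
      simpa using ((hasDerivAt_id (0 : ℝ)).smul_const
        (EuclideanSpace.single i 1 : Plane)).const_add x
    have h3 := (differentiable_of_mem_biquadratics hq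
      (x + (0 : ℝ) • EuclideanSpace.single i 1)).hasFDerivAt.comp_hasDerivAt 0 h2
    have h4 : HasDerivAt (fun t : ℝ => a + b * t + c * t ^ 2) b 0 := by
      have h5 := ((((hasDerivAt_id (0 : ℝ)).const_mul b).const_add a).add
        (((hasDerivAt_id (0 : ℝ)).pow 2).const_mul c))
      convert! h5 using 1
      simp
    have h6 : (q ∘ fun t : ℝ => x + t • (EuclideanSpace.single i 1 : Plane)) =
        fun t : ℝ => a + b * t + c * t ^ 2 := funext h
    rw [h6] at h3
    have h7 := h3.unique h4
    rwa [zero_smul, add_zero] at h7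
  rw [hb]
  refine abs_linear_coeff_le (t₀ := lo i - x i) (t₁ := hi i - x i) (a := a) (c := c)
    (by linarith [(hx i).1]) (by linarith [(hx i).2]) hℓ (by linarith [hlen i]) fun t ht => ?_
  rw [← h t]
  refine hS _ fun k => ?_
  by_cases hk : k = i
  · subst hk
    simp only [PiLp.add_apply, PiLp.smul_apply, PiLp.single_apply, if_true, smul_eq_mul,
      mul_one]
    exact ⟨by linarith [ht.1], by linarith [ht.2]⟩
  · simpa [PiLp.single_apply, hk] using hx k

/-- Inverse estimates for biquadratic polynomials on rectangles. -/
theorem inverse_estimate {q : Plane → ℝ} (hq : q ∈ biquadratics)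
    {lo hi : Fin 2 → ℝ} {ℓ S : ℝ} (hℓ : 0 < ℓ) (hlen : ∀ k, ℓ ≤ hi k - lo k)
    (hS : ∀ x : Plane, (∀ k, x k ∈ Ioo (lo k) (hi k)) → |q x| ≤ S) {x : Plane}
    (hx : ∀ k, x k ∈ Ioo (lo k) (hi k)) :
    ‖fderiv ℝ q x‖ ≤ 72 * S / ℓ ∧ hessNorm q x ≤ 2592 * S / ℓ ^ 2 := by
  have hS0 : 0 ≤ S := (abs_nonneg _).trans (hS x hx)
  have h1 : ∀ i, ∀ y : Plane, (∀ k, y k ∈ Ioo (lo k) (hi k)) →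
      |fderiv ℝ q y (EuclideanSpace.single i 1)| ≤ 36 * S / ℓ :=
    fun i y hy => abs_partial_le_of_mem_biquadratics hq hℓ hlen hS i hy
  have h2 : ∀ i j, |hess q x i j| ≤ 36 * (36 * S / ℓ) / ℓ := fun i j => by
    have h3 := abs_partial_le_of_mem_biquadratics (fderiv_mem_biquadratics hq j) hℓ hlen
      (h1 j) i hx
    have h4 : HasFDerivAt (fun x => fderiv ℝ q x (EuclideanSpace.single j 1))
        ((ContinuousLinearMap.apply ℝ ℝ (EuclideanSpace.single j 1 : Plane)).comp
          (fderiv ℝ (fderiv ℝ q) x)) x :=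
      (ContinuousLinearMap.apply ℝ ℝ (EuclideanSpace.single j 1 : Plane)).hasFDerivAt.comp x
        (differentiable_fderiv_of_mem_biquadratics hq x).hasFDerivAt
    rw [h4.fderiv] at h3
    exact h3
  -- The two first derivatives are bounded by $36S/\ell$ and the four second ones by $36^2S/\ell^2$.
  -- The norms are then at most twice these bounds, $72=2\cdot36$ and $2592=2\cdot36^2$.
  constructor
  · refine (sq_le_sq₀ (norm_nonneg _) (by positivity)).1 ?_
    refine (sq_norm_apply_le _).trans ?_
    have h3 := pow_le_pow_left₀ (abs_nonneg _) (h1 0 x hx) 2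
    have h4 := pow_le_pow_left₀ (abs_nonneg _) (h1 1 x hx) 2
    rw [Real.norm_eq_abs, Real.norm_eq_abs]
    have h5 : (72 * S / ℓ) ^ 2 = 4 * (36 * S / ℓ) ^ 2 := by ring
    nlinarith [sq_nonneg (36 * S / ℓ)]
  · refine (sq_le_sq₀ (hessNorm_nonneg _ _) (by positivity)).1 ?_
    refine (hessNorm_sq_le q x).trans ?_
    have h3 : ∀ i j, hess q x i j * hess q x i j ≤ (36 * (36 * S / ℓ) / ℓ) ^ 2 := fun i j => by
      rw [← sq, ← sq_abs]
      exact pow_le_pow_left₀ (abs_nonneg _) (h2 i j) 2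
    have h5 : (2592 * S / ℓ ^ 2) ^ 2 = 4 * (36 * (36 * S / ℓ) / ℓ) ^ 2 := by
      field_simp; ring
    rw [h5]
    simp only [Fin.sum_univ_two]
    linarith [h3 0 0, h3 0 1, h3 1 0, h3 1 1]

instance : FiniteDimensional ℝ biquadratics :=
  FiniteDimensional.span_of_finite ℝ (finite_range _)

theorem finrank_biquadratics_le : Module.finrank ℝ biquadratics ≤ 9 := by
  have := finrank_range_le_card (R := ℝ) (fun e : Fin 3 × Fin 3 =>
    fun x : Plane => x 0 ^ (e.1 : ℕ) * x 1 ^ (e.2 : ℕ))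
  rw [Fintype.card_prod, Fintype.card_fin] at this
  exact this

namespace PUM

/-! ### The generalized finite element space -/

variable {Ω : Set Plane} (P : PUM Ω)

theorem phi_isW2Inf (i : Fin P.n) : IsW2Inf (P.phi i) := P.regular i

theorem phi_nonneg (i : Fin P.n) (x : Plane) : 0 ≤ P.phi i x :=
  mul_nonneg ((P.flatTop i 0).nonneg _) ((P.flatTop i 1).nonneg _)

theorem phi_eq_zero {i : Fin P.n} {x : Plane} (hx : x ∉ P.patch i) : P.phi i x = 0 := by
  simp only [patch, mem_ofPred_eq, not_forall] at hx
  obtain ⟨k, hk⟩ := hx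
  have := (P.flatTop i k).eq_zero _ hk
  unfold phi
  fin_cases k
  · exact mul_eq_zero_of_left this _
  · exact mul_eq_zero_of_right _ this

theorem phi_node_eq_one {i : Fin P.n} {p : Plane} (hp : p ∈ P.nodes i) : P.phi i p = 1 :=
  (P.nodes_subset i p hp).2

theorem node_mem {i : Fin P.n} {p : Plane} (hp : p ∈ P.nodes i) : p ∈ Ω :=
  (P.nodes_subset i p hp).1

theorem node_mem_patch {i : Fin P.n} {p : Plane} (hp : p ∈ P.nodes i) : p ∈ P.patch i := by
  by_contra h
  have := P.phi_node_eq_one hp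
  rw [P.phi_eq_zero h] at this
  exact zero_ne_one this

theorem sum_phi {x : Plane} (hx : x ∈ Ω) : ∑ i, P.phi i x = 1 := P.sum_eq_one x hx

/-- The partition functions are nonnegative with sum 1, so where one equals 1 all the others vanish.
-/
theorem phi_node_eq_zero {i k : Fin P.n} {p : Plane} (hp : p ∈ P.nodes i) (hk : k ≠ i) :
    P.phi k p = 0 := by
  have h1 := P.sum_phi (P.node_mem hp)
  rw [← Finset.add_sum_erase _ _ (Finset.mem_univ i), P.phi_node_eq_one hp] at h1
  have h2 : ∑ j ∈ Finset.univ.erase i, P.phi j p = 0 := by linarith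
  exact (Finset.sum_eq_zero_iff_of_nonneg fun j _ => P.phi_nonneg j p).1 h2 k
    (Finset.mem_erase.2 ⟨hk, Finset.mem_univ k⟩)

/-- A zero of the nonnegative function $\varphi_i$ is a minimum. -/
theorem fderiv_phi_eq_zero {i : Fin P.n} {x : Plane} (hx : P.phi i x = 0) :
    fderiv ℝ (P.phi i) x = 0 := by
  refine IsLocalMin.fderiv_eq_zero (Filter.Eventually.of_forall fun y => ?_)
  rw [hx]
  exact P.phi_nonneg i y

theorem isOpen_patch (i : Fin P.n) : IsOpen (P.patch i) := by
  have : P.patch i = ⋂ k, {x : Plane | x k ∈ Ioo (P.lo i k) (P.hi i k)} := by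
    ext x; simp [patch]
  rw [this]
  refine isOpen_iInter_of_finite fun k => ?_
  exact isOpen_Ioo.preimage (EuclideanSpace.proj k : Plane →L[ℝ] ℝ).continuous

theorem convex_patch (i : Fin P.n) : Convex ℝ (P.patch i) := by
  have : P.patch i = ⋂ k, {x : Plane | x k ∈ Ioo (P.lo i k) (P.hi i k)} := by
    ext x; simp [patch]
  rw [this]
  refine convex_iInter fun k => ?_
  exact (convex_Ioo _ _).linear_preimage (EuclideanSpace.proj k : Plane →L[ℝ] ℝ).toLinearMap

theorem volume_frontier_patch (i : Fin P.n) : volume (frontier (P.patch i)) = 0 :=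
  (P.convex_patch i).addHaar_frontier _

theorem ae_notMem_frontier_patch : ∀ᵐ x : Plane, ∀ i, x ∉ frontier (P.patch i) :=
  ae_all_iff.2 fun i => measure_eq_zero_iff_ae_notMem.1 (P.volume_frontier_patch i)

theorem patch_subset_closedBall (i : Fin P.n) :
    P.patch i ⊆ Metric.closedBall 0 (∑ k, (|P.lo i k| + |P.hi i k|)) := by
  intro x hx
  rw [mem_closedBall_zero_iff]
  have h1 : ‖x‖ ≤ |x 0| + |x 1| := by
    refine (sq_le_sq₀ (norm_nonneg _) (by positivity)).1 ?_
    rw [plane_norm_sq, ← sq_abs (x 0), ← sq_abs (x 1)]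
    nlinarith [abs_nonneg (x 0), abs_nonneg (x 1)]
  have h2 : ∀ k, |x k| ≤ |P.lo i k| + |P.hi i k| := fun k => by
    have h3 := hx k
    rw [abs_le]
    constructor
    · linarith [h3.1, neg_abs_le (P.lo i k), abs_nonneg (P.hi i k)]
    · linarith [h3.2, le_abs_self (P.hi i k), abs_nonneg (P.lo i k)]
  rw [Fin.sum_univ_two]
  linarith [h2 0, h2 1]

theorem isBounded_patch (i : Fin P.n) : Bornology.IsBounded (P.patch i) :=
  Metric.isBounded_closedBall.subset (P.patch_subset_closedBall i)

theorem phi_mul_mem_W2c (i : Fin P.n) {q : Plane → ℝ} (hq : q ∈ biquadratics) :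
    P.phi i * q ∈ W2c := by
  set R := ∑ k, (|P.lo i k| + |P.hi i k|) with hR
  have hR0 : 0 ≤ R := Finset.sum_nonneg fun k _ => by positivity
  -- A polynomial is not in $W^2_\infty(\mathbb R^2)$. A cutoff equal to 1 on the patch repairs this
  -- without changing the product with $\varphi_i$.
  let χ : ContDiffBump (0 : Plane) := ⟨R + 1, R + 2, by positivity, by linarith⟩
  have hχ : IsW2Inf (q * χ) := by
    refine IsW2Inf.of_contDiff ((contDiff_of_mem_biquadratics hq).mul χ.contDiff) ?_
    exact χ.hasCompactSupport.mul_left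
  have h1 : P.phi i * q = P.phi i * (q * χ) := by
    ext x
    by_cases hx : x ∈ P.patch i
    · have : χ x = 1 := χ.one_of_mem_closedBall
        (Metric.closedBall_subset_closedBall (show R ≤ R + 1 by linarith) (P.patch_subset_closedBall i hx))
      simp [this]
    · simp [P.phi_eq_zero hx]
  refine ⟨h1 ▸ (P.phi_isW2Inf i).mul hχ, ?_⟩
  refine HasCompactSupport.intro (isCompact_closedBall (0 : Plane) R) fun x hx => ?_
  have : x ∉ P.patch i := fun h => hx (P.patch_subset_closedBall i h)
  simp [P.phi_eq_zero this]

/-- The function `∑ φ_i q_i` as a member of `W2c`. -/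
noncomputable def assemble (q : Fin P.n → Plane → ℝ) (hq : ∀ i, q i ∈ P.V i) : W2c :=
  ⟨∑ i, P.phi i * q i, sum_mem fun i _ => P.phi_mul_mem_W2c i (P.V_le i (hq i))⟩

theorem assemble_mem_Vh (q : Fin P.n → Plane → ℝ) (hq : ∀ i, q i ∈ P.V i) :
    P.assemble q hq ∈ P.Vh := by
  change ∑ i, P.phi i * q i ∈ ⨆ i, (P.V i).map (LinearMap.mulLeft ℝ (P.phi i))
  refine sum_mem fun i _ => Submodule.mem_iSup_of_mem i ?_
  exact ⟨q i, hq i, rfl⟩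

theorem exists_eq_sum {v : W2c} (hv : v ∈ P.Vh) :
    ∃ q : Fin P.n → Plane → ℝ, (∀ i, q i ∈ P.V i) ∧
      (v : Plane → ℝ) = ∑ i, P.phi i * q i := by
  change (v : Plane → ℝ) ∈ ⨆ i, (P.V i).map (LinearMap.mulLeft ℝ (P.phi i)) at hv
  rw [Submodule.mem_iSup_iff_exists_finsupp] at hv
  obtain ⟨f, hf, hs⟩ := hv
  choose q hq hqf using hf
  refine ⟨q, hq, ?_⟩
  rw [← hs, Finsupp.sum_fintype _ _ fun _ => rfl]
  exact Finset.sum_congr rfl fun i _ => (hqf i).symm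

/-- The point of the flat tops: at a node of a patch only the local polynomial of that patch is
seen, so interpolation in $V_h$ is local. -/
theorem sum_apply_node (q : Fin P.n → Plane → ℝ) {i : Fin P.n} {p : Plane}
    (hp : p ∈ P.nodes i) : (∑ k, P.phi k * q k) p = q i p := by
  rw [Finset.sum_apply, Finset.sum_eq_single i]
  · simp [P.phi_node_eq_one hp]
  · intro k _ hk
    simp [P.phi_node_eq_zero hp hk]
  · simp

theorem eq_zero_of_nodes {i : Fin P.n} {q : Plane → ℝ} (hq : q ∈ P.V i)
    (h : ∀ p ∈ P.nodes i, q p = 0) : q = 0 := by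
  obtain ⟨q₀, -, hu⟩ := P.unisolvent i 0
  rw [hu q ⟨hq, h⟩, hu 0 ⟨zero_mem _, fun _ _ => rfl⟩]

theorem Vh_eq_zero_of_nodes {v : W2c} (hv : v ∈ P.Vh)
    (h : ∀ p ∈ P.nodeSet, (v : Plane → ℝ) p = 0) : v = 0 := by
  obtain ⟨q, hq, hs⟩ := P.exists_eq_sum hv
  have hq0 : ∀ i, q i = 0 := fun i => P.eq_zero_of_nodes (hq i) fun p hp => by
    rw [← P.sum_apply_node q hp, ← hs]
    exact h p (mem_iUnion.2 ⟨i, hp⟩)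
  ext x
  simp [hs, hq0]

/-- Each summand is clamped on its own: inside the patch through $q_i$, outside it through
$\varphi_i$, whose value and gradient vanish. -/
theorem sum_clamped (q : Fin P.n → Plane → ℝ) (hq : ∀ i, q i ∈ P.V i) {z : Plane}
    (hz : z ∈ frontier Ω) :
    (∑ k, P.phi k * q k) z = 0 ∧ fderiv ℝ (∑ k, P.phi k * q k) z = 0 := by
  have hd : ∀ i, Differentiable ℝ (q i) := fun i =>
    differentiable_of_mem_biquadratics (P.V_le i (hq i))
  have hd' : ∀ i, Differentiable ℝ (P.phi i) := fun i => (P.phi_isW2Inf i).differentiable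
  have key : ∀ i, (P.phi i * q i) z = 0 ∧ fderiv ℝ (P.phi i * q i) z = 0 := by
    intro i
    rw [fderiv_mul_eq (hd' i) (hd i)]
    by_cases h : z ∈ P.patch i
    · obtain ⟨h1, h2⟩ := P.V_clamped i (q i) (hq i) z hz h
      simp [h1, h2]
    · have h1 := P.phi_eq_zero h
      simp [h1, P.fderiv_phi_eq_zero h1]
  constructor
  · rw [Finset.sum_apply]
    exact Finset.sum_eq_zero fun i _ => (key i).1
  · rw [fderiv_sum fun i _ => (hd' i).mul (hd i) z]
    exact Finset.sum_eq_zero fun i _ => (key i).2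

theorem Vh_clamped {v : W2c} (hv : v ∈ P.Vh) : ∀ z ∈ frontier Ω,
    (v : Plane → ℝ) z = 0 ∧ fderiv ℝ (v : Plane → ℝ) z = 0 := by
  intro z hz
  obtain ⟨q, hq, hs⟩ := P.exists_eq_sum hv
  rw [hs]
  exact P.sum_clamped q hq hz

/-! ### Nodal interpolation -/

/-- The local nodal interpolant of `g` in `V i`. -/
noncomputable def interp (i : Fin P.n) (g : Plane → ℝ) : Plane → ℝ := (P.unisolvent i g).choose

theorem interp_mem (i : Fin P.n) (g : Plane → ℝ) : P.interp i g ∈ P.V i :=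
  (P.unisolvent i g).choose_spec.1.1

theorem interp_node {i : Fin P.n} (g : Plane → ℝ) {p : Plane} (hp : p ∈ P.nodes i) :
    P.interp i g p = g p :=
  (P.unisolvent i g).choose_spec.1.2 p hp

theorem eq_interp {i : Fin P.n} {g q : Plane → ℝ} (hq : q ∈ P.V i)
    (h : ∀ p ∈ P.nodes i, q p = g p) : q = P.interp i g :=
  (P.unisolvent i g).choose_spec.2 q ⟨hq, h⟩

/-- Evaluation at the nodes maps $V_i$ onto all nodal data, and the biquadratics have dimension at
most 9. -/
theorem card_nodes_le (i : Fin P.n) : (P.nodes i).card ≤ 9 := by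
  classical
  have : FiniteDimensional ℝ (P.V i) := Submodule.finiteDimensional_of_le (P.V_le i)
  let ev : P.V i →ₗ[ℝ] (P.nodes i → ℝ) :=
    { toFun := fun q p => (q : Plane → ℝ) p
      map_add' := fun _ _ => rfl
      map_smul' := fun _ _ => rfl }
  have hsurj : Function.Surjective ev := fun g => by
    refine ⟨⟨P.interp i fun p => if h : p ∈ P.nodes i then g ⟨p, h⟩ else 0, P.interp_mem i _⟩, ?_⟩
    ext p
    change P.interp i _ (p : Plane) = g p
    rw [P.interp_node _ p.2]
    simp
  have h1 := LinearMap.finrank_le_finrank_of_surjective hsurj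
  rw [Module.finrank_fintype_fun_eq_card, Fintype.card_coe] at h1
  exact h1.trans ((Submodule.finrank_mono (P.V_le i)).trans finrank_biquadratics_le)

/-- Expansion in the nodal basis, which has at most 9 members, each bounded by $\sigma$ on the
patch. -/
theorem abs_interp_le {h ρ Cφ σ : ℝ} {M : ℕ} (hP : P.IsRegular h ρ Cφ σ M) (i : Fin P.n)
    {g : Plane → ℝ} {B : ℝ} (hB0 : 0 ≤ B) (hB : ∀ p ∈ P.nodes i, |g p| ≤ B) {x : Plane}
    (hx : x ∈ P.patch i) : |P.interp i g x| ≤ 9 * |σ| * B := by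
  classical
  set b : Plane → Plane → ℝ := fun p => P.interp i (fun y => if y = p then 1 else 0) with hb
  have hsum : ∑ p ∈ P.nodes i, g p • b p = P.interp i g := by
    refine P.eq_interp (sum_mem fun p _ => Submodule.smul_mem _ _ (P.interp_mem i _))
      fun p' hp' => ?_
    rw [Finset.sum_apply, Finset.sum_eq_single p']
    · simp [hb, P.interp_node _ hp']
    · intro p _ hne
      simp [hb, P.interp_node _ hp', hne.symm]
    · exact fun hn => absurd hp' hn
  rw [← hsum, Finset.sum_apply]
  calc |∑ p ∈ P.nodes i, (g p • b p) x| ≤ ∑ p ∈ P.nodes i, |(g p • b p) x| :=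
        Finset.abs_sum_le_sum_abs _ _
    _ ≤ ∑ p ∈ P.nodes i, B * |σ| := by
        refine Finset.sum_le_sum fun p hp => ?_
        rw [Pi.smul_apply, smul_eq_mul, abs_mul]
        refine mul_le_mul (hB p hp) ?_ (abs_nonneg _) hB0
        refine le_trans ?_ (le_abs_self σ)
        refine hP.nodal_basis_bound i p hp (b p) (P.interp_mem i _) ?_ ?_ x hx
        · simp [hb, P.interp_node _ hp]
        · intro p' hp' hne
          simp [hb, P.interp_node _ hp', hne]
    _ = (P.nodes i).card * (B * |σ|) := by rw [Finset.sum_const, nsmul_eq_mul]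
    _ ≤ 9 * (B * |σ|) := by
        refine mul_le_mul_of_nonneg_right ?_ (by positivity)
        exact_mod_cast P.card_nodes_le i
    _ = 9 * |σ| * B := by ring

theorem VhOn_le (S : Set Plane) : P.VhOn S ≤ P.Vh := fun _ hv => hv.1

instance finiteDimensional_Vh : FiniteDimensional ℝ P.Vh := by
  let ev : P.Vh →ₗ[ℝ] (((i : Fin P.n) × P.nodes i) → ℝ) :=
    { toFun := fun v s => ((v : W2c) : Plane → ℝ) s.2
      map_add' := fun _ _ => rfl
      map_smul' := fun _ _ => rfl }
  refine FiniteDimensional.of_injective ev fun v w hvw => ?_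
  refine Subtype.ext (sub_eq_zero.1 (P.Vh_eq_zero_of_nodes (sub_mem v.2 w.2) fun p hp => ?_))
  obtain ⟨i, hi⟩ := mem_iUnion.1 hp
  exact sub_eq_zero.2 (congrFun hvw ⟨i, ⟨p, hi⟩⟩)

/-- Off the patch boundaries, a null set, a point outside a patch has a neighbourhood outside it.
Second derivatives at `x` then see only the at most $M$ patches containing `x`. -/
theorem eventuallyEq_sum_filter {x : Plane}
    (hx : ∀ i, x ∉ frontier (P.patch i)) (s : Finset (Fin P.n))
    (hs : ∀ i, i ∈ s ↔ x ∈ P.patch i) (q : Fin P.n → Plane → ℝ) :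
    (∑ i, P.phi i * q i) =ᶠ[nhds x] ∑ i ∈ s, P.phi i * q i := by
  have h1 : ∀ᶠ y in nhds x, ∀ i, i ∉ s → P.phi i y = 0 := by
    rw [Filter.eventually_all]
    intro i
    by_cases hi : i ∈ s
    · exact Filter.Eventually.of_forall fun y h => absurd hi h
    · have hxc : x ∉ closure (P.patch i) := fun hc => by
        have := hx i
        rw [(P.isOpen_patch i).frontier_eq] at this
        exact this ⟨hc, fun h => hi ((hs i).2 h)⟩
      filter_upwards [isClosed_closure.isOpen_compl.mem_nhds hxc] with y hy _
      exact P.phi_eq_zero fun h => hy (subset_closure h)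
  filter_upwards [h1] with y hy
  rw [Finset.sum_apply, Finset.sum_apply]
  symm
  refine Finset.sum_subset (Finset.subset_univ s) fun i _ hi => ?_
  simp [hy i hi]

end PUM

/-! ### Stability of the interpolation -/

/-- Tonelli and the symmetry of $|x-y|\le R$: each `y` is counted once for every centre in a ball of
radius `R`. -/
theorem integral_le_of_le_integral_closedBall {U : Set Plane} {F g : Plane → ℝ}
    (hF : Measurable F) (hF0 : ∀ x, 0 ≤ F x)
    (hg : Measurable g) (hg0 : ∀ x, 0 ≤ g x) (hgi : Integrable g) {c R : ℝ} (hc : 0 ≤ c)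
    (h : ∀ᵐ x ∂(volume.restrict U), F x ≤ c * ∫ y in Metric.closedBall x R, g y) :
    ∫ x in U, F x ≤ c * volume.real (Metric.closedBall (0 : Plane) R) * ∫ x, g x := by
  have hbd : ∀ x : Plane, volume (Metric.closedBall x R) =
      ENNReal.ofReal (volume.real (Metric.closedBall (0 : Plane) R)) := fun x => by
    rw [ofReal_measureReal measure_closedBall_lt_top.ne]
    exact Measure.addHaar_closedBall_center _ _ _
  have hgm : Measurable fun y => ENNReal.ofReal (g y) := hg.ennreal_ofReal
  have h1 : ∫⁻ x in U, ENNReal.ofReal (F x) ≤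
      ENNReal.ofReal (c * volume.real (Metric.closedBall (0 : Plane) R) * ∫ x, g x) := by
    calc ∫⁻ x in U, ENNReal.ofReal (F x)
        ≤ ∫⁻ x in U, ENNReal.ofReal c * ∫⁻ y in Metric.closedBall x R, ENNReal.ofReal (g y) := by
          refine lintegral_mono_ae ?_
          filter_upwards [h] with x hx
          refine (ENNReal.ofReal_le_ofReal hx).trans ?_
          rw [ENNReal.ofReal_mul hc, ofReal_integral_eq_lintegral_ofReal hgi.integrableOn
            (Filter.Eventually.of_forall hg0)]
      _ ≤ ∫⁻ x, ENNReal.ofReal c * ∫⁻ y in Metric.closedBall x R, ENNReal.ofReal (g y) :=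
          setLIntegral_le_lintegral _ _
      _ = ENNReal.ofReal c * ∫⁻ x : Plane, ∫⁻ y : Plane,
            {p : Plane × Plane | dist p.2 p.1 ≤ R}.indicator
              (fun p => ENNReal.ofReal (g p.2)) (x, y) := by
          rw [lintegral_const_mul' _ _ ENNReal.ofReal_ne_top]
          congr 1
          refine lintegral_congr fun x => ?_
          rw [← lintegral_indicator Metric.isClosed_closedBall.measurableSet]
          rfl
      _ = ENNReal.ofReal c * ∫⁻ y : Plane, ∫⁻ x : Plane,
            {p : Plane × Plane | dist p.2 p.1 ≤ R}.indicator
              (fun p => ENNReal.ofReal (g p.2)) (x, y) := by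
          congr 1
          refine lintegral_lintegral_swap (f := fun x y : Plane =>
            {p : Plane × Plane | dist p.2 p.1 ≤ R}.indicator
              (fun p => ENNReal.ofReal (g p.2)) (x, y)) (Measurable.aemeasurable ?_)
          refine (hgm.comp measurable_snd).indicator ?_
          exact measurableSet_le (measurable_snd.dist measurable_fst) measurable_const
      _ = ENNReal.ofReal c * ∫⁻ y : Plane, ENNReal.ofReal (g y) *
            ENNReal.ofReal (volume.real (Metric.closedBall (0 : Plane) R)) := by
          congr 1
          refine lintegral_congr fun y => ?_
          rw [← hbd y, ← lintegral_indicator_const Metric.isClosed_closedBall.measurableSet]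
          refine lintegral_congr fun x => ?_
          simp only [indicator, mem_ofPred_eq, Metric.mem_closedBall, dist_comm y x]
      _ = ENNReal.ofReal (c * volume.real (Metric.closedBall (0 : Plane) R) * ∫ x, g x) := by
          rw [lintegral_mul_const _ hgm, ← ofReal_integral_eq_lintegral_ofReal hgi
            (Filter.Eventually.of_forall hg0),
            ← ENNReal.ofReal_mul (integral_nonneg hg0), ← ENNReal.ofReal_mul hc]
          congr 1; ring
  have h2 : 0 ≤ c * volume.real (Metric.closedBall (0 : Plane) R) * ∫ x, g x :=
    mul_nonneg (mul_nonneg hc measureReal_nonneg) (integral_nonneg hg0)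
  rw [integral_eq_lintegral_of_nonneg_ae (Filter.Eventually.of_forall hF0)
    hF.aestronglyMeasurable]
  exact ENNReal.toReal_le_of_le_ofReal h2 h1

theorem hessNorm_affine_add {f : Plane → ℝ} (hf : Differentiable ℝ f) (c : ℝ) (A : Plane →L[ℝ] ℝ)
    (x : Plane) : hessNorm (fun y => (c + A y) + f y) x = hessNorm f x := by
  unfold hessNorm
  have h1 : fderiv ℝ (fun y => (c + A y) + f y) = fun y => A + fderiv ℝ f y := by
    ext1 y
    exact ((A.hasFDerivAt.const_add c).add (hf y).hasFDerivAt).fderiv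
  rw [h1, fderiv_const_add]

/-! ### Estimates of the interpolant on the patches around a point. -/

namespace PUM

variable {Ω : Set Plane} (P : PUM Ω) {h ρ Cφ σ : ℝ} {M : ℕ}

theorem IsRegular.rho_pos (hP : P.IsRegular h ρ Cφ σ M) (hh : 0 < h) (i : Fin P.n) : 0 < ρ := by
  have h1 := hP.le_flat i 0
  have h2 := (P.flatTop i 0).lt_mid
  by_contra hρ
  have h3 : ρ * (P.fhi i 0 - P.flo i 0) ≤ 0 :=
    mul_nonpos_of_nonpos_of_nonneg (not_lt.1 hρ) (by linarith)
  linarith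

theorem IsRegular.le_side (hP : P.IsRegular h ρ Cφ σ M) (hh : 0 < h) (i : Fin P.n) (k : Fin 2) :
    h / ρ ≤ P.hi i k - P.lo i k := by
  have hρ := hP.rho_pos P hh i
  have h1 := hP.le_flat i k
  have h2 := (P.flatTop i k).lt_left
  have h3 := (P.flatTop i k).lt_right
  rw [div_le_iff₀ hρ]
  nlinarith

theorem IsRegular.le_diam (hP : P.IsRegular h ρ Cφ σ M) (hh : 0 < h) (i : Fin P.n) :
    h / ρ ≤ Metric.diam (P.patch i) := by
  have hρ := hP.rho_pos P hh i
  have h1 := hP.le_flat i 0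
  have hlt := fun k => (P.flatTop i k).lt_left
  have hmid := fun k => (P.flatTop i k).lt_mid
  have hrt := fun k => (P.flatTop i k).lt_right
  have hp : (WithLp.toLp 2 (P.flo i) : Plane) ∈ P.patch i := fun k =>
    ⟨hlt k, (hmid k).trans (hrt k)⟩
  have hq : (WithLp.toLp 2 (P.fhi i) : Plane) ∈ P.patch i := fun k =>
    ⟨(hlt k).trans (hmid k), hrt k⟩
  refine le_trans ?_ (Metric.dist_le_diam_of_mem (P.isBounded_patch i) hq hp)
  rw [dist_eq_norm]
  refine le_trans ?_ (PiLp.norm_apply_le _ 0)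
  rw [Real.norm_eq_abs]
  refine le_trans ?_ (le_abs_self _)
  rw [div_le_iff₀ hρ]
  simp only [PiLp.sub_apply]
  linarith

theorem IsRegular.ae_phi_bound (hP : P.IsRegular h ρ Cφ σ M) (hh : 0 < h) :
    ∀ᵐ x : Plane, ∀ i, |P.phi i x| ≤ |Cφ| ∧ ‖fderiv ℝ (P.phi i) x‖ ≤ |Cφ| * (ρ / h) ∧
      hessNorm (P.phi i) x ≤ |Cφ| * (ρ / h) ^ 2 := by
  refine ae_all_iff.2 fun i => ?_
  have h1 := (hP.phi_bound i).ae
  rw [Measure.restrict_univ] at h1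
  have hρ := hP.rho_pos P hh i
  have hd := hP.le_diam P hh i
  have hdiv : ∀ m : ℕ, Cφ / Metric.diam (P.patch i) ^ m ≤ |Cφ| * (ρ / h) ^ m := fun m => by
    have hpos : 0 < h / ρ := by positivity
    have h2 : (h / ρ) ^ m ≤ Metric.diam (P.patch i) ^ m := pow_le_pow_left₀ hpos.le hd m
    have h3 : (ρ / h) ^ m = ((h / ρ) ^ m)⁻¹ := by rw [← inv_pow, inv_div]
    rw [div_eq_mul_inv, h3]
    exact mul_le_mul (le_abs_self _) (inv_anti₀ (by positivity) h2)
      (inv_nonneg.2 (by positivity)) (abs_nonneg _)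
  filter_upwards [h1] with x hx
  refine ⟨hx.1.trans ?_, hx.2.1.trans ?_, hx.2.2.trans (hdiv 2)⟩
  · simpa using hdiv 0
  · simpa using hdiv 1

theorem IsRegular.norm_sub_le (hP : P.IsRegular h ρ Cφ σ M) {i : Fin P.n} {x y : Plane}
    (hx : x ∈ P.patch i) (hy : y ∈ P.patch i) : ‖x - y‖ ≤ ρ * h := by
  rw [← dist_eq_norm]
  exact (Metric.dist_le_diam_of_mem (P.isBounded_patch i) hx hy).trans (hP.diam_le i)

/-- Leibniz rule and inverse estimates, all three terms scaling like $(\rho/h)^2$;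
$2737=2592+2\cdot72+1$. -/
theorem IsRegular.hessNorm_phi_mul_le (hP : P.IsRegular h ρ Cφ σ M) (hh : 0 < h) {i : Fin P.n}
    {x : Plane} (hx : x ∈ P.patch i) (hd : DifferentiableAt ℝ (fderiv ℝ (P.phi i)) x)
    (hb : |P.phi i x| ≤ |Cφ| ∧ ‖fderiv ℝ (P.phi i) x‖ ≤ |Cφ| * (ρ / h) ∧
      hessNorm (P.phi i) x ≤ |Cφ| * (ρ / h) ^ 2)
    {g : Plane → ℝ} (hg : g ∈ biquadratics) {S : ℝ} (hS : ∀ y ∈ P.patch i, |g y| ≤ S) :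
    hessNorm (P.phi i * g) x ≤ 2737 * |Cφ| * (ρ / h) ^ 2 * S := by
  have hρ := hP.rho_pos P hh i
  have hS0 : 0 ≤ S := (abs_nonneg _).trans (hS x hx)
  obtain ⟨h1, h2⟩ := inverse_estimate hg (by positivity : 0 < h / ρ) (hP.le_side P hh i) hS hx
  have e1 : 72 * S / (h / ρ) = 72 * S * (ρ / h) := by field_simp
  have e2 : 2592 * S / (h / ρ) ^ 2 = 2592 * S * (ρ / h) ^ 2 := by field_simp
  rw [e1] at h1
  rw [e2] at h2
  refine (hessNorm_mul_le (P.phi_isW2Inf i).differentiable (differentiable_of_mem_biquadratics hg)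
    hd (differentiable_fderiv_of_mem_biquadratics hg x)).trans ?_
  calc |P.phi i x| * hessNorm g x + 2 * ‖fderiv ℝ (P.phi i) x‖ * ‖fderiv ℝ g x‖ +
        |g x| * hessNorm (P.phi i) x
      ≤ |Cφ| * (2592 * S * (ρ / h) ^ 2) + 2 * (|Cφ| * (ρ / h)) * (72 * S * (ρ / h)) +
        S * (|Cφ| * (ρ / h) ^ 2) := by
        refine add_le_add_three
          (mul_le_mul hb.1 h2 (hessNorm_nonneg _ _) (abs_nonneg _))
          (mul_le_mul (mul_le_mul_of_nonneg_left hb.2.1 zero_le_two) h1 (norm_nonneg _)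
            (by positivity))
          (mul_le_mul (hS x hx) hb.2.2 (hessNorm_nonneg _ _) hS0)
    _ = _ := by ring

/-- The interpolation error near a point `x`: up to an affine function the interpolant is a
combination of small local functions. -/
theorem IsRegular.exists_local_decomposition (hP : P.IsRegular h ρ Cφ σ M) (hΩ : IsOpen Ω)
    (hh : 0 < h) (hρ : 0 < ρ) {ℓ κ : ℝ} (hℓ : 0 < ℓ) (hκ1 : 1 ≤ κ) (hκ : 2 * (ρ * h) ≤ κ * ℓ)
    (hseg : ∀ z ∈ frontier Ω, ∃ e : Plane, ‖e‖ = 1 ∧ ∀ t ∈ Icc 0 ℓ, z + t • e ∈ frontier Ω)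
    {w : Plane → ℝ} (hw : IsW2Inf w) (hw0 : ∀ z ∈ frontier Ω, w z = 0 ∧ fderiv ℝ w z = 0)
    {x : Plane} (hx : x ∈ Ω) (hxf : ∀ i, x ∉ frontier (P.patch i)) (s : Finset (Fin P.n))
    (hs : ∀ i, i ∈ s ↔ x ∈ P.patch i) :
    ∃ (c : ℝ) (A : Plane →L[ℝ] ℝ) (g : Fin P.n → Plane → ℝ),
      (∑ i, P.phi i * P.interp i w) =ᶠ[nhds x] (fun y => (c + A y) + (∑ i ∈ s, P.phi i * g i) y) ∧
      ∀ i ∈ s, g i ∈ biquadratics ∧ ∀ y ∈ P.patch i, |g i y| ≤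
        9 * |σ| * ((4 + 2 * √(2 * κ)) * (5 + 2 * κ) * (2 * (ρ * h)) *
          √(∫ y in Metric.closedBall x (5 * (ρ * h)), hessNorm w y ^ 2)) := by
  have hr : 0 < ρ * h := by positivity
  obtain ⟨K, hK0, hK⟩ := hw.exists_hessNorm_le
  have hmono : ∀ z : Plane, ∀ R, Metric.closedBall z R ⊆ Metric.closedBall x (5 * (ρ * h)) →
      √(∫ y in Metric.closedBall z R, hessNorm w y ^ 2) ≤
        √(∫ y in Metric.closedBall x (5 * (ρ * h)), hessNorm w y ^ 2) := by
    intro z R hsub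
    refine Real.sqrt_le_sqrt (setIntegral_mono_set ?_
      (Filter.Eventually.of_forall fun y => sq_nonneg _) (Filter.Eventually.of_forall hsub))
    have : IsFiniteMeasure (volume.restrict (Metric.closedBall x (5 * (ρ * h)))) :=
      ⟨by rw [Measure.restrict_apply_univ]; exact measure_closedBall_lt_top⟩
    refine Integrable.of_bound ((hessNorm_measurable w).pow_const 2).aestronglyMeasurable (K ^ 2)
      (Filter.Eventually.of_forall fun y => ?_)
    rw [Real.norm_of_nonneg (sq_nonneg _)]
    exact pow_le_pow_left₀ (hessNorm_nonneg _ _) (hK _) 2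
  set E := √(∫ y in Metric.closedBall x (5 * (ρ * h)), hessNorm w y ^ 2) with hE
  have hE0 : 0 ≤ E := Real.sqrt_nonneg _
  -- If a patch around `x` meets the boundary, affine functions may be missing from the local spaces
  -- and none is subtracted: $w$ is small by its boundary values. Otherwise every local space around
  -- `x` consists of all biquadratics, and an affine approximation is split off.
  by_cases hbd : ∃ i ∈ s, ∃ z ∈ frontier Ω, z ∈ P.patch i
  · obtain ⟨i₀, hi₀, z, hz, hzi⟩ := hbd
    refine ⟨0, 0, fun i => P.interp i w, ?_, fun i hi => ⟨P.V_le i (P.interp_mem i w),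
      fun y hy => P.abs_interp_le hP i (by positivity) (fun p hp => ?_) hy⟩⟩
    · refine (P.eventuallyEq_sum_filter hxf s hs _).trans (Filter.Eventually.of_forall fun y => ?_)
      simp
    · obtain ⟨e, he, hfr⟩ := hseg z hz
      have hxz : ‖x - z‖ ≤ ρ * h := hP.norm_sub_le P ((hs i₀).1 hi₀) hzi
      have hpx : ‖p - x‖ ≤ ρ * h := hP.norm_sub_le P (P.node_mem_patch hp) ((hs i).1 hi)
      have hpz : ‖p - z‖ ≤ 2 * (ρ * h) := by
        have := norm_sub_le_norm_sub_add_norm_sub p x z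
        linarith
      -- With $r=2\rho h$ the segment is cut at length $\min(r,\ell)$. The ball of radius $2r$ about
      -- $z$ lies in that of radius $5\rho h$ about $x$, because $|x-z|\le\rho h$.
      have hτκ : 2 * (ρ * h) ≤ κ * min (2 * (ρ * h)) ℓ := by
        rcases le_total (2 * (ρ * h)) ℓ with hle | hle
        · rw [min_eq_left hle]; nlinarith
        · rwa [min_eq_right hle]
      have h1 := abs_le_of_zero_on_segment hw z he (r := 2 * (ρ * h))
        (τ := min (2 * (ρ * h)) ℓ) (lt_min (by positivity) hℓ) (min_le_left _ _) hτκ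
        (fun t ht => hw0 _ (hfr t ⟨ht.1, ht.2.trans (min_le_right _ _)⟩)) hpz
      refine h1.trans (mul_le_mul_of_nonneg_left (hmono z _ ?_) (by positivity))
      refine Metric.closedBall_subset_closedBall' ?_
      rw [dist_comm, dist_eq_norm]
      linarith
  · push Not at hbd
    obtain ⟨c, A, hA⟩ := exists_affine_approx hw x (r := 2 * (ρ * h)) (by positivity)
    have hV : ∀ i ∈ s, P.V i = biquadratics := fun i hi => P.V_interior i fun z hz => hbd i hi z hz
    have hT := affine_mem_biquadratics c A
    have hg : ∀ i ∈ s, P.interp i w - (fun y => c + A y) = P.interp i (w - fun y => c + A y) := by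
      intro i hi
      refine P.eq_interp (sub_mem (P.interp_mem i w) (hV i hi ▸ hT)) fun p hp => ?_
      rw [Pi.sub_apply, Pi.sub_apply, P.interp_node w hp]
    refine ⟨c, A, fun i => P.interp i w - fun y => c + A y, ?_, fun i hi => ⟨sub_mem
      (P.V_le i (P.interp_mem i w)) hT, fun y hy => ?_⟩⟩
    · have h1 := P.eventuallyEq_sum_filter hxf s hs fun i => P.interp i w
      -- Localizing the constant 1 shows that the active $\varphi_i$ alone sum to 1 near `x`, so the
      -- affine function is reproduced there.
      have h2 := P.eventuallyEq_sum_filter hxf s hs fun _ => 1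
      filter_upwards [h1, h2, hΩ.mem_nhds hx] with y hy1 hy2 hyΩ
      rw [hy1]
      have h3 : ∑ i ∈ s, P.phi i y = 1 := by
        rw [← P.sum_phi hyΩ]
        simpa using hy2.symm
      simp only [Finset.sum_apply, Pi.mul_apply, Pi.sub_apply, mul_sub, Finset.sum_sub_distrib,
        ← Finset.sum_mul, h3]
      ring
    · change |(P.interp i w - fun y => c + A y) y| ≤ _
      rw [hg i hi]
      refine P.abs_interp_le hP i (by positivity) (fun p hp => ?_) hy
      have hpx : ‖p - x‖ ≤ 2 * (ρ * h) := by
        have := hP.norm_sub_le P (P.node_mem_patch hp) ((hs i).1 hi)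
        linarith
      refine (hA p hpx).trans ?_
      have h4 := hmono x (2 * (2 * (ρ * h))) (Metric.closedBall_subset_closedBall (by linarith))
      have h5 : (6 : ℝ) ≤ (4 + 2 * √(2 * κ)) * (5 + 2 * κ) := by
        nlinarith [Real.sqrt_nonneg (2 * κ)]
      calc 6 * (2 * (ρ * h)) * √(∫ y in Metric.closedBall x (2 * (2 * (ρ * h))), hessNorm w y ^ 2)
          ≤ 6 * (2 * (ρ * h)) * E := mul_le_mul_of_nonneg_left h4 (by positivity)
        _ ≤ _ := by gcongr

/-- The affine part has no second derivative. Each of the at most $M$ remaining terms has values of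
order $h$ times the local seminorm, which the inverse estimate multiplies by $h^{-2}$. -/
theorem IsRegular.ae_hessNorm_interp_le (hP : P.IsRegular h ρ Cφ σ M) (hΩ : IsOpen Ω)
    (hh : 0 < h) (hρ : 0 < ρ) {ℓ κ : ℝ} (hℓ : 0 < ℓ) (hκ1 : 1 ≤ κ) (hκ : 2 * (ρ * h) ≤ κ * ℓ)
    (hseg : ∀ z ∈ frontier Ω, ∃ e : Plane, ‖e‖ = 1 ∧ ∀ t ∈ Icc 0 ℓ, z + t • e ∈ frontier Ω)
    {w : Plane → ℝ} (hw : IsW2Inf w) (hw0 : ∀ z ∈ frontier Ω, w z = 0 ∧ fderiv ℝ w z = 0) :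
    ∀ᵐ x ∂(volume.restrict Ω), hessNorm (∑ i, P.phi i * P.interp i w) x ≤
      M * (2737 * |Cφ| * (ρ / h) ^ 2 * (9 * |σ| * ((4 + 2 * √(2 * κ)) * (5 + 2 * κ) *
        (2 * (ρ * h)) * √(∫ y in Metric.closedBall x (5 * (ρ * h)), hessNorm w y ^ 2)))) := by
  classical
  have hd : ∀ᵐ x : Plane, ∀ i, DifferentiableAt ℝ (fderiv ℝ (P.phi i)) x :=
    ae_all_iff.2 fun i => (P.phi_isW2Inf i).ae_differentiableAt_fderiv
  filter_upwards [ae_restrict_of_ae P.ae_notMem_frontier_patch, ae_restrict_of_ae hd,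
    ae_restrict_of_ae (hP.ae_phi_bound P hh), ae_restrict_mem hΩ.measurableSet]
    with x hxf hxd hxb hx
  set s : Finset (Fin P.n) := Finset.univ.filter fun i => x ∈ P.patch i with hsd
  have hs : ∀ i, i ∈ s ↔ x ∈ P.patch i := fun i => by simp [hsd]
  obtain ⟨c, A, g, heq, hg⟩ := hP.exists_local_decomposition P hΩ hh hρ hℓ hκ1 hκ hseg hw hw0 hx
    hxf s hs
  set B := 9 * |σ| * ((4 + 2 * √(2 * κ)) * (5 + 2 * κ) * (2 * (ρ * h)) *
          √(∫ y in Metric.closedBall x (5 * (ρ * h)), hessNorm w y ^ 2)) with hB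
  have hdiff : ∀ i ∈ s, Differentiable ℝ (P.phi i * g i) := fun i hi =>
    (P.phi_isW2Inf i).differentiable.mul (differentiable_of_mem_biquadratics (hg i hi).1)
  rw [hessNorm_congr heq, hessNorm_affine_add]
  swap
  · exact Differentiable.sum hdiff
  refine (hessNorm_sum_le s hdiff fun i hi => ?_).trans ?_
  · rw [fderiv_mul_eq (P.phi_isW2Inf i).differentiable
      (differentiable_of_mem_biquadratics (hg i hi).1)]
    exact (((P.phi_isW2Inf i).differentiable x).smul
      (differentiable_fderiv_of_mem_biquadratics (hg i hi).1 x)).add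
      ((differentiable_of_mem_biquadratics (hg i hi).1 x).smul (hxd i))
  have hcard : s.card ≤ M := by
    refine le_trans (le_of_eq ?_) (hP.overlap x)
    rw [← Set.ncard_coe_finset]
    congr 1
    ext i
    simp [hsd]
  calc ∑ i ∈ s, hessNorm (P.phi i * g i) x
      ≤ ∑ i ∈ s, 2737 * |Cφ| * (ρ / h) ^ 2 * B := Finset.sum_le_sum fun i hi =>
        hP.hessNorm_phi_mul_le P hh ((hs i).1 hi) (hxd i) (hxb i) (hg i hi).1 (hg i hi).2
    _ = s.card * (2737 * |Cφ| * (ρ / h) ^ 2 * B) := by rw [Finset.sum_const, nsmul_eq_mul]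
    _ ≤ M * (2737 * |Cφ| * (ρ / h) ^ 2 * B) := by
        refine mul_le_mul_of_nonneg_right (by exact_mod_cast hcard) (by positivity)

end PUM

/-- The constant in the stability estimate of the interpolation. -/
noncomputable def interpConst (ρ Cφ σ κ : ℝ) (M : ℕ) : ℝ :=
  (M * (2737 * |Cφ| * ρ ^ 2 * (9 * |σ| * ((4 + 2 * √(2 * κ)) * (5 + 2 * κ) * (2 * ρ))))) ^ 2 *
    (25 * ρ ^ 2 * volume.real (Metric.closedBall (0 : Plane) 1))

/-- Stability of the interpolation operator in the `H²` seminorm. -/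
theorem PUM.IsRegular.integral_hessNorm_interp_le {Ω : Set Plane} (P : PUM Ω) {h ρ Cφ σ : ℝ} {M : ℕ}
    (hP : P.IsRegular h ρ Cφ σ M) (hΩ : IsOpen Ω)
    (hh : 0 < h) (hρ : 0 < ρ) {ℓ κ : ℝ} (hℓ : 0 < ℓ) (hκ1 : 1 ≤ κ) (hκ : 2 * (ρ * h) ≤ κ * ℓ)
    (hseg : ∀ z ∈ frontier Ω, ∃ e : Plane, ‖e‖ = 1 ∧ ∀ t ∈ Icc 0 ℓ, z + t • e ∈ frontier Ω)
    {w : Plane → ℝ} (hw : IsW2Inf w) (hw0 : ∀ z ∈ frontier Ω, w z = 0 ∧ fderiv ℝ w z = 0)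
    (hwi : Integrable fun x => hessNorm w x ^ 2) :
    ∫ x in Ω, hessNorm (∑ i, P.phi i * P.interp i w) x ^ 2 ≤
      interpConst ρ Cφ σ κ M * ∫ x, hessNorm w x ^ 2 := by
  set c₀ := M * (2737 * |Cφ| * ρ ^ 2 * (9 * |σ| * ((4 + 2 * √(2 * κ)) * (5 + 2 * κ) * (2 * ρ))))
    with hc₀
  have h1 : ∀ᵐ x ∂(volume.restrict Ω), hessNorm (∑ i, P.phi i * P.interp i w) x ^ 2 ≤
      (c₀ / h) ^ 2 * ∫ y in Metric.closedBall x (5 * (ρ * h)), hessNorm w y ^ 2 := by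
    filter_upwards [hP.ae_hessNorm_interp_le P hΩ hh hρ hℓ hκ1 hκ hseg hw hw0] with x hx
    have h2 := pow_le_pow_left₀ (hessNorm_nonneg _ _) hx 2
    refine h2.trans (le_of_eq ?_)
    set E := ∫ y in Metric.closedBall x (5 * (ρ * h)), hessNorm w y ^ 2 with hE
    have hE0 : 0 ≤ E := integral_nonneg fun y => sq_nonneg _
    have h3 : M * (2737 * |Cφ| * (ρ / h) ^ 2 * (9 * |σ| * ((4 + 2 * √(2 * κ)) * (5 + 2 * κ) *
        (2 * (ρ * h)) * √E))) = c₀ / h * √E := by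
      rw [hc₀]
      field_simp
    rw [h3, mul_pow, Real.sq_sqrt hE0]
  refine (integral_le_of_le_integral_closedBall ((hessNorm_measurable _).pow_const 2)
    (fun x => sq_nonneg _) ((hessNorm_measurable w).pow_const 2) (fun x => sq_nonneg _) hwi
    (sq_nonneg _) h1).trans (le_of_eq ?_)
  -- The area of the disc supplies the factor $h^2$ that cancels the $h^{-2}$ of the squared
  -- pointwise bound.
  have h4 : volume.real (Metric.closedBall (0 : Plane) (5 * (ρ * h))) =
      (5 * (ρ * h)) ^ 2 * volume.real (Metric.closedBall (0 : Plane) 1) := by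
    have := Measure.addHaar_real_closedBall' (volume : Measure Plane) 0
      (by positivity : 0 ≤ 5 * (ρ * h))
    simpa using this
  rw [h4, interpConst, ← hc₀]
  field_simp
  ring

/-! ### Additive Schwarz operators -/

/-- An operator on a finite-dimensional space that is symmetric with respect to a positive definite
symmetric bilinear form is diagonalizable. -/
theorem iSup_eigenspace_eq_top_of_symmetric {E : Type*} [AddCommGroup E] [Module ℝ E]
    [FiniteDimensional ℝ E] (B : E →ₗ[ℝ] E →ₗ[ℝ] ℝ) (hsymm : ∀ x y, B x y = B y x)
    (hpos : ∀ x, x ≠ 0 → 0 < B x x) (T : Module.End ℝ E) (hT : ∀ x y, B (T x) y = B x (T y)) :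
    ⨆ μ : ℝ, Module.End.eigenspace T μ = ⊤ := by
  let core : InnerProductSpace.Core ℝ E :=
    { inner := fun x y => B x y
      conj_inner_symm := fun x y => by simpa using hsymm y x
      re_inner_nonneg := fun x => by
        rcases eq_or_ne x 0 with rfl | hx
        · simp
        · exact (hpos x hx).le
      add_left := fun x y z => by simp
      smul_left := fun x y c => by simp
      definite := fun x hx => by
        by_contra hne
        exact (hpos x hne).ne' hx }
  let _ : NormedAddCommGroup E := core.toNormedAddCommGroup
  let _ : InnerProductSpace ℝ E := InnerProductSpace.ofCore core.toCore
  have hs : T.IsSymmetric := fun x y => hT x y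
  have := hs.orthogonalComplement_iSup_eigenspaces_eq_bot
  rwa [Submodule.orthogonal_eq_bot_iff] at this

theorem bijective_of_injective_dual {E : Type*} [AddCommGroup E] [Module ℝ E]
    [FiniteDimensional ℝ E] (A : E →ₗ[ℝ] Module.Dual ℝ E) (hA : Function.Injective A) :
    Function.Bijective A :=
  ⟨hA, (LinearMap.injective_iff_surjective_of_finrank_eq_finrank
    (Subspace.dual_finrank_eq).symm).1 hA⟩

theorem stiffness_bijective {Ω : Set Plane} {U : Submodule ℝ W2c} [FiniteDimensional ℝ U]
    (hpos : ∀ v ∈ U, v ≠ 0 → 0 < plateForm Ω v v) : Function.Bijective (stiffness Ω U) := by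
  have hinj : Function.Injective (stiffness Ω U) := fun v w hvw => by
    by_contra hne
    have h1 : (v : W2c) - w ≠ 0 := fun h => hne (Subtype.ext (sub_eq_zero.1 h))
    have h2 := hpos _ (sub_mem v.2 w.2) h1
    have h3 : plateForm Ω (v : W2c) ((v : W2c) - w) = plateForm Ω (w : W2c) ((v : W2c) - w) :=
      LinearMap.congr_fun hvw (v - w)
    have h4 : plateForm Ω ((v : W2c) - w) ((v : W2c) - w) =
        plateForm Ω (v : W2c) ((v : W2c) - w) - plateForm Ω (w : W2c) ((v : W2c) - w) :=
      LinearMap.map_sub₂ (plateForm Ω) _ _ _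
    rw [h4, h3, sub_self] at h2
    exact lt_irrefl _ h2
  exact bijective_of_injective_dual (E := U) (stiffness Ω U) hinj

theorem linInv_apply {E F : Type*} [AddCommMonoid E] [Module ℝ E] [AddCommMonoid F] [Module ℝ F]
    {A : E →ₗ[ℝ] F} (hA : Function.Bijective A) (y : F) : A (linInv A y) = y := by
  rw [linInv, dif_pos hA]
  exact (LinearEquiv.ofBijective A hA).apply_symm_apply y

theorem plateForm_comm (Ω : Set Plane) (v w : W2c) : plateForm Ω v w = plateForm Ω w v :=
  plateEnergy_comm Ω v w

theorem plateForm_self_nonneg (Ω : Set Plane) (v : W2c) : 0 ≤ plateForm Ω v v :=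
  integral_nonneg fun x => Finset.sum_nonneg fun i _ => Finset.sum_nonneg fun j _ =>
    mul_self_nonneg (hess v x i j)

theorem plateForm_sum_left (Ω : Set Plane) {ι : Type*} (s : Finset ι) (v : ι → W2c) (w : W2c) :
    plateForm Ω (∑ i ∈ s, v i) w = ∑ i ∈ s, plateForm Ω (v i) w := by
  rw [map_sum, LinearMap.sum_apply]

theorem plateForm_sum_right (Ω : Set Plane) {ι : Type*} (s : Finset ι) (v : ι → W2c) (w : W2c) :
    plateForm Ω w (∑ i ∈ s, v i) = ∑ i ∈ s, plateForm Ω w (v i) := map_sum _ _ _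

/-- Young's inequality with weight, from the energy of $\Lambda v-w$. -/
theorem two_mul_plateForm_le (Ω : Set Plane) (v w : W2c) {Λ : ℝ} (hΛ : 0 < Λ) :
    2 * plateForm Ω v w ≤ Λ * plateForm Ω v v + Λ⁻¹ * plateForm Ω w w := by
  have h1 := plateForm_self_nonneg Ω (Λ • v - w)
  have h2 : plateForm Ω (Λ • v - w) (Λ • v - w) =
      Λ * (Λ * plateForm Ω v v) - 2 * Λ * plateForm Ω v w + plateForm Ω w w := by
    rw [map_sub, LinearMap.map_sub₂, LinearMap.map_sub₂, LinearMap.map_smul₂, LinearMap.map_smul₂,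
      map_smul, map_smul, plateForm_comm Ω w v]
    simp only [smul_eq_mul]
    ring
  rw [h2] at h1
  have h3 := mul_nonneg (inv_nonneg.2 hΛ.le) h1
  have h4 : Λ⁻¹ * (Λ * (Λ * plateForm Ω v v) - 2 * Λ * plateForm Ω v w + plateForm Ω w w) =
      Λ * plateForm Ω v v - 2 * plateForm Ω v w + Λ⁻¹ * plateForm Ω w w := by
    field_simp
  linarith

section Schwarz

variable {Ω : Set Plane} {P : PUM Ω} {J : ℕ} {H δ CH Cd : ℝ} {Nc : ℕ}

/-- The energy projection onto the local space. -/
noncomputable def localProj (DD : Decomposition P J H δ CH Cd Nc) (Nt : Set Plane) (j : Fin J)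
    (v : P.Vt Nt) : P.Vloc Nt (DD.D j) :=
  linInv (Aj DD Nt j) ((Ij DD Nt j).dualMap (Ah P Nt v))

theorem plateForm_localProj (DD : Decomposition P J H δ CH Cd Nc) (Nt : Set Plane) (j : Fin J)
    (hA : Function.Bijective (Aj DD Nt j)) (v : P.Vt Nt) {w : W2c}
    (hw : w ∈ P.Vloc Nt (DD.D j)) :
    plateForm Ω (localProj DD Nt j v : W2c) w = plateForm Ω (v : W2c) w :=
  LinearMap.congr_fun (linInv_apply hA ((Ij DD Nt j).dualMap (Ah P Nt v))) ⟨w, hw⟩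

theorem coe_BOLAh_apply (DD : Decomposition P J H δ CH Cd Nc) (Nt : Set Plane) (v : P.Vt Nt) :
    (BOLAh DD Nt v : W2c) = ∑ j, (localProj DD Nt j v : W2c) := by
  have : BOLAh DD Nt v = ∑ j, Ij DD Nt j (localProj DD Nt j v) := by
    simp only [BOLAh, BOL, LinearMap.comp_apply, LinearMap.sum_apply, localProj]
  rw [this, AddSubmonoidClass.coe_finsetSum]
  rfl

instance (Nt : Set Plane) : FiniteDimensional ℝ (P.Vt Nt) :=
  Submodule.finiteDimensional_of_le (P.VhOn_le Nt)

instance (Nt D : Set Plane) : FiniteDimensional ℝ (P.Vloc Nt D) :=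
  Submodule.finiteDimensional_of_le (inf_le_left.trans (P.VhOn_le Nt))

/-- The abstract theory of additive Schwarz preconditioners. -/
theorem schwarz_bound (DD : Decomposition P J H δ CH Cd Nc) (Nt : Set Plane)
    (hpos : ∀ v ∈ P.Vt Nt, v ≠ 0 → 0 < plateForm Ω v v) {K Λ : ℝ} (hK0 : 0 ≤ K) (hΛ0 : 0 < Λ)
    (hK : ∀ w : Fin J → W2c, (∀ j, w j ∈ P.Vloc Nt (DD.D j)) →
      plateForm Ω (∑ j, w j) (∑ j, w j) ≤ K * ∑ j, plateForm Ω (w j) (w j))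
    (hΛ : ∀ v ∈ P.Vt Nt, ∃ w : Fin J → W2c, (∀ j, w j ∈ P.Vloc Nt (DD.D j)) ∧ v = ∑ j, w j ∧
      ∑ j, plateForm Ω (w j) (w j) ≤ Λ * plateForm Ω v v) :
    (∀ j, Function.Bijective (Aj DD Nt j)) ∧
    (⨆ μ : ℝ, Module.End.eigenspace (M := P.Vt Nt) (BOLAh DD Nt) μ) = ⊤ ∧
    (∀ μ : ℝ, Module.End.HasEigenvalue (M := P.Vt Nt) (BOLAh DD Nt) μ → 0 < μ) ∧
    condNumber (E := P.Vt Nt) (BOLAh DD Nt) ≤ K * Λ := by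
  have hA : ∀ j, Function.Bijective (Aj DD Nt j) := fun j =>
    stiffness_bijective fun v hv => hpos v hv.1
  have hQ : ∀ j (v : P.Vt Nt) {w : W2c}, w ∈ P.Vloc Nt (DD.D j) →
      plateForm Ω (localProj DD Nt j v : W2c) w = plateForm Ω (v : W2c) w :=
    fun j v _ hw => plateForm_localProj DD Nt j (hA j) v hw
  -- With $P_j$ the local projections, $a(Tx,y)=\sum a(P_jx,P_jy)$. This makes $T$ symmetric for $a$
  -- and evaluates $\sum a(P_jv,P_jv)=\mu a(v,v)$ on eigenvectors.
  have hT : ∀ x y : P.Vt Nt, plateForm Ω (BOLAh DD Nt x : W2c) (y : W2c) =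
      ∑ j, plateForm Ω (localProj DD Nt j x : W2c) (localProj DD Nt j y : W2c) := by
    intro x y
    rw [coe_BOLAh_apply, plateForm_sum_left]
    refine Finset.sum_congr rfl fun j _ => ?_
    rw [plateForm_comm, ← hQ j y (localProj DD Nt j x).2, plateForm_comm]
  have hdiag : (⨆ μ : ℝ, Module.End.eigenspace (M := P.Vt Nt) (BOLAh DD Nt) μ) = ⊤ := by
    refine iSup_eigenspace_eq_top_of_symmetric (E := P.Vt Nt) (stiffness Ω (P.Vt Nt)) (fun x y => plateForm_comm Ω _ _)
      (fun x hx => hpos x x.2 fun h => hx (Subtype.ext h)) _ fun x y => ?_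
    change plateForm Ω (BOLAh DD Nt x : W2c) (y : W2c) =
      plateForm Ω (x : W2c) (BOLAh DD Nt y : W2c)
    rw [plateForm_comm Ω (x : W2c), hT, hT]
    exact Finset.sum_congr rfl fun j _ => plateForm_comm Ω _ _
  have heig : ∀ μ : ℝ, Module.End.HasEigenvalue (M := P.Vt Nt) (BOLAh DD Nt) μ →
      Λ⁻¹ ≤ μ ∧ μ ≤ K := by
    intro μ hμ
    obtain ⟨v, hv⟩ := hμ.exists_hasEigenvector
    have hTv : (BOLAh DD Nt v : W2c) = μ • (v : W2c) := congrArg Subtype.val hv.apply_eq_smul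
    have hv0 := hpos v v.2 fun h => hv.2 (Subtype.ext h)
    set a := plateForm Ω (v : W2c) (v : W2c) with ha
    have hS : ∑ j, plateForm Ω (localProj DD Nt j v : W2c) (localProj DD Nt j v : W2c) = μ * a := by
      rw [← hT v v, hTv, LinearMap.map_smul₂, smul_eq_mul]
    -- Here $a(v,v)=\sum a(P_jv,w_j)$. Young's inequality with weight $\Lambda$ and the stability of
    -- the splitting give $2a(v,v)\le\Lambda\mu a(v,v)+a(v,v)$.
    have hlow : Λ⁻¹ ≤ μ := by
      obtain ⟨w, hw, hvw, hle⟩ := hΛ v v.2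
      have h1 : a = ∑ j, plateForm Ω (localProj DD Nt j v : W2c) (w j) := by
        have : a = plateForm Ω (v : W2c) (∑ j, w j) := by rw [ha]; congr 1
        rw [this, plateForm_sum_right]
        exact Finset.sum_congr rfl fun j _ => (hQ j v (hw j)).symm
      have h2 : 2 * a ≤ Λ * (μ * a) + Λ⁻¹ * ∑ j, plateForm Ω (w j) (w j) := by
        rw [← hS, h1, Finset.mul_sum, Finset.mul_sum, Finset.mul_sum, ← Finset.sum_add_distrib]
        exact Finset.sum_le_sum fun j _ => two_mul_plateForm_le Ω _ _ hΛ0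
      have h3 : Λ⁻¹ * ∑ j, plateForm Ω (w j) (w j) ≤ a := by
        rw [inv_mul_le_iff₀ hΛ0]; exact hle
      have h4 : 1 * a ≤ (Λ * μ) * a := by linarith
      have h5 : 1 ≤ Λ * μ := le_of_mul_le_mul_right h4 hv0
      rw [inv_le_iff_one_le_mul₀' hΛ0]
      exact h5
    refine ⟨hlow, ?_⟩
    have hμ0 : 0 < μ := (inv_pos.2 hΛ0).trans_le hlow
    -- The choice $w_j=P_jv$ turns the hypothesis into $\mu^2a(v,v)\le K\mu a(v,v)$.
    have h6 := hK (fun j => (localProj DD Nt j v : W2c)) fun j => (localProj DD Nt j v).2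
    rw [hS, ← coe_BOLAh_apply, hTv, LinearMap.map_smul₂, map_smul, smul_eq_mul, smul_eq_mul,
      ← ha] at h6
    have h7 : μ * (μ * a) ≤ K * (μ * a) := h6
    exact le_of_mul_le_mul_right h7 (by positivity)
  refine ⟨hA, hdiag, fun μ hμ => (inv_pos.2 hΛ0).trans_le (heig μ hμ).1, ?_⟩
  unfold condNumber
  rcases Set.eq_empty_or_nonempty {μ : ℝ | Module.End.HasEigenvalue (M := P.Vt Nt) (BOLAh DD Nt) μ} with he | hne
  -- Without eigenvalues (trivial space) supremum, infimum and quotient are all 0 by convention.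
  · rw [he, Real.sSup_empty, Real.sInf_empty, div_zero]
    positivity
  · have h1 : sSup {μ : ℝ | Module.End.HasEigenvalue (M := P.Vt Nt) (BOLAh DD Nt) μ} ≤ K :=
      csSup_le hne fun μ hμ => (heig μ hμ).2
    have h2 : Λ⁻¹ ≤ sInf {μ : ℝ | Module.End.HasEigenvalue (M := P.Vt Nt) (BOLAh DD Nt) μ} :=
      le_csInf hne fun μ hμ => (heig μ hμ).1
    have h3 : 0 < Λ⁻¹ := inv_pos.2 hΛ0
    calc _ ≤ K / Λ⁻¹ := div_le_div₀ hK0 h1 h3 h2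
      _ = K * Λ := by rw [div_inv_eq_mul]

end Schwarz

/-! ### Extension of the discrete functions by zero -/

section Extension

variable {Ω : Set Plane} {P : PUM Ω}

theorem ae_mem_or_notMem_closure (hΩ : IsPolygonalDomain Ω) : ∀ᵐ x, x ∈ Ω ∨ x ∉ closure Ω := by
  filter_upwards [measure_eq_zero_iff_ae_notMem.1 hΩ.volume_frontier] with x hx
  rw [hΩ.isOpen.frontier_eq] at hx
  by_cases h : x ∈ Ω
  · exact Or.inl h
  · exact Or.inr fun hc => hx ⟨hc, h⟩

theorem indicator_eventuallyEq_zero {v : Plane → ℝ} {x : Plane} (hx : x ∉ closure Ω) :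
    Ω.indicator v =ᶠ[nhds x] 0 := by
  filter_upwards [isClosed_closure.isOpen_compl.mem_nhds hx] with y hy
  exact indicator_of_notMem (fun h => hy (subset_closure h)) v

/-- Members of `P.Vh` need not vanish outside $\Omega$. Their clamped boundary values permit the
extension by zero, to which the Poincaré inequalities on the plane apply. -/
theorem extension_isW2Inf (hΩ : IsOpen Ω) {v : W2c} (hv : v ∈ P.Vh) :
    IsW2Inf (Ω.indicator (v : Plane → ℝ)) :=
  IsW2Inf.indicator hΩ v.2.1 (P.Vh_clamped hv)

theorem extension_frontier (hΩ : IsOpen Ω) {v : W2c} (hv : v ∈ P.Vh) {z : Plane}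
    (hz : z ∈ frontier Ω) : Ω.indicator (v : Plane → ℝ) z = 0 ∧
      fderiv ℝ (Ω.indicator (v : Plane → ℝ)) z = 0 := by
  have hzΩ : z ∉ Ω := by
    rw [hΩ.frontier_eq] at hz
    exact hz.2
  refine ⟨indicator_of_notMem hzΩ _, ?_⟩
  rw [(fderiv_indicator_of_frontier hΩ v.2.1 (P.Vh_clamped hv) z).fderiv,
    indicator_of_notMem hzΩ]

theorem exists_closedBall_support (hΩ : IsPolygonalDomain Ω) : ∃ z : Plane, ∀ v : Plane → ℝ,
    ∀ x, x ∉ Metric.closedBall z (Metric.diam Ω) → Ω.indicator v x = 0 := by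
  obtain ⟨z, hz⟩ := hΩ.isConnected.nonempty
  exact ⟨z, fun v x hx => indicator_of_notMem
    (fun h => hx (Metric.dist_le_diam_of_mem hΩ.isBounded h hz)) v⟩

theorem integral_hessNorm_extension_le (hΩ : IsPolygonalDomain Ω) (v : W2c) :
    ∫ x, hessNorm (Ω.indicator (v : Plane → ℝ)) x ^ 2 ≤ plateForm Ω v v := by
  have h1 : ∫ x, hessNorm (Ω.indicator (v : Plane → ℝ)) x ^ 2 =
      ∫ x in Ω, hessNorm (Ω.indicator (v : Plane → ℝ)) x ^ 2 := by
    symm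
    refine setIntegral_eq_integral_of_ae_compl_eq_zero ?_
    filter_upwards [ae_mem_or_notMem_closure hΩ] with x hx hxΩ
    rw [hessNorm_eq_zero (indicator_eventuallyEq_zero (hx.resolve_left hxΩ))]
    norm_num
  rw [h1]
  refine integral_mono_of_nonneg (Filter.Eventually.of_forall fun x => sq_nonneg _)
    (plateEnergy_integrable Ω v.2 v.2) ?_
  filter_upwards [ae_restrict_mem hΩ.isOpen.measurableSet] with x hx
  have h2 : Ω.indicator (v : Plane → ℝ) =ᶠ[nhds x] v := by
    filter_upwards [hΩ.isOpen.mem_nhds hx] with y hy using indicator_of_mem hy _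
  rw [hessNorm_congr h2]
  exact hessNorm_sq_le _ _

/-- Zero energy forces the extension to vanish by Poincaré. The nodes lie in $\Omega$, so all nodal
values are zero, and these determine `v`. -/
theorem plateForm_pos (hΩ : IsPolygonalDomain Ω) (hd : 0 < Metric.diam Ω) {v : W2c}
    (hv : v ∈ P.Vh) (hne : v ≠ 0) : 0 < plateForm Ω v v := by
  refine lt_of_le_of_ne (plateForm_self_nonneg Ω v) fun h0 => hne ?_
  obtain ⟨z, hz⟩ := exists_closedBall_support hΩ
  have hu := extension_isW2Inf hΩ.isOpen hv
  have h1 := poincare_two hu hd (hz v)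
  have h2 := integral_hessNorm_extension_le hΩ v
  rw [← h0] at h2
  have h3 : ∫ x, Ω.indicator (v : Plane → ℝ) x ^ 2 = 0 := by
    refine le_antisymm (h1.trans ?_) (integral_nonneg fun x => sq_nonneg _)
    exact mul_nonpos_of_nonneg_of_nonpos (by positivity) h2
  rw [integral_eq_zero_iff_of_nonneg (fun x => sq_nonneg _) (hu.integrable_sq (hz v)).1] at h3
  have h4 : Ω.indicator (v : Plane → ℝ) = 0 := by
    refine (Continuous.ae_eq_iff_eq volume hu.continuous continuous_zero).1 ?_
    filter_upwards [h3] with x hx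
    simpa using hx
  refine P.Vh_eq_zero_of_nodes hv fun p hp => ?_
  obtain ⟨i, hi⟩ := mem_iUnion.1 hp
  rw [← indicator_of_mem (P.node_mem hi) (v : Plane → ℝ), h4]
  rfl

end Extension

section Estimates

variable {Ω : Set Plane} {P : PUM Ω} {J : ℕ} {H δ CH Cd : ℝ} {Nc : ℕ} {h ρ Cφ σ : ℝ} {M : ℕ}

/-! ### The upper bound -/

-- Functions in a local space may be nonzero outside $D_j$, so subdomains are counted through nodes:
-- at most $M$ patches at `x`, at most 9 nodes in each, at most $N_c$ subdomains at each node.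
open Classical in
theorem card_active_le (hP : P.IsRegular h ρ Cφ σ M) (DD : Decomposition P J H δ CH Cd Nc)
    (x : Plane) :
    (Finset.univ.filter fun j => ∃ k, x ∈ P.patch k ∧ ∃ p ∈ P.nodes k, p ∈ DD.D j).card ≤
      M * (9 * Nc) := by
  set s : Finset (Fin P.n) := Finset.univ.filter fun i => x ∈ P.patch i with hsd
  have hcard : s.card ≤ M := by
    refine le_trans (le_of_eq ?_) (hP.overlap x)
    rw [← Set.ncard_coe_finset]
    congr 1
    ext i
    simp [hsd]
  have hsub : (Finset.univ.filter fun j => ∃ k, x ∈ P.patch k ∧ ∃ p ∈ P.nodes k, p ∈ DD.D j) ⊆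
      s.biUnion fun k => (P.nodes k).biUnion fun p => Finset.univ.filter fun j => p ∈ DD.D j := by
    intro j hj
    simpa [hsd] using hj
  refine (Finset.card_le_card hsub).trans ?_
  refine (Finset.card_biUnion_le_card_mul s _ (9 * Nc) fun k _ => ?_).trans
    (Nat.mul_le_mul_right _ hcard)
  refine (Finset.card_biUnion_le_card_mul (P.nodes k) _ Nc fun p hp => ?_).trans
    (Nat.mul_le_mul_right _ (P.card_nodes_le k))
  refine le_trans (le_of_eq ?_) (DD.overlap p (P.node_mem hp))
  rw [← Set.ncard_coe_finset]
  congr 1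
  ext i
  simp

/-- By unisolvence the polynomials of all patches around `x` vanish, since all their nodes lie
outside $D_j$. -/
theorem eventuallyEq_zero_of_inactive (DD : Decomposition P J H δ CH Cd Nc) {j : Fin J} {w : W2c}
    (hw : w ∈ P.VhOn (DD.D j)) {x : Plane} (hxf : ∀ i, x ∉ frontier (P.patch i))
    (hx : ¬ ∃ k, x ∈ P.patch k ∧ ∃ p ∈ P.nodes k, p ∈ DD.D j) :
    (w : Plane → ℝ) =ᶠ[nhds x] 0 := by
  classical
  obtain ⟨q, hq, hs⟩ := P.exists_eq_sum hw.1
  have h1 := P.eventuallyEq_sum_filter hxf (Finset.univ.filter fun i => x ∈ P.patch i)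
    (fun i => by simp) q
  rw [← hs] at h1
  refine h1.trans (Filter.EventuallyEq.of_eq (Finset.sum_eq_zero fun k hk => ?_))
  have hk' : x ∈ P.patch k := (Finset.mem_filter.1 hk).2
  have : q k = 0 := P.eq_zero_of_nodes (hq k) fun p hp => by
    rw [← P.sum_apply_node q hp, ← hs]
    exact hw.2 p (mem_iUnion.2 ⟨k, hp⟩) fun hpD => hx ⟨k, hk', p, hp, hpD⟩
  rw [this, mul_zero]

/-- Cauchy–Schwarz at almost every point, over the active indices only. -/
theorem plateForm_sum_le (hP : P.IsRegular h ρ Cφ σ M) (DD : Decomposition P J H δ CH Cd Nc)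
    {w : Fin J → W2c} (hw : ∀ j, w j ∈ P.VhOn (DD.D j)) :
    plateForm Ω (∑ j, w j) (∑ j, w j) ≤
      ((M * (9 * Nc) : ℕ) : ℝ) * ∑ j, plateForm Ω (w j) (w j) := by
  classical
  have h1 : ∑ j, plateForm Ω (w j) (w j) =
      ∫ x in Ω, ∑ j, ∑ a, ∑ b, hess (w j) x a b * hess (w j) x a b :=
    (integral_finsetSum _ fun j _ => plateEnergy_integrable Ω (w j).2 (w j).2).symm
  rw [h1, ← integral_const_mul]
  refine integral_mono_of_nonneg (Filter.Eventually.of_forall fun x =>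
    Finset.sum_nonneg fun a _ => Finset.sum_nonneg fun b _ => mul_self_nonneg _)
    ((integrable_finsetSum _ fun j _ => plateEnergy_integrable Ω (w j).2 (w j).2).const_mul _) ?_
  have h2 := hess_ae_sum Finset.univ (f := fun j => (w j : Plane → ℝ)) fun j _ => (w j).2.1
  filter_upwards [ae_restrict_of_ae h2, ae_restrict_of_ae P.ae_notMem_frontier_patch] with x hx hxf
  have hcoe : ((∑ j, w j : W2c) : Plane → ℝ) = ∑ j, (w j : Plane → ℝ) :=
    AddSubmonoidClass.coe_finsetSum _ _
  have h3 : ∀ a b, hess (∑ j, w j : W2c) x a b * hess (∑ j, w j : W2c) x a b ≤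
      ((M * (9 * Nc) : ℕ) : ℝ) * ∑ j, hess (w j) x a b * hess (w j) x a b := by
    intro a b
    rw [hcoe, hx a b]
    set S := Finset.univ.filter fun j => ∃ k, x ∈ P.patch k ∧ ∃ p ∈ P.nodes k, p ∈ DD.D j with hS
    have hz : ∀ j ∉ S, hess (w j) x a b = 0 := fun j hj =>
      hess_eq_zero_of_eventuallyEq (eventuallyEq_zero_of_inactive DD (hw j) hxf
        (by simpa [hS] using hj)) a b
    have e1 : ∑ j, hess (w j) x a b = ∑ j ∈ S, hess (w j) x a b :=
      (Finset.sum_subset (Finset.subset_univ S) fun j _ hj => hz j hj).symm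
    have e2 : ∑ j, hess (w j) x a b * hess (w j) x a b =
        ∑ j ∈ S, hess (w j) x a b * hess (w j) x a b :=
      (Finset.sum_subset (Finset.subset_univ S) fun j _ hj => by rw [hz j hj, mul_zero]).symm
    rw [e1, e2, ← sq]
    refine sq_sum_le_card_mul_sum_sq.trans ?_
    simp only [sq]
    refine mul_le_mul_of_nonneg_right ?_ (Finset.sum_nonneg fun j _ => mul_self_nonneg _)
    exact_mod_cast card_active_le hP DD x
  change ∑ a, ∑ b, hess (∑ j, w j : W2c) x a b * hess (∑ j, w j : W2c) x a b ≤ _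
  calc ∑ a, ∑ b, hess (∑ j, w j : W2c) x a b * hess (∑ j, w j : W2c) x a b
      ≤ ∑ a, ∑ b, ((M * (9 * Nc) : ℕ) : ℝ) * ∑ j, hess (w j) x a b * hess (w j) x a b :=
        Finset.sum_le_sum fun a _ => Finset.sum_le_sum fun b _ => h3 a b
    _ = ((M * (9 * Nc) : ℕ) : ℝ) * ∑ j, ∑ a, ∑ b, hess (w j) x a b * hess (w j) x a b := by
        simp only [Fin.sum_univ_two, ← Finset.mul_sum, ← Finset.sum_add_distrib]

/-! ### The lower bound -/

/-- The definition gives zeros only off $\bar D_j$. A nonzero value at $x$ would persist nearby and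
put $x$ in the interior of $\bar D_j$, hence in $D_j$ in the absence of slits. -/
theorem Decomposition.psi_eq_zero (DD : Decomposition P J H δ CH Cd Nc) (hΩ : IsOpen Ω) {j : Fin J}
    {x : Plane} (hx : x ∈ Ω) (hxD : x ∉ DD.D j) : DD.ψ j x = 0 := by
  by_contra hne
  have hnear : ∀ᶠ y in nhds x, DD.ψ j y ≠ 0 :=
    (DD.ψ_regular j).continuous.continuousAt.eventually_ne hne
  refine hxD (DD.no_slit j ⟨hx, ?_⟩)
  rw [mem_interior_iff_mem_nhds]
  filter_upwards [hnear, hΩ.mem_nhds hx] with y hy hyΩ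
  by_contra hyc
  exact hy (DD.ψ_eq_zero j y ⟨hyΩ, hyc⟩)

theorem Decomposition.ae_notMem_frontier (DD : Decomposition P J H δ CH Cd Nc)
    (hΩ : IsPolygonalDomain Ω) : ∀ᵐ x, ∀ j, x ∉ frontier (DD.D j) := by
  filter_upwards [measure_eq_zero_iff_ae_notMem.1 hΩ.volume_frontier,
    P.ae_notMem_frontier_patch] with x h1 h2 j hj
  rcases DD.aligned j hj with h | h
  · exact h1 h
  · obtain ⟨i, hi⟩ := mem_iUnion.1 h
    exact h2 i hi

/-- Leibniz rule with $(a+b+c)^2\le3(a^2+b^2+c^2)$; the 4 is the square of the double cross term.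
Off the null boundaries only the at most $N_c$ subdomains containing `x` contribute. -/
theorem Decomposition.ae_sum_hessNorm_le (DD : Decomposition P J H δ CH Cd Nc)
    (hΩ : IsPolygonalDomain Ω) {v : W2c} (hv : v ∈ P.Vh) :
    ∀ᵐ x, ∑ j, hessNorm (DD.ψ j * Ω.indicator (v : Plane → ℝ)) x ^ 2 ≤
      Nc * (3 * Cd ^ 2 * (hessNorm (Ω.indicator (v : Plane → ℝ)) x ^ 2 +
        4 * (δ ^ 2)⁻¹ * ‖fderiv ℝ (Ω.indicator (v : Plane → ℝ)) x‖ ^ 2 +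
        (δ ^ 4)⁻¹ * Ω.indicator (v : Plane → ℝ) x ^ 2)) := by
  classical
  have hu := extension_isW2Inf hΩ.isOpen hv
  set u := Ω.indicator (v : Plane → ℝ) with hud
  have hψd : ∀ᵐ x, ∀ j, DifferentiableAt ℝ (fderiv ℝ (DD.ψ j)) x :=
    ae_all_iff.2 fun j => (DD.ψ_regular j).ae_differentiableAt_fderiv
  have hψb : ∀ᵐ x, x ∈ Ω → ∀ j, |DD.ψ j x| ≤ Cd * (δ ^ 0)⁻¹ ∧
      ‖fderiv ℝ (DD.ψ j) x‖ ≤ Cd * (δ ^ 1)⁻¹ ∧ hessNorm (DD.ψ j) x ≤ Cd * (δ ^ 2)⁻¹ :=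
    (ae_restrict_iff' hΩ.isOpen.measurableSet).1
      (ae_all_iff.2 fun j => (DD.ψ_bound j).ae)
  filter_upwards [hψd, hψb, hu.ae_differentiableAt_fderiv, DD.ae_notMem_frontier hΩ,
    ae_mem_or_notMem_closure hΩ] with x h1 h2 h3 h4 h5
  have hrhs : 0 ≤ 3 * Cd ^ 2 * (hessNorm u x ^ 2 + 4 * (δ ^ 2)⁻¹ * ‖fderiv ℝ u x‖ ^ 2 +
        (δ ^ 4)⁻¹ * u x ^ 2) := by positivity
  rcases h5 with hx | hx
  swap
  · have : ∀ j, hessNorm (DD.ψ j * u) x = 0 := fun j => by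
      refine hessNorm_eq_zero ?_
      filter_upwards [indicator_eventuallyEq_zero (v := (v : Plane → ℝ)) hx] with y hy
      rw [Pi.mul_apply, hud, hy]
      simp
    simp only [this]
    simpa using mul_nonneg (Nat.cast_nonneg Nc) hrhs
  set S : Finset (Fin J) := Finset.univ.filter fun j => x ∈ DD.D j with hS
  have hcard : S.card ≤ Nc := by
    refine le_trans (le_of_eq ?_) (DD.overlap x hx)
    rw [← Set.ncard_coe_finset]
    congr 1
    ext i
    simp [hS]
  have hz : ∀ j ∉ S, hessNorm (DD.ψ j * u) x = 0 := fun j hj => by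
    have hxD : x ∉ DD.D j := by simpa [hS] using hj
    have hxc : x ∉ closure (DD.D j) := fun hc => by
      have := h4 j
      rw [(DD.isOpen j).frontier_eq] at this
      exact this ⟨hc, hxD⟩
    refine hessNorm_eq_zero ?_
    filter_upwards [hΩ.isOpen.mem_nhds hx, isClosed_closure.isOpen_compl.mem_nhds hxc] with y hy hyc
    rw [Pi.mul_apply, DD.ψ_eq_zero j y ⟨hy, hyc⟩, zero_mul]
    rfl
  have hb : ∀ j, hessNorm (DD.ψ j * u) x ^ 2 ≤ 3 * Cd ^ 2 * (hessNorm u x ^ 2 +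
      4 * (δ ^ 2)⁻¹ * ‖fderiv ℝ u x‖ ^ 2 + (δ ^ 4)⁻¹ * u x ^ 2) := fun j => by
    obtain ⟨b0, b1, b2⟩ := h2 hx j
    rw [pow_zero, inv_one, mul_one] at b0
    rw [pow_one] at b1
    have h6 := hessNorm_mul_le (DD.ψ_regular j).differentiable hu.differentiable (h1 j) h3
    have h7 : hessNorm (DD.ψ j * u) x ≤ Cd * hessNorm u x +
        2 * (Cd * δ⁻¹) * ‖fderiv ℝ u x‖ + |u x| * (Cd * (δ ^ 2)⁻¹) := by
      refine h6.trans (add_le_add_three (mul_le_mul_of_nonneg_right b0 (hessNorm_nonneg _ _))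
        (mul_le_mul_of_nonneg_right (mul_le_mul_of_nonneg_left b1 zero_le_two) (norm_nonneg _))
        (mul_le_mul_of_nonneg_left b2 (abs_nonneg _)))
    refine (pow_le_pow_left₀ (hessNorm_nonneg _ _) h7 2).trans ?_
    have h8 : ∀ a b c : ℝ, (a + b + c) ^ 2 ≤ 3 * (a ^ 2 + b ^ 2 + c ^ 2) := fun a b c => by
      nlinarith [sq_nonneg (a - b), sq_nonneg (b - c), sq_nonneg (a - c)]
    refine (h8 _ _ _).trans (le_of_eq ?_)
    have h9 : (δ ^ 4)⁻¹ = (δ ^ 2)⁻¹ ^ 2 := by rw [inv_pow]; ring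
    have h10 : (δ ^ 2)⁻¹ = δ⁻¹ ^ 2 := by rw [inv_pow]
    simp only [mul_pow, sq_abs, h9, h10]
    ring
  calc ∑ j, hessNorm (DD.ψ j * u) x ^ 2 = ∑ j ∈ S, hessNorm (DD.ψ j * u) x ^ 2 :=
        (Finset.sum_subset (Finset.subset_univ S) fun j _ hj => by rw [hz j hj]; norm_num).symm
    _ ≤ ∑ j ∈ S, 3 * Cd ^ 2 * (hessNorm u x ^ 2 + 4 * (δ ^ 2)⁻¹ * ‖fderiv ℝ u x‖ ^ 2 +
          (δ ^ 4)⁻¹ * u x ^ 2) := Finset.sum_le_sum fun j _ => hb j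
    _ ≤ _ := by
        rw [Finset.sum_const, nsmul_eq_mul]
        exact mul_le_mul_of_nonneg_right (by exact_mod_cast hcard) hrhs

theorem Decomposition.sum_integral_hessNorm_le (DD : Decomposition P J H δ CH Cd Nc)
    (hΩ : IsPolygonalDomain Ω) (hδ : 0 < δ) (hδd : δ ≤ Metric.diam Ω) {v : W2c} (hv : v ∈ P.Vh) :
    ∑ j, ∫ x, hessNorm (DD.ψ j * Ω.indicator (v : Plane → ℝ)) x ^ 2 ≤
      Nc * (705 * Cd ^ 2 * Metric.diam Ω ^ 4 * (δ ^ 4)⁻¹) * plateForm Ω v v := by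
  obtain ⟨z, hz⟩ := exists_closedBall_support hΩ
  have hu := extension_isW2Inf hΩ.isOpen hv
  have hz' := hz v
  have hform := integral_hessNorm_extension_le hΩ v
  have hae := DD.ae_sum_hessNorm_le hΩ hv
  set u := Ω.indicator (v : Plane → ℝ) with hud
  set d := Metric.diam Ω with hd
  have hd0 : 0 < d := hδ.trans_le hδd
  obtain ⟨i0, i1, i2⟩ := hu.integrable_sq hz'
  have p1 := poincare_fderiv hu hd0 hz'
  have p2 := poincare_two hu hd0 hz'
  have hj : ∀ j, Integrable fun x => hessNorm (DD.ψ j * u) x ^ 2 := fun j =>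
    (((DD.ψ_regular j).mul hu).integrable_sq (z := z) (R := d)
      fun x hx => by rw [Pi.mul_apply, hz' x hx, mul_zero]).2.2
  rw [← integral_finsetSum _ fun j _ => hj j]
  have j1 : Integrable fun x => 4 * (δ ^ 2)⁻¹ * ‖fderiv ℝ u x‖ ^ 2 := i1.const_mul _
  have j0 : Integrable fun x => (δ ^ 4)⁻¹ * u x ^ 2 := i0.const_mul _
  have j2 : Integrable fun x => hessNorm u x ^ 2 + 4 * (δ ^ 2)⁻¹ * ‖fderiv ℝ u x‖ ^ 2 := i2.add j1
  have j3 : Integrable fun x => hessNorm u x ^ 2 + 4 * (δ ^ 2)⁻¹ * ‖fderiv ℝ u x‖ ^ 2 +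
      (δ ^ 4)⁻¹ * u x ^ 2 := j2.add j0
  refine (integral_mono_ae (integrable_finsetSum _ fun j _ => hj j)
    ((j3.const_mul _).const_mul _) hae).trans ?_
  rw [integral_const_mul, integral_const_mul, integral_add j2 j0, integral_add i2 j1,
    integral_const_mul, integral_const_mul]
  set I := ∫ x, hessNorm u x ^ 2 with hI
  have hI0 : 0 ≤ I := integral_nonneg fun x => sq_nonneg _
  -- As $\delta\le d$, all lower powers of $1/\delta$ are raised to $\delta^{-4}$ at the price of
  -- powers of $d$. With the Poincaré constants, $235=1+4\cdot18+162$ and $705=3\cdot235$.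
  have e1 : (1 : ℝ) ≤ d ^ 4 * (δ ^ 4)⁻¹ := by
    rw [← div_eq_mul_inv, one_le_div (by positivity)]
    exact pow_le_pow_left₀ hδ.le hδd 4
  have e2 : (δ ^ 2)⁻¹ ≤ d ^ 2 * (δ ^ 4)⁻¹ := by
    rw [← div_eq_mul_inv, inv_le_iff_one_le_mul₀ (by positivity)]
    have : d ^ 2 / δ ^ 4 * δ ^ 2 = d ^ 2 / δ ^ 2 := by field_simp
    rw [this, one_le_div (by positivity)]
    exact pow_le_pow_left₀ hδ.le hδd 2
  have hsum : I + 4 * (δ ^ 2)⁻¹ * (∫ x, ‖fderiv ℝ u x‖ ^ 2) + (δ ^ 4)⁻¹ * ∫ x, u x ^ 2 ≤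
      235 * (d ^ 4 * (δ ^ 4)⁻¹) * plateForm Ω v v := by
    calc I + 4 * (δ ^ 2)⁻¹ * (∫ x, ‖fderiv ℝ u x‖ ^ 2) + (δ ^ 4)⁻¹ * ∫ x, u x ^ 2
        ≤ (d ^ 4 * (δ ^ 4)⁻¹) * I + 4 * (d ^ 2 * (δ ^ 4)⁻¹) * (18 * d ^ 2 * I) +
          (δ ^ 4)⁻¹ * (162 * d ^ 4 * I) := by
          refine add_le_add_three (le_mul_of_one_le_left hI0 e1) ?_ ?_
          · exact mul_le_mul (mul_le_mul_of_nonneg_left e2 (by norm_num)) p1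
              (integral_nonneg fun x => sq_nonneg _) (by positivity)
          · exact mul_le_mul_of_nonneg_left p2 (by positivity)
      _ = 235 * (d ^ 4 * (δ ^ 4)⁻¹) * I := by ring
      _ ≤ _ := mul_le_mul_of_nonneg_left hform (by positivity)
  calc _ ≤ Nc * (3 * Cd ^ 2 * (235 * (d ^ 4 * (δ ^ 4)⁻¹) * plateForm Ω v v)) :=
        mul_le_mul_of_nonneg_left (mul_le_mul_of_nonneg_left hsum (by positivity)) (by positivity)
    _ = _ := by ring

/-- The stable decomposition of a function in `Ṽ_h`. -/
theorem exists_stable_decomposition (hP : P.IsRegular h ρ Cφ σ M)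
    (DD : Decomposition P J H δ CH Cd Nc) (hΩ : IsPolygonalDomain Ω) (hh : 0 < h) (hδ : h ≤ δ)
    (hδd : δ ≤ Metric.diam Ω) (hρ : 0 < ρ) {ℓ κ : ℝ} (hℓ : 0 < ℓ) (hκ1 : 1 ≤ κ)
    (hκ : 2 * (ρ * h) ≤ κ * ℓ)
    (hseg : ∀ z ∈ frontier Ω, ∃ e : Plane, ‖e‖ = 1 ∧ ∀ t ∈ Icc 0 ℓ, z + t • e ∈ frontier Ω)
    (Nt : Set Plane) {v : W2c} (hv : v ∈ P.Vt Nt) :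
    ∃ w : Fin J → W2c, (∀ j, w j ∈ P.Vloc Nt (DD.D j)) ∧ v = ∑ j, w j ∧
      ∑ j, plateForm Ω (w j) (w j) ≤ 4 * (interpConst ρ Cφ σ κ M *
        (Nc * (705 * Cd ^ 2 * Metric.diam Ω ^ 4 * (δ ^ 4)⁻¹) * plateForm Ω v v)) := by
  have hvh : v ∈ P.Vh := hv.1
  have hu := extension_isW2Inf hΩ.isOpen hvh
  have hfr := fun z hz => extension_frontier (P := P) hΩ.isOpen hvh (z := z) hz
  have hsum := DD.sum_integral_hessNorm_le hΩ (hh.trans_le hδ) hδd hvh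
  obtain ⟨z, hz⟩ := exists_closedBall_support hΩ
  have hz' := hz v
  set u := Ω.indicator (v : Plane → ℝ) with hud
  have hwj : ∀ j, IsW2Inf (DD.ψ j * u) := fun j => (DD.ψ_regular j).mul hu
  have hwj0 : ∀ j, ∀ z ∈ frontier Ω, (DD.ψ j * u) z = 0 ∧ fderiv ℝ (DD.ψ j * u) z = 0 := by
    intro j z hz
    obtain ⟨h1, h2⟩ := hfr z hz
    rw [fderiv_mul_eq (DD.ψ_regular j).differentiable hu.differentiable]
    simp [h1, h2]
  -- The interpolant of $\psi_jv$ has nodal values $\psi_j(p)v(p)$. It therefore vanishes at every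
  -- node where $v$ does, whatever the choice of `Nt`, and at the nodes outside $D_j$.
  let w : Fin J → W2c := fun j =>
    P.assemble (fun i => P.interp i (DD.ψ j * u)) fun i => P.interp_mem i _
  have hwcoe : ∀ j, (w j : Plane → ℝ) = ∑ i, P.phi i * P.interp i (DD.ψ j * u) := fun j => rfl
  have hwh : ∀ j, w j ∈ P.Vh := fun j => P.assemble_mem_Vh _ _
  have hnode : ∀ j, ∀ p ∈ P.nodeSet, p ∈ Ω ∧ (w j : Plane → ℝ) p = DD.ψ j p * (v : Plane → ℝ) p := by
    intro j p hp
    obtain ⟨i, hi⟩ := mem_iUnion.1 hp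
    have hpΩ := P.node_mem hi
    refine ⟨hpΩ, ?_⟩
    rw [hwcoe, P.sum_apply_node _ hi, P.interp_node _ hi, Pi.mul_apply, hud,
      indicator_of_mem hpΩ]
  refine ⟨w, fun j => ⟨⟨hwh j, fun p hp hpN => ?_⟩, ⟨hwh j, fun p hp hpD => ?_⟩⟩, ?_, ?_⟩
  · rw [(hnode j p hp).2, hv.2 p hp hpN, mul_zero]
  · rw [(hnode j p hp).2, DD.psi_eq_zero hΩ.isOpen (hnode j p hp).1 hpD, zero_mul]
  · refine sub_eq_zero.1 (P.Vh_eq_zero_of_nodes (sub_mem hvh (sum_mem fun j _ => hwh j))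
      fun p hp => ?_)
    have hpΩ : p ∈ Ω := by
      obtain ⟨i, hi⟩ := mem_iUnion.1 hp
      exact P.node_mem hi
    have h1 : ((∑ j, w j : W2c) : Plane → ℝ) p = (v : Plane → ℝ) p := by
      rw [AddSubmonoidClass.coe_finsetSum, Finset.sum_apply,
        Finset.sum_congr rfl fun j _ => (hnode j p hp).2, ← Finset.sum_mul,
        DD.ψ_sum p (subset_closure hpΩ), one_mul]
    exact sub_eq_zero.2 h1.symm
  -- The factor 4 passes from the operator norm of the Hessian to the sum of its four squared
  -- entries.
  · have h1 : ∀ j, plateForm Ω (w j) (w j) ≤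
        4 * (interpConst ρ Cφ σ κ M * ∫ x, hessNorm (DD.ψ j * u) x ^ 2) := by
      intro j
      have hint := ((hwj j).integrable_sq (z := z) (R := Metric.diam Ω)
        fun x hx => by rw [Pi.mul_apply, hz' x hx, mul_zero]).2.2
      refine le_trans ?_ (mul_le_mul_of_nonneg_left (hP.integral_hessNorm_interp_le P hΩ.isOpen hh
        hρ hℓ hκ1 hκ hseg (hwj j) (hwj0 j) hint) (by norm_num))
      rw [← integral_const_mul, ← hwcoe]
      refine integral_mono_of_nonneg (Filter.Eventually.of_forall fun x =>
        Finset.sum_nonneg fun a _ => Finset.sum_nonneg fun b _ => mul_self_nonneg _) ?_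
        (Filter.Eventually.of_forall fun x => sum_hess_sq_le _ _)
      obtain ⟨R, hR⟩ := (w j).2.2.isCompact.isBounded.subset_closedBall 0
      refine (((w j).2.1.integrable_sq (z := 0) (R := R) fun x hx => ?_).2.2.const_mul 4).restrict
      exact image_eq_zero_of_notMem_tsupport fun h => hx (hR h)
    have hc : 0 ≤ interpConst ρ Cφ σ κ M := by
      unfold interpConst
      positivity
    calc ∑ j, plateForm Ω (w j) (w j)
        ≤ ∑ j, 4 * (interpConst ρ Cφ σ κ M * ∫ x, hessNorm (DD.ψ j * u) x ^ 2) :=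
          Finset.sum_le_sum fun j _ => h1 j
      _ = 4 * (interpConst ρ Cφ σ κ M * ∑ j, ∫ x, hessNorm (DD.ψ j * u) x ^ 2) := by
          rw [← Finset.mul_sum, ← Finset.mul_sum]
      _ ≤ _ := mul_le_mul_of_nonneg_left (mul_le_mul_of_nonneg_left hsum hc) (by norm_num)

end Estimates

end PlateSchwarz

/-! ### Assembly of the constants. -/

theorem mainTheorem1 (Ω : Set PlateSchwarz.Plane) (hΩ : PlateSchwarz.IsPolygonalDomain Ω)
    (ρ Cφ σ CH Cd : ℝ) (M Nc : ℕ) :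
    ∃ C : ℝ, 0 < C ∧
      ∀ (h H δ : ℝ) (J : ℕ), 0 < h → 0 < H → h ≤ δ → δ ≤ Metric.diam Ω →
      ∀ P : PlateSchwarz.PUM Ω, P.IsRegular h ρ Cφ σ M →
      ∀ (DD : PlateSchwarz.Decomposition P J H δ CH Cd Nc) (Nt : Set PlateSchwarz.Plane),
        Nt ⊆ P.nodeSet →
        (∀ j, Function.Bijective (PlateSchwarz.Aj DD Nt j)) ∧
        (⨆ μ : ℝ, Module.End.eigenspace (M := P.Vt Nt) (PlateSchwarz.BOLAh DD Nt) μ) = ⊤ ∧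
        (∀ μ : ℝ, Module.End.HasEigenvalue (M := P.Vt Nt) (PlateSchwarz.BOLAh DD Nt) μ → 0 < μ) ∧
        PlateSchwarz.condNumber (E := P.Vt Nt) (PlateSchwarz.BOLAh DD Nt) ≤ C * (δ ^ 4)⁻¹ := by
  obtain ⟨ℓ, hℓ, hseg⟩ := hΩ.exists_boundary_segment
  set d := Metric.diam Ω with hd
  -- The mesh size need not be small against the boundary segments. Since $h\le\delta\le d$, this
  -- $\kappa$ bounds $2\rho h/\ell$ by data of $\Omega$ and $\rho$ alone.
  set κ : ℝ := max 1 (2 * (ρ * d) / ℓ) with hκd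
  set K : ℝ := ((M * (9 * Nc) : ℕ) : ℝ) with hK
  set c : ℝ := 4 * (PlateSchwarz.interpConst ρ Cφ σ κ M * (Nc * (705 * Cd ^ 2 * d ^ 4))) with hc
  have hc0 : 0 ≤ c := by
    rw [hc]
    unfold PlateSchwarz.interpConst
    positivity
  have hK0 : 0 ≤ K := Nat.cast_nonneg _
  -- The two summands 1 keep $\Lambda$ and $C$ positive even when $c$ or $K$ vanishes.
  refine ⟨K * (c + 1) + 1, by positivity, ?_⟩
  intro h H δ J hh _ hhδ hδd P hP DD Nt _
  have hδ : 0 < δ := hh.trans_le hhδ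
  have hρ : 0 < ρ := by
    obtain ⟨z, hz⟩ := hΩ.isConnected.nonempty
    obtain ⟨i, -⟩ := mem_iUnion.1 (P.cover (subset_closure hz))
    exact hP.rho_pos P hh i
  have hκ : 2 * (ρ * h) ≤ κ * ℓ := by
    have h1 : 2 * (ρ * h) ≤ 2 * (ρ * d) := by
      have := mul_le_mul_of_nonneg_left (hhδ.trans hδd) hρ.le
      linarith
    have h2 : 2 * (ρ * d) / ℓ * ℓ ≤ κ * ℓ := mul_le_mul_of_nonneg_right (le_max_right _ _) hℓ.le
    rw [div_mul_cancel₀ _ hℓ.ne'] at h2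
    exact h1.trans h2
  obtain ⟨h1, h2, h3, h4⟩ := PlateSchwarz.schwarz_bound DD Nt (K := K) (Λ := (c + 1) * (δ ^ 4)⁻¹)
    (fun v hv hne => PlateSchwarz.plateForm_pos hΩ (hδ.trans_le hδd) hv.1 hne) hK0 (by positivity)
    (fun w hw => PlateSchwarz.plateForm_sum_le hP DD fun j => (hw j).2) fun v hv => by
      obtain ⟨w, hw, hvw, hle⟩ := PlateSchwarz.exists_stable_decomposition hP DD hΩ hh hhδ hδd hρ hℓ
        (le_max_left 1 (2 * (ρ * d) / ℓ)) hκ hseg Nt hv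
      refine ⟨w, hw, hvw, hle.trans ?_⟩
      have h5 := PlateSchwarz.plateForm_self_nonneg Ω v
      have h6 : 4 * (PlateSchwarz.interpConst ρ Cφ σ κ M *
          (Nc * (705 * Cd ^ 2 * d ^ 4 * (δ ^ 4)⁻¹) * PlateSchwarz.plateForm Ω v v)) =
          c * ((δ ^ 4)⁻¹ * PlateSchwarz.plateForm Ω v v) := by
        rw [hc]; ring
      have h7 : 0 ≤ (δ ^ 4)⁻¹ * PlateSchwarz.plateForm Ω v v := by positivity
      refine h6.trans_le ?_
      rw [mul_assoc (c + 1)]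
      exact mul_le_mul_of_nonneg_right (by linarith) h7
  refine ⟨h1, h2, h3, h4.trans ?_⟩
  have h8 : 0 ≤ (δ ^ 4)⁻¹ := by positivity
  rw [← mul_assoc]
  exact mul_le_mul_of_nonneg_right (by linarith) h8
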